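/- Let $N\ge 1$ and $1\le p\le\infty$, with $(N,p)\ne(1,1)$, let $\Omega\subseteq\mathbb R^N$ be open, $T>0$, and $\Omega_T=\Omega\times(0,T)$. **The heat $p$-mean.** Let $\Phi(y,s)=(4\pi s)^{-N/2}e^{-|y|^2/(4s)}$ for $s>0$ and $\Phi(y,s)=0$ for $s\le 0$. For $(x,t)\in\mathbb R^N\times\mathbb R$ and $\varepsilon>0$ let $$E_\varepsilon(x,t)=\{(y,s)\in\mathbb R^{N+1}: s<t,\ \Phi(x-y,t-s)>\varepsilon^{-N}\},\qquad d\nu(y,s)=\frac{|x-y|^2}{(t-s)^2}\,dy\,ds .$$ For $\varphi\in C(\overline{E_\varepsilon(x,t)})$ let $\pi_p(\varepsilon,\varphi)(x,t)$ be the unique real number $\pi$ with $$\|\varphi-\pi\|_{L^p(E_\varepsilon(x,t),\nu)}=\min_{\lambda\in\mathbb R}\|\varphi-\lambda\|_{L^p(E_\varepsilon(x,t),\nu)} .$$ **The operator.** Let $\nabla$ and $\nabla^2$ be the gradient and the Hessian in the space variable, and $$\Delta_p^n\varphi=\frac{\nabla\cdot(|\nabla\varphi|^{p-2}\nabla\varphi)}{|\nabla\varphi|^{p-2}}\quad(1\le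 p<\infty),\qquad \Delta_\infty^n\varphi=\frac{\langle\nabla^2\varphi\,\nabla\varphi,\nabla\varphi\rangle}{|\nabla\varphi|^2}.$$ For $p=\infty$ the expression $\frac{N}{N+p-2}\Delta_p^n\varphi$ means its limit as $p\to\infty$, that is, $N\,\Delta_\infty^n\varphi$. **Test functions.** Let $u\in C(\Omega_T)$ and $(x,t)\in\Omega_T$. A lower (respectively upper) test function for $u$ at $(x,t)$ is a function $\varphi$ of class $C^2$ near $(x,t)$ such that $u-\varphi$ has a strict local minimum (respectively maximum) at $(x,t)$, $u(x,t)=\varphi(x,t)$ and $\nabla\varphi(x,t)\neq0$. * $u$ is a *viscosity solution* of $u_t=\frac{N}{N+p-2}\Delta_p^n u$ in $\Omega_T$ if, at every $(x,t)\in\Omega_T$, $\frac{N}{N+p-2}\Delta_p^n\varphi(x,t)\le\varphi_t(x,t)$ for every lower test function $\varphi$, and $\frac{N}{N+p-2}\Delta_p^n\varphi(x,t)\ge\varphi_t(x,t)$ for every upper test function $\varphi$. * $u(x,t)=\pi_p(\varepsilon,u)(x,t)+o(\varepsilon^2)$ *in the viscosity sense* at $(x,t)$ if, as $\varepsilon\to0^+$,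 $\varphi(x,t)\ge\pi_p(\varepsilon,\varphi)(x,t)+o(\varepsilon^2)$ for every lower test function $\varphi$, and $\varphi(x,t)\le\pi_p(\varepsilon,\varphi)(x,t)+o(\varepsilon^2)$ for every upper test function $\varphi$. **Theorem 1.2.** The number $\pi_p(\varepsilon,\varphi)(x,t)$ is well defined: for all $(x,t)\in\mathbb R^{N}\times\mathbb R$, $\varepsilon>0$ and $\varphi\in C(\overline{E_\varepsilon(x,t)})$ the minimizer exists and is unique. Moreover, for $u\in C(\Omega_T)$ the following assertions are equivalent: 1. $u$ is a viscosity solution of $u_t=\frac{N}{N+p-2}\Delta_p^n u$ in $\Omega_T$; 2. $u(x,t)=\pi_p(\varepsilon,u)(x,t)+o(\varepsilon^2)$ as $\varepsilon\to0^+$ in the viscosity sense for every $(x,t)\in\Omega_T$. -/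

import Mathlib

open scoped ENNReal Topology

noncomputable section

namespace HeatMean

/-- The Euclidean space `ℝ^N`. -/
abbrev Space (N : ℕ) : Type := EuclideanSpace ℝ (Fin N)

variable {N : ℕ}

/-! ### The heat ball and the heat `p`-mean -/

/-- The fundamental solution `Φ(y, s)` of the heat equation in `ℝ^N × ℝ`,
extended by zero to `s ≤ 0`. -/
def heatKernel (y : Space N) (s : ℝ) : ℝ :=
  if 0 < s then (4 * Real.pi * s) ^ (-(N : ℝ) / 2) * Real.exp (-‖y‖ ^ 2 / (4 * s)) else 0

/-- The heat ball `E_ε(x, t) = {(y, s) : s < t, Φ(x - y, t - s) > ε^{-N}}`. -/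
def heatBall (ε : ℝ) (x : Space N) (t : ℝ) : Set (Space N × ℝ) :=
  {q | q.2 < t ∧ (ε ^ N)⁻¹ < heatKernel (x - q.1) (t - q.2)}

/-- The measure `|x - y|² / (t - s)² dy ds` on the heat ball `E_ε(x, t)`. -/
def heatMeasure (ε : ℝ) (x : Space N) (t : ℝ) : MeasureTheory.Measure (Space N × ℝ) :=
  (MeasureTheory.volume.restrict (heatBall ε x t)).withDensity
    (fun q => ENNReal.ofReal (‖x - q.1‖ ^ 2 / (t - q.2) ^ 2))

/-- `m` is a best constant approximation of `φ` in `L^p(E_ε(x, t), ν)`, that is, it minimizes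
`‖φ - l‖_{L^p(E_ε(x, t), ν)}` over all real constants `l`. -/
def IsBestConstant (p : ℝ≥0∞) (ε : ℝ) (φ : Space N × ℝ → ℝ) (x : Space N) (t m : ℝ) : Prop :=
  ∀ l : ℝ, MeasureTheory.eLpNorm (fun q => φ q - m) p (heatMeasure ε x t) ≤
    MeasureTheory.eLpNorm (fun q => φ q - l) p (heatMeasure ε x t)

/-- The heat `p`-mean `π_p(ε, φ)(x, t)`: the best constant approximation of `φ` in
`L^p(E_ε(x, t), ν)`. -/
def heatPMean (p : ℝ≥0∞) (ε : ℝ) (φ : Space N × ℝ → ℝ) (x : Space N) (t : ℝ) : ℝ :=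
  Classical.epsilon (IsBestConstant p ε φ x t)

/-! ### The normalized `p`-Laplace operator -/

/-- The divergence of a vector field on `ℝ^N`. -/
def divergence (F : Space N → Space N) (x : Space N) : ℝ :=
  ∑ i, fderiv ℝ F x (EuclideanSpace.single i 1) i

/-- The normalized `p`-Laplacian `div (|∇f|^{p-2} ∇f) / |∇f|^{p-2}`, for finite `p`. -/
def normalizedPLaplacian (p : ℝ) (f : Space N → ℝ) (x : Space N) : ℝ :=
  divergence (fun y => ‖gradient f y‖ ^ (p - 2) • gradient f y) x / ‖gradient f x‖ ^ (p - 2)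

/-- The normalized infinity Laplacian `⟨∇²f ∇f, ∇f⟩ / |∇f|²`. -/
def normalizedInftyLaplacian (f : Space N → ℝ) (x : Space N) : ℝ :=
  inner ℝ (fderiv ℝ (gradient f) x (gradient f x)) (gradient f x) / ‖gradient f x‖ ^ 2

/-- The operator `N / (N + p - 2) Δ_p^n`; for `p = ∞` it is the limit of these operators
as `p → ∞`, namely `N Δ_∞^n`. -/
def scaledPLaplacian (p : ℝ≥0∞) (f : Space N → ℝ) (x : Space N) : ℝ :=
  if p = ∞ then (N : ℝ) * normalizedInftyLaplacian f x
  else (N : ℝ) / ((N : ℝ) + p.toReal - 2) * normalizedPLaplacian p.toReal f x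

/-- The gradient of `φ` in the space variable. -/
def spatialGradient (φ : Space N × ℝ → ℝ) (x : Space N) (t : ℝ) : Space N :=
  gradient (fun y => φ (y, t)) x

/-- The derivative of `φ` in the time variable. -/
def timeDeriv (φ : Space N × ℝ → ℝ) (x : Space N) (t : ℝ) : ℝ :=
  deriv (fun s => φ (x, s)) t

/-! ### Test functions, viscosity solutions, viscosity mean value property -/

/-- `φ` is `C²` near `(x, t)`, `u - φ` has a strict (local) minimum at `(x, t)`,
`u(x, t) = φ(x, t)` and `∇φ(x, t) ≠ 0`. -/
def IsLowerTest (u φ : Space N × ℝ → ℝ) (x : Space N) (t : ℝ) : Prop :=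
  ContDiffAt ℝ 2 φ (x, t) ∧
  (∀ᶠ q in 𝓝[≠] (x, t), u (x, t) - φ (x, t) < u q - φ q) ∧
  u (x, t) = φ (x, t) ∧ spatialGradient φ x t ≠ 0

/-- `φ` is `C²` near `(x, t)`, `u - φ` has a strict (local) maximum at `(x, t)`,
`u(x, t) = φ(x, t)` and `∇φ(x, t) ≠ 0`. -/
def IsUpperTest (u φ : Space N × ℝ → ℝ) (x : Space N) (t : ℝ) : Prop :=
  ContDiffAt ℝ 2 φ (x, t) ∧
  (∀ᶠ q in 𝓝[≠] (x, t), u q - φ q < u (x, t) - φ (x, t)) ∧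
  u (x, t) = φ (x, t) ∧ spatialGradient φ x t ≠ 0

/-- The continuous function `u` is a viscosity solution of `u_t = N / (N + p - 2) Δ_p^n u`
in `Ω × (0, T)`. -/
def IsViscositySolution (p : ℝ≥0∞) (Ω : Set (Space N)) (T : ℝ) (u : Space N × ℝ → ℝ) : Prop :=
  ∀ x ∈ Ω, ∀ t ∈ Set.Ioo 0 T,
    (∀ φ, IsLowerTest u φ x t →
      scaledPLaplacian p (fun y => φ (y, t)) x ≤ timeDeriv φ x t) ∧
    (∀ φ, IsUpperTest u φ x t →
      timeDeriv φ x t ≤ scaledPLaplacian p (fun y => φ (y, t)) x)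

/-- The asymptotic mean value property `u(x, t) = π_p(ε, u)(x, t) + o(ε²)` as `ε → 0⁺`,
in the viscosity sense at `(x, t)`. -/
def ViscosityAMVP (p : ℝ≥0∞) (u : Space N × ℝ → ℝ) (x : Space N) (t : ℝ) : Prop :=
  (∀ φ, IsLowerTest u φ x t →
    ∃ r : ℝ → ℝ, Asymptotics.IsLittleO (𝓝[>] (0 : ℝ)) r (fun ε => ε ^ 2) ∧
      ∀ᶠ ε in 𝓝[>] (0 : ℝ), φ (x, t) ≥ heatPMean p ε φ x t + r ε) ∧
  (∀ φ, IsUpperTest u φ x t →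
    ∃ r : ℝ → ℝ, Asymptotics.IsLittleO (𝓝[>] (0 : ℝ)) r (fun ε => ε ^ 2) ∧
      ∀ᶠ ε in 𝓝[>] (0 : ℝ), φ (x, t) ≤ heatPMean p ε φ x t + r ε)

end HeatMean

end

/-!
In the parabolic coordinates `(x + R y, t - R²)`, `R = ε r γ(y)`, with `γ(y)^N = Φ(y, 1)`, every
heat ball becomes `ℝ^N × (0, 1)` and `ν` becomes `ε^N` times the fixed finite product measure `|y|²
γ^N dy ⊗ 2 r^{N-1} dr` (`heatMeasure_eq`). A function of class `C²` with gradient `a`, Hessian `H`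
and time derivative `θ` at `(x, t)` turns into `φ(x, t) + ε s + ε² Q + o(ε²)`, uniformly, where `s
= r γ ⟨a, y⟩` and `Q = r² γ² (½ ⟨H y, y⟩ - θ)` (`hasParabolicExpansion_of_contDiffAt`).

Existence of the mean is coercivity. Uniqueness is comparison of two minimizers with their
midpoint; for finite `p` the argument uses that the domain is connected and that the measure is
positive on open sets, without which it fails for `p = 1` (`existsUnique_isBestConst`).

The equivalence rests on a one-sided estimate: with `L` the value of the operator on `(a, H)`, the
best constant of `s + ε Q + o(ε)` is at most `ε c (L - θ) + o(ε)` for some `c > 0`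
(`exists_upperBound`). Applied to `φ` and to `-φ` it says that `π_p(ε, φ) - φ(x, t)` has, at order
`ε²`, the sign of the defect `L - θ` (`exists_heatPMean_bounds`), which gives both implications for
each test function.

The estimate has three cases.

* For `1 < p < ∞` the sign of `∫ sgn(f - l) |f - l|^{p-1}` locates the best constant. For `f = s +
  ε Q`, `l = ε k` this integral vanishes at `ε = 0` since `s` is odd, and its derivative there is
  `(p - 1) ∫ |s|^{p-2} (Q - k)`. The weight may be singular but is integrable, and the Gaussian
  moments with weight `|⟨a, y⟩|^{p-2}` give `∫ |s|^{p-2} Q = 0` for `θ = L`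
  (`exists_upperBound_of_one_lt`).
* For `p = 1` the integrand is `sgn(s + ε (Q - k))`. Symmetrized under `y ↦ -y` it lives on `|s| ≤
  ε |Q - k|`; after stretching the coordinate along `a` by `1 / ε`, dominated convergence produces
  an integral over the hyperplane orthogonal to `a`, where again Gaussian moments apply. The decay
  needed for this uses `N ≥ 2` (`exists_upperBound_one`).
* For `p = ∞` the best constant is the midrange. On the closed domain `s` has its maximum and
  minimum at the antipodal points `r = 1`, `y = ± √(2N) a / |a|`, and `Q` takes there one and the
  same value, a positive multiple of `L - θ` (`exists_upperBound_top`).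
-/

section

open MeasureTheory Set Filter

namespace HeatMean

/-! ### Parabolic coordinates on the heat ball -/

section Chart

variable {N : ℕ}

/-- The profile `γ(y) = (4π)^{-1/2} exp(-|y|² / (4N))`, so that `Φ(y, 1) = γ(y)^N`. -/
noncomputable def profile (y : Space N) : ℝ :=
  Real.exp (-‖y‖ ^ 2 / (4 * N)) / √(4 * Real.pi)

lemma profile_pos (y : Space N) : 0 < profile y := by
  unfold profile; positivity

lemma continuous_profile : Continuous (profile : Space N → ℝ) := by
  unfold profile; fun_prop

@[fun_prop]
lemma measurable_profile : Measurable (profile : Space N → ℝ) := continuous_profile.measurable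

lemma profile_neg (y : Space N) : profile (-y) = profile y := by simp [profile]

/-- Parabolic coordinates on the heat ball: `(y, r) ↦ (x + R y, t - R²)` with `R = ε r γ(y)`. -/
noncomputable def chart (ε : ℝ) (x : Space N) (t : ℝ) (q : Space N × ℝ) : Space N × ℝ :=
  (x + (ε * (q.2 * profile q.1)) • q.1, t - (ε * (q.2 * profile q.1)) ^ 2)

/-- The parameter domain `ℝ^N × (0, 1)` of the parabolic coordinates. -/
def chartDomain (N : ℕ) : Set (Space N × ℝ) := univ ×ˢ Ioo 0 1

lemma continuous_chart (ε : ℝ) (x : Space N) (t : ℝ) : Continuous (chart ε x t) := by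
  unfold chart
  have := continuous_profile (N := N)
  fun_prop

/-- On the parabolic curve `R ↦ (x + R y, t - R²)` the kernel is `(γ(y) / R)^N`, so the heat ball
cuts out the interval `R < ε γ(y)`. -/
lemma mem_heatBall_iff (hN : 1 ≤ N) {ε : ℝ} (hε : 0 < ε) (x y : Space N) (t : ℝ) {R : ℝ}
    (hR : 0 < R) : (x + R • y, t - R ^ 2) ∈ heatBall ε x t ↔ R < ε * profile y := by
  have hN' : (N : ℝ) ≠ 0 := by positivity
  have hR2 : 0 < R ^ 2 := by positivity
  have hpi := Real.pi_pos
  have h1 : (4 * Real.pi * R ^ 2) ^ (-(N : ℝ) / 2) = ((√(4 * Real.pi) * R) ^ N)⁻¹ := by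
    have : 4 * Real.pi * R ^ 2 = (√(4 * Real.pi) * R) ^ (2 : ℝ) := by
      rw [Real.rpow_two, mul_pow, Real.sq_sqrt (by positivity)]
    rw [this, ← Real.rpow_mul (by positivity), ← Real.rpow_natCast, ← Real.rpow_neg (by positivity)]
    congr 1; ring
  have h2 : Real.exp (-‖R • y‖ ^ 2 / (4 * R ^ 2)) = Real.exp (-‖y‖ ^ 2 / (4 * N)) ^ N := by
    rw [← Real.exp_nat_mul, norm_smul, mul_pow, Real.norm_eq_abs, sq_abs]
    congr 1
    field_simp
  have h3 : heatKernel (x - (x + R • y)) (t - (t - R ^ 2)) = (profile y / R) ^ N := by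
    rw [heatKernel, sub_sub_cancel, if_pos hR2, h1, sub_add_cancel_left, norm_neg, h2, profile]
    rw [← inv_pow, ← mul_pow]
    congr 1
    field_simp
  have h4 : t - R ^ 2 < t := by linarith
  simp only [heatBall, mem_ofPred_eq, h3, h4, true_and]
  rw [← inv_pow, pow_lt_pow_iff_left₀ (by positivity)
    (div_nonneg (profile_pos y).le hR.le) (by lia), lt_div_iff₀ hR, inv_mul_lt_iff₀ hε]

/-- The weight `|y|² γ(y)^N dy` in the variable `y`. -/
noncomputable def spaceWeight (N : ℕ) : Measure (Space N) :=
  volume.withDensity fun y => ENNReal.ofReal (‖y‖ ^ 2 * profile y ^ N)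

/-- The weight `2 r^{N-1} dr` on `(0, 1)`. -/
noncomputable def radialWeight (N : ℕ) : Measure ℝ :=
  (volume.restrict (Ioo 0 1)).withDensity fun r => ENNReal.ofReal (2 * r ^ (N - 1))

/-- The measure `ν` on the heat ball in parabolic coordinates, up to the factor `ε^N`. -/
noncomputable def chartMeasure (N : ℕ) : Measure (Space N × ℝ) :=
  (spaceWeight N).prod (radialWeight N)

instance : SFinite (spaceWeight N) := by unfold spaceWeight; infer_instance

instance : SFinite (radialWeight N) := by unfold radialWeight; infer_instance

lemma lintegral_affine (F : Space N → ℝ≥0∞) (x : Space N) {R : ℝ} (hR : 0 < R) :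
    ∫⁻ z, F z = ENNReal.ofReal (R ^ N) * ∫⁻ y, F (x + R • y) := by
  rw [← lintegral_add_left_eq_self (μ := volume) F x]
  have h := lintegral_map_equiv (μ := (volume : Measure (Space N))) (fun z => F (x + z))
    (MeasurableEquiv.smul₀ R hR.ne')
  have h2 : Measure.map (MeasurableEquiv.smul₀ R hR.ne') (volume : Measure (Space N)) =
      Measure.map (R • ·) volume := rfl
  rw [h2, Measure.map_addHaar_smul _ hR.ne'] at h
  simp only [lintegral_smul_measure, finrank_euclideanSpace, Fintype.card_fin,
    MeasurableEquiv.coe_smul₀] at h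
  rw [← h, smul_eq_mul, ← mul_assoc, ← ENNReal.ofReal_mul (by positivity),
    abs_of_pos (by positivity), mul_inv_cancel₀ (by positivity)]
  simp

/-- The substitution `s = t - (c r)²`. -/
lemma lintegral_quadratic_subst (k : ℝ → ℝ≥0∞) (t : ℝ) {c : ℝ} (hc : 0 < c) :
    ∫⁻ s in Ioo (t - c ^ 2) t, k s =
      ∫⁻ r in Ioo 0 1, ENNReal.ofReal (2 * c ^ 2 * r) * k (t - (c * r) ^ 2) := by
  have himg : (fun r => t - (c * r) ^ 2) '' Ioo 0 1 = Ioo (t - c ^ 2) t := by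
    ext s
    constructor
    · rintro ⟨r, ⟨h0, h1⟩, rfl⟩
      have : 0 < c * r := by positivity
      have h3 : c * r < c := by nlinarith
      constructor
      · have := pow_lt_pow_left₀ h3 this.le two_ne_zero
        simp only; linarith
      · have : 0 < (c * r) ^ 2 := by positivity
        simp only; linarith
    · rintro ⟨h0, h1⟩
      have hs : 0 < √(t - s) := Real.sqrt_pos.2 (by linarith)
      refine ⟨√(t - s) / c, ⟨by positivity, ?_⟩, ?_⟩
      · rw [div_lt_one hc, Real.sqrt_lt' hc]; linarith
      · simp only
        rw [mul_div_cancel₀ _ hc.ne', Real.sq_sqrt (by linarith)]; ring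
  rw [← himg, lintegral_image_eq_lintegral_abs_deriv_mul measurableSet_Ioo
    (f' := fun r => -(2 * c ^ 2 * r))]
  · refine setLIntegral_congr_fun measurableSet_Ioo fun r hr => ?_
    rw [abs_neg, abs_of_pos (by have := hr.1; positivity)]
  · intro r _
    have := (((hasDerivAt_id r).const_mul c).pow 2).const_sub t
    refine (HasDerivAt.congr_deriv this ?_).hasDerivWithinAt
    simp; ring
  · intro r hr r' hr' h
    have h1 : (c * r) ^ 2 = (c * r') ^ 2 := by simpa using h
    have h2 := (pow_left_inj₀ (by have := hr.1; positivity) (by have := hr'.1; positivity)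
      two_ne_zero).1 h1
    exact mul_left_cancel₀ hc.ne' h2

lemma measurableSet_heatBall (ε : ℝ) (x : Space N) (t : ℝ) : MeasurableSet (heatBall ε x t) := by
  have h : Measurable fun q : Space N × ℝ => heatKernel (x - q.1) (t - q.2) := by
    unfold heatKernel
    refine Measurable.ite (measurableSet_lt (by fun_prop) (by fun_prop)) ?_ measurable_const
    fun_prop
  exact (measurableSet_lt measurable_snd measurable_const).inter
    (measurableSet_lt measurable_const h)

lemma lintegral_heatMeasure (hN : 1 ≤ N) {ε : ℝ} (hε : 0 < ε) (x : Space N) (t : ℝ)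
    (f : Space N × ℝ → ℝ≥0∞) (hf : Measurable f) :
    ∫⁻ q, f q ∂(heatMeasure ε x t) =
      ENNReal.ofReal (ε ^ N) * ∫⁻ q, f (chart ε x t q) ∂(chartMeasure N) := by
  have hw : Measurable fun q : Space N × ℝ => ENNReal.ofReal (‖x - q.1‖ ^ 2 / (t - q.2) ^ 2) := by
    fun_prop
  have hE := measurableSet_heatBall ε x t
  rw [heatMeasure, lintegral_withDensity_eq_lintegral_mul _ hw hf, ← lintegral_indicator hE,
    Measure.volume_eq_prod, lintegral_prod_symm' _ ((hw.mul hf).indicator hE)]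
  -- `K` is the integrand after the substitution `q = (x + √(t - s) y, s)` for fixed `s`
  set K : Space N → ℝ → ℝ≥0∞ := fun y s =>
    (Ioo (t - (ε * profile y) ^ 2) t).indicator (fun s =>
      ENNReal.ofReal (√(t - s) ^ N * (‖y‖ ^ 2 / (t - s))) * f (x + √(t - s) • y, s)) s with hK
  have hKm : Measurable (Function.uncurry K) := by
    have : Function.uncurry K = indicator
        {q : Space N × ℝ | t - (ε * profile q.1) ^ 2 < q.2 ∧ q.2 < t}
        (fun q => ENNReal.ofReal (√(t - q.2) ^ N * (‖q.1‖ ^ 2 / (t - q.2))) *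
          f (x + √(t - q.2) • q.1, q.2)) := by
      ext ⟨y, s⟩
      simp only [hK, Function.uncurry, indicator, mem_Ioo, mem_ofPred_eq]
    rw [this]
    refine Measurable.indicator (by fun_prop) ?_
    exact (measurableSet_lt (f := fun q : Space N × ℝ => t - (ε * profile q.1) ^ 2)
      (by fun_prop) measurable_snd).inter (measurableSet_lt measurable_snd measurable_const)
  have hslice : ∀ s, ∫⁻ z, (heatBall ε x t).indicator
      ((fun q : Space N × ℝ => ENNReal.ofReal (‖x - q.1‖ ^ 2 / (t - q.2) ^ 2)) * f) (z, s) =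
      ∫⁻ y, K y s := by
    intro s
    rcases le_or_gt t s with hs | hs
    · have h1 : ∀ z, (z, s) ∉ heatBall ε x t := fun z h => absurd h.1 (not_lt.2 hs)
      have h2 : ∀ y, s ∉ Ioo (t - (ε * profile (N := N) y) ^ 2) t := fun y h =>
        absurd h.2 (not_lt.2 hs)
      simp [hK, h1, h2]
    · have hR : 0 < √(t - s) := Real.sqrt_pos.2 (by linarith)
      have hR2 : √(t - s) ^ 2 = t - s := Real.sq_sqrt (by linarith)
      rw [lintegral_affine _ x hR, ← lintegral_const_mul' _ _ ENNReal.ofReal_ne_top]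
      refine lintegral_congr fun y => ?_
      have hiff := mem_heatBall_iff hN hε x y t hR
      have hs' : t - √(t - s) ^ 2 = s := by rw [hR2]; ring
      rw [hs'] at hiff
      have hiff2 : s ∈ Ioo (t - (ε * profile y) ^ 2) t ↔ √(t - s) < ε * profile y := by
        rw [Real.sqrt_lt' (mul_pos hε (profile_pos y)), mem_Ioo]
        constructor
        · rintro ⟨h, _⟩; linarith
        · intro h; exact ⟨by linarith, hs⟩
      by_cases h : √(t - s) < ε * profile y
      · simp only [hK]
        rw [indicator_of_mem (hiff.2 h), indicator_of_mem (hiff2.2 h), Pi.mul_apply, ← mul_assoc,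
          ← ENNReal.ofReal_mul (by positivity)]
        congr 2
        simp only [sub_add_cancel_left, norm_neg, norm_smul, mul_pow, Real.norm_eq_abs, sq_abs, hR2]
        have : t - s ≠ 0 := by linarith
        field_simp
      · simp only [hK]
        rw [indicator_of_notMem (mt hiff.1 h), indicator_of_notMem (mt hiff2.1 h), mul_zero]
  simp_rw [hslice]
  have hcm : Measurable fun q => f (chart ε x t q) := hf.comp (continuous_chart ε x t).measurable
  rw [lintegral_lintegral_swap (f := fun s y => K y s) (hKm.comp measurable_swap).aemeasurable,
    chartMeasure, lintegral_prod (fun q => f (chart ε x t q))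
      hcm.aemeasurable, spaceWeight, radialWeight]
  rw [lintegral_withDensity_eq_lintegral_mul _ (by fun_prop)
    hcm.lintegral_prod_right',
    ← lintegral_const_mul' _ _ ENNReal.ofReal_ne_top]
  refine lintegral_congr fun y => ?_
  -- for fixed `y`, substitute `s = t - (ε γ(y) r)²`
  have hc : 0 < ε * profile y := mul_pos hε (profile_pos y)
  have hmf : Measurable fun r => f (chart ε x t (y, r)) :=
    hf.comp ((continuous_chart ε x t).measurable.comp (by fun_prop))
  rw [Pi.mul_apply, lintegral_withDensity_eq_lintegral_mul _ (by fun_prop) hmf, hK,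
    lintegral_indicator measurableSet_Ioo, lintegral_quadratic_subst _ t hc,
    ← lintegral_const_mul' _ _ ENNReal.ofReal_ne_top,
    ← lintegral_const_mul' _ _ ENNReal.ofReal_ne_top]
  refine setLIntegral_congr_fun measurableSet_Ioo fun r hr => ?_
  have hr0 := hr.1
  have hγ := profile_pos y
  have e1 : √(t - (t - (ε * profile y * r) ^ 2)) = ε * (r * profile y) := by
    rw [sub_sub_cancel, Real.sqrt_sq (by positivity)]; ring
  have e2 : (ε * profile y * r) ^ 2 = (ε * (r * profile y)) ^ 2 := by ring
  simp only [Pi.mul_apply, e1, chart]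
  rw [e2]
  simp only [← mul_assoc]
  rw [← ENNReal.ofReal_mul (by positivity), ← ENNReal.ofReal_mul (by positivity),
    ← ENNReal.ofReal_mul (by positivity)]
  congr 2
  obtain ⟨n, rfl⟩ : ∃ n, N = n + 1 := ⟨N - 1, by lia⟩
  rw [sub_sub_cancel, Nat.add_sub_cancel]
  field_simp
  ring

/-- In parabolic coordinates the measure `ν` on the heat ball becomes a product measure. -/
theorem heatMeasure_eq (hN : 1 ≤ N) {ε : ℝ} (hε : 0 < ε) (x : Space N) (t : ℝ) :
    heatMeasure ε x t =
      ENNReal.ofReal (ε ^ N) • (chartMeasure N).map (chart ε x t) := by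
  have hm := (continuous_chart ε x t).measurable
  ext s hs
  rw [← lintegral_indicator_one hs, lintegral_heatMeasure hN hε x t _ (measurable_one.indicator hs),
    Measure.smul_apply, Measure.map_apply hm hs, ← lintegral_indicator_one (hm hs), smul_eq_mul]
  rfl

end Chart

/-! ### Gaussian moments of monomials with real exponents -/

lemma integrable_abs_rpow_mul_gaussian {a b : ℝ} (ha : -1 < a) (hb : 0 < b) :
    Integrable fun t : ℝ => |t| ^ a * Real.exp (-b * t ^ 2) := by
  have h := (integrable_indicator_iff measurableSet_Ioi).2
    (integrableOn_rpow_mul_exp_neg_mul_sq hb ha)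
  refine (h.add h.comp_neg).congr ?_
  filter_upwards [Measure.ae_ne volume (0 : ℝ)] with t ht
  rcases lt_or_gt_of_ne ht with h0 | h0
  · simp [indicator, h0, h0.not_gt, abs_of_neg h0]
  · simp [indicator, h0, h0.not_gt, abs_of_pos h0]

lemma integral_abs_rpow_mul_gaussian_eq {a b : ℝ} (ha : -1 < a) (hb : 0 < b) :
    ∫ t : ℝ, |t| ^ a * Real.exp (-b * t ^ 2) =
      b ^ (-(a + 1) / 2) * Real.Gamma ((a + 1) / 2) := by
  have h : ∀ t : ℝ, |t| ^ a * Real.exp (-b * t ^ 2) =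
      (fun s => s ^ a * Real.exp (-b * s ^ (2 : ℝ))) |t| := by intro t; simp
  rw [integral_congr_ae (ae_of_all _ h), integral_comp_abs
    (f := fun s => s ^ a * Real.exp (-b * s ^ (2 : ℝ))),
    integral_rpow_mul_exp_neg_mul_rpow two_pos ha hb]
  ring

lemma integral_abs_rpow_add_two_mul_gaussian {a b : ℝ} (ha : -1 < a) (hb : 0 < b) :
    ∫ t : ℝ, |t| ^ (a + 2) * Real.exp (-b * t ^ 2) =
      (a + 1) / (2 * b) * ∫ t : ℝ, |t| ^ a * Real.exp (-b * t ^ 2) := by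
  rw [integral_abs_rpow_mul_gaussian_eq (by linarith) hb, integral_abs_rpow_mul_gaussian_eq ha hb]
  have h1 : (a + 2 + 1) / 2 = (a + 1) / 2 + 1 := by ring
  have h2 : -(a + 2 + 1) / 2 = -(a + 1) / 2 - 1 := by ring
  rw [h1, h2, Real.Gamma_add_one (by linarith), Real.rpow_sub_one hb.ne']
  field_simp

/-- The exponents `a` with the `i`-th one raised by two. -/
def raiseTwo {ι : Type*} [DecidableEq ι] (a : ι → ℝ) (i : ι) : ι → ℝ :=
  fun k => a k + if k = i then 2 else 0

lemma neg_one_lt_raiseTwo {ι : Type*} [DecidableEq ι] {a : ι → ℝ} (ha : ∀ k, -1 < a k) (i : ι) :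
    ∀ k, -1 < raiseTwo a i k := by
  intro k
  have := ha k
  unfold raiseTwo
  split_ifs <;> linarith

section GaussianMoments

variable {ι : Type*} [Fintype ι]

/-- The Gaussian `∏ exp(-b y_k²)` times the monomial `∏ |y_k|^{a_k}` with real exponents. -/
noncomputable def gaussMonomial (b : ℝ) (a : ι → ℝ) (y : ι → ℝ) : ℝ :=
  ∏ k, (|y k| ^ a k * Real.exp (-b * y k ^ 2))

lemma gaussMonomial_nonneg (b : ℝ) (a : ι → ℝ) (y : ι → ℝ) : 0 ≤ gaussMonomial b a y := by
  unfold gaussMonomial; positivity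

lemma integrable_gaussMonomial {b : ℝ} (hb : 0 < b) {a : ι → ℝ} (ha : ∀ k, -1 < a k) :
    Integrable (gaussMonomial b a) :=
  Integrable.fintype_prod (f := fun k t => |t| ^ a k * Real.exp (-b * t ^ 2))
    fun k => integrable_abs_rpow_mul_gaussian (ha k) hb

lemma integral_gaussMonomial (b : ℝ) (a : ι → ℝ) :
    ∫ y, gaussMonomial b a y = ∏ k, ∫ t : ℝ, |t| ^ a k * Real.exp (-b * t ^ 2) :=
  integral_fintype_prod_volume_eq_prod (fun k t => |t| ^ a k * Real.exp (-b * t ^ 2))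

variable [DecidableEq ι]

lemma sq_mul_gaussMonomial (b : ℝ) {a : ι → ℝ} (ha : ∀ k, -1 < a k) (i : ι) (y : ι → ℝ) :
    y i ^ 2 * gaussMonomial b a y = gaussMonomial b (raiseTwo a i) y := by
  unfold gaussMonomial
  rw [← Finset.mul_prod_erase _ _ (Finset.mem_univ i), ← Finset.mul_prod_erase Finset.univ
    (fun k => |y k| ^ raiseTwo a i k * Real.exp (-b * y k ^ 2)) (Finset.mem_univ i)]
  have h1 : y i ^ 2 * |y i| ^ a i = |y i| ^ (a i + 2) := by
    have := ha i
    rw [Real.rpow_add' (abs_nonneg _) (by linarith), Real.rpow_two, sq_abs, mul_comm]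
  rw [← mul_assoc, ← mul_assoc, h1]
  congr 1
  · simp [raiseTwo]
  · refine Finset.prod_congr rfl fun k hk => ?_
    simp [raiseTwo, Finset.ne_of_mem_erase hk]

lemma integral_sq_mul_gaussMonomial {b : ℝ} (hb : 0 < b) {a : ι → ℝ} (ha : ∀ k, -1 < a k)
    (i : ι) : ∫ y : ι → ℝ, y i ^ 2 * gaussMonomial b a y =
      (a i + 1) / (2 * b) * ∫ y, gaussMonomial b a y := by
  simp_rw [sq_mul_gaussMonomial b ha]
  rw [integral_gaussMonomial, integral_gaussMonomial,
    ← Finset.mul_prod_erase _ _ (Finset.mem_univ i), ← Finset.mul_prod_erase Finset.univ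
      (fun k => ∫ t : ℝ, |t| ^ a k * Real.exp (-b * t ^ 2)) (Finset.mem_univ i)]
  rw [← mul_assoc, ← integral_abs_rpow_add_two_mul_gaussian (ha i) hb]
  congr 1
  · simp [raiseTwo]
  · refine Finset.prod_congr rfl fun k hk => ?_
    simp [raiseTwo, Finset.ne_of_mem_erase hk]

lemma integrable_sq_mul_gaussMonomial {b : ℝ} (hb : 0 < b) {a : ι → ℝ} (ha : ∀ k, -1 < a k)
    (i : ι) : Integrable fun y : ι → ℝ => y i ^ 2 * gaussMonomial b a y := by
  simp_rw [sq_mul_gaussMonomial b ha]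
  exact integrable_gaussMonomial hb (neg_one_lt_raiseTwo ha i)

lemma integrable_mul_mul_gaussMonomial {b : ℝ} (hb : 0 < b) {a : ι → ℝ} (ha : ∀ k, -1 < a k)
    (i j : ι) : Integrable fun y : ι → ℝ => y i * y j * gaussMonomial b a y := by
  refine ((integrable_sq_mul_gaussMonomial hb ha i).add
    (integrable_sq_mul_gaussMonomial hb ha j)).mono ?_ (ae_of_all _ fun y => ?_)
  · have : Measurable (gaussMonomial b a) := by unfold gaussMonomial; fun_prop
    fun_prop
  · have h := gaussMonomial_nonneg b a y
    simp only [Pi.add_apply, Real.norm_eq_abs]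
    rw [← add_mul, abs_mul, abs_mul (y i ^ 2 + _), abs_of_nonneg h,
      abs_of_nonneg (a := y i ^ 2 + y j ^ 2) (by positivity), abs_mul]
    gcongr
    nlinarith [sq_abs (y i), sq_abs (y j), sq_nonneg (|y i| - |y j|), sq_nonneg (y i),
      sq_nonneg (y j)]

lemma integral_mul_mul_gaussMonomial_eq_zero (b : ℝ) (a : ι → ℝ)
    {i j : ι} (hij : i ≠ j) : ∫ y : ι → ℝ, y i * y j * gaussMonomial b a y = 0 := by
  have h : ∀ y : ι → ℝ, y i * y j * gaussMonomial b a y =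
      ∏ k, (fun k t => (if k = i then t else 1) * (if k = j then t else 1) *
        (|t| ^ a k * Real.exp (-b * t ^ 2))) k (y k) := by
    intro y
    simp only [Finset.prod_mul_distrib, gaussMonomial]
    simp
  rw [integral_congr_ae (ae_of_all _ h), integral_fintype_prod_volume_eq_prod
    (fun k t => (if k = i then t else 1) * (if k = j then t else 1) *
      (|t| ^ a k * Real.exp (-b * t ^ 2)))]
  refine Finset.prod_eq_zero (Finset.mem_univ i) ?_
  simp only [if_true, if_neg hij, mul_one]
  -- the factor belonging to `i` has an odd integrand
  have h2 := integral_neg_eq_self (fun t : ℝ => t * (|t| ^ a i * Real.exp (-b * t ^ 2))) volume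
  simp only [abs_neg, even_two.neg_pow, neg_mul, integral_neg] at h2 ⊢
  linarith

/-- The weighted integral of `|y|² (½ ∑ A_ij y_i y_j - l)` vanishes when `l` is the weighted trace
of `A` in `hl`: off-diagonal terms are odd, and raising an exponent by two multiplies the moment by
`(a_k + 1) / (2b)`. -/
theorem integral_normSq_mul_quadratic_gaussMonomial {b : ℝ} (hb : 0 < b) {a : ι → ℝ}
    (ha : ∀ k, -1 < a k) (A : ι → ι → ℝ) {l : ℝ}
    (hl : (∑ k, (a k + 1)) * l =
      (∑ k, (a k + 1) + 2) / (4 * b) * ∑ i, A i i * (a i + 1)) :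
    ∫ y : ι → ℝ, (∑ k, y k ^ 2) * (1 / 2 * (∑ i, ∑ j, A i j * (y i * y j)) - l) *
      gaussMonomial b a y = 0 := by
  have hk := neg_one_lt_raiseTwo ha
  have I1 : ∀ k, Integrable fun y : ι → ℝ => y k ^ 2 * gaussMonomial b a y :=
    integrable_sq_mul_gaussMonomial hb ha
  have I2 : ∀ k i j, Integrable fun y : ι → ℝ => y i * y j * (y k ^ 2 * gaussMonomial b a y) := by
    intro k i j
    simp_rw [sq_mul_gaussMonomial b ha]
    exact integrable_mul_mul_gaussMonomial hb (hk k) i j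
  have hsplit : ∀ y : ι → ℝ, (∑ k, y k ^ 2) * (1 / 2 * (∑ i, ∑ j, A i j * (y i * y j)) - l) *
      gaussMonomial b a y =
      ∑ k, ((∑ i, ∑ j, A i j / 2 * (y i * y j * (y k ^ 2 * gaussMonomial b a y))) -
        l * (y k ^ 2 * gaussMonomial b a y)) := by
    intro y
    rw [mul_assoc, Finset.sum_mul]
    refine Finset.sum_congr rfl fun k _ => ?_
    rw [show y k ^ 2 * ((1 / 2 * (∑ i, ∑ j, A i j * (y i * y j)) - l) * gaussMonomial b a y) =
      (1 / 2 * (∑ i, ∑ j, A i j * (y i * y j)) - l) * (y k ^ 2 * gaussMonomial b a y) by ring,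
      sub_mul, Finset.mul_sum, Finset.sum_mul]
    congr 1
    refine Finset.sum_congr rfl fun i _ => ?_
    rw [Finset.mul_sum, Finset.sum_mul]
    refine Finset.sum_congr rfl fun j _ => ?_
    ring
  simp_rw [hsplit]
  have I3 : ∀ k, Integrable fun y : ι → ℝ =>
      ∑ i, ∑ j, A i j / 2 * (y i * y j * (y k ^ 2 * gaussMonomial b a y)) := fun k =>
    integrable_finsetSum _ fun i _ => integrable_finsetSum _ fun j _ => (I2 k i j).const_mul _
  rw [integral_finsetSum _ fun k _ => by exact (I3 k).sub ((I1 k).const_mul l)]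
  set P := ∫ y, gaussMonomial b a y with hP
  have hval : ∀ k, ∫ y : ι → ℝ, ((∑ i, ∑ j, A i j / 2 * (y i * y j * (y k ^ 2 *
      gaussMonomial b a y))) - l * (y k ^ 2 * gaussMonomial b a y)) =
      (∑ i, A i i / 2 * (((a i + 1) / (2 * b)) * (raiseTwo a i k + 1) / (2 * b) * P)) -
        l * ((a k + 1) / (2 * b) * P) := by
    intro k
    rw [integral_sub (I3 k) ((I1 k).const_mul l), integral_const_mul,
      integral_sq_mul_gaussMonomial hb ha, integral_finsetSum _ fun i _ =>
        integrable_finsetSum _ fun j _ => (I2 k i j).const_mul _]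
    congr 1
    refine Finset.sum_congr rfl fun i _ => ?_
    rw [integral_finsetSum _ fun j _ => (I2 k i j).const_mul _]
    rw [Finset.sum_eq_single i]
    · rw [integral_const_mul]
      congr 1
      have : ∀ y : ι → ℝ, y i * y i * (y k ^ 2 * gaussMonomial b a y) =
          y k ^ 2 * gaussMonomial b (raiseTwo a i) y := by
        intro y; rw [← sq_mul_gaussMonomial b ha]; ring
      simp_rw [this]
      rw [integral_sq_mul_gaussMonomial hb (hk i)]
      simp_rw [← sq_mul_gaussMonomial b ha]
      rw [integral_sq_mul_gaussMonomial hb ha]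
      ring
    · intro j _ hj
      rw [integral_const_mul]
      simp_rw [sq_mul_gaussMonomial b ha]
      rw [integral_mul_mul_gaussMonomial_eq_zero b _ hj.symm, mul_zero]
    · simp
  simp_rw [hval]
  rw [Finset.sum_sub_distrib, Finset.sum_comm]
  have e1 : ∀ i, ∑ k, A i i / 2 * ((a i + 1) / (2 * b) * (raiseTwo a i k + 1) / (2 * b) * P)
      = P / (2 * b) * ((∑ k, (a k + 1) + 2) / (4 * b) * (A i i * (a i + 1))) := by
    intro i
    have : ∑ k, (a k + 1) + 2 = ∑ k, (raiseTwo a i k + 1) := by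
      simp only [raiseTwo, Finset.sum_add_distrib]
      simp; ring
    rw [this, Finset.sum_div, Finset.sum_mul, Finset.mul_sum]
    refine Finset.sum_congr rfl fun k _ => ?_
    field_simp
    ring
  simp_rw [e1]
  rw [← Finset.mul_sum, ← Finset.mul_sum, ← hl, ← Finset.mul_sum, ← Finset.sum_mul,
    ← Finset.sum_div]
  ring

end GaussianMoments

/-! ### Coordinates in an orthonormal basis -/

section Coordinates

variable {n : ℕ}

lemma exists_orthonormalBasis_zero_eq {a : Space (n + 1)} (ha : a ≠ 0) :
    ∃ b : OrthonormalBasis (Fin (n + 1)) ℝ (Space (n + 1)), b 0 = ‖a‖⁻¹ • a := by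
  have h : Orthonormal ℝ (({0} : Set (Fin (n + 1))).domRestrict
      fun _ : Fin (n + 1) => ‖a‖⁻¹ • a) := by
    constructor
    · intro i
      simp [norm_smul, ha]
    · intro i j hij
      exact absurd (Subsingleton.elim i j) hij
  obtain ⟨b, hb⟩ := h.exists_orthonormalBasis_extension_of_card_eq (by simp)
  exact ⟨b, hb 0 rfl⟩

/-- The point with coordinates `v` in the orthonormal basis `b`. -/
noncomputable def ofCoords {N : ℕ} (b : OrthonormalBasis (Fin N) ℝ (Space N)) (v : Fin N → ℝ) :
    Space N := ∑ i, v i • b i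

/-- `ofCoords` as a measurable equivalence. -/
noncomputable def ofCoordsEquiv {N : ℕ} (b : OrthonormalBasis (Fin N) ℝ (Space N)) :
    (Fin N → ℝ) ≃ᵐ Space N :=
  (MeasurableEquiv.toLp 2 (Fin N → ℝ)).trans b.measurableEquiv.symm

variable {N : ℕ} (b : OrthonormalBasis (Fin N) ℝ (Space N))

lemma coe_ofCoordsEquiv : ⇑(ofCoordsEquiv b) = ofCoords b := by
  ext1 v
  rw [ofCoords]
  exact b.sum_repr_symm (WithLp.toLp 2 v) |>.symm

lemma measurePreserving_ofCoords : MeasurePreserving (ofCoordsEquiv b) volume volume :=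
  (PiLp.volume_preserving_toLp (Fin N)).trans b.measurePreserving_measurableEquiv.symm

lemma integral_ofCoords (F : Space N → ℝ) : ∫ v, F (ofCoords b v) = ∫ y, F y := by
  rw [← coe_ofCoordsEquiv]
  exact (measurePreserving_ofCoords b).integral_comp' F

lemma integrable_ofCoords (F : Space N → ℝ) :
    Integrable (fun v => F (ofCoords b v)) ↔ Integrable F := by
  rw [← coe_ofCoordsEquiv]
  exact (measurePreserving_ofCoords b).integrable_comp_emb (ofCoordsEquiv b).measurableEmbedding

lemma norm_sq_ofCoords (v : Fin N → ℝ) : ‖ofCoords b v‖ ^ 2 = ∑ k, v k ^ 2 := by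
  rw [ofCoords, ← real_inner_self_eq_norm_sq, b.orthonormal.inner_sum]
  simp [pow_two]

lemma inner_ofCoords (v : Fin N → ℝ) (i : Fin N) : inner ℝ (b i) (ofCoords b v) = v i := by
  rw [ofCoords, b.orthonormal.inner_right_fintype]

lemma inner_map_ofCoords (H : Space N →L[ℝ] Space N) (v : Fin N → ℝ) :
    inner ℝ (H (ofCoords b v)) (ofCoords b v) =
      ∑ i, ∑ j, inner ℝ (H (b i)) (b j) * (v i * v j) := by
  simp only [ofCoords, map_sum, map_smul, sum_inner, inner_sum, real_inner_smul_left,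
    real_inner_smul_right]
  rw [Finset.sum_comm]
  refine Finset.sum_congr rfl fun i _ => Finset.sum_congr rfl fun j _ => by ring

end Coordinates

section SpaceMoments

variable {n : ℕ}

/-- The exponents with value `r` at `0` and `0` elsewhere. -/
def zeroExponent (r : ℝ) : Fin (n + 1) → ℝ := fun k => if k = 0 then r else 0

lemma neg_one_lt_zeroExponent {r : ℝ} (hr : -1 < r) (k : Fin (n + 1)) : -1 < zeroExponent r k := by
  unfold zeroExponent
  split_ifs <;> linarith

lemma gaussMonomial_eq {ι : Type*} [Fintype ι] (β : ℝ) (v : ι → ℝ) :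
    gaussMonomial β 0 v = Real.exp (-β * ∑ k, v k ^ 2) := by
  simp [gaussMonomial, Finset.mul_sum, ← Real.exp_sum]

lemma gaussMonomial_zeroExponent (β r : ℝ) (v : Fin (n + 1) → ℝ) :
    gaussMonomial β (zeroExponent r) v = |v 0| ^ r * Real.exp (-β * ∑ k, v k ^ 2) := by
  rw [gaussMonomial, Finset.prod_mul_distrib, ← Real.exp_sum, ← Finset.mul_sum]
  congr 1
  rw [Fin.prod_univ_succ]
  simp [zeroExponent, Fin.succ_ne_zero]

variable {a : Space (n + 1)} (ha : a ≠ 0) {r : ℝ} (hr : -1 < r) {β : ℝ} (hβ : 0 < β)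

include ha in
lemma inner_ofCoords_of_zero_eq {b : OrthonormalBasis (Fin (n + 1)) ℝ (Space (n + 1))}
    (hb : b 0 = ‖a‖⁻¹ • a) (v : Fin (n + 1) → ℝ) : inner ℝ a (ofCoords b v) = ‖a‖ * v 0 := by
  have h : a = ‖a‖ • b 0 := by
    rw [hb, smul_smul, mul_inv_cancel₀ (norm_ne_zero_iff.2 ha), one_smul]
  conv_lhs => rw [h, real_inner_smul_left, inner_ofCoords]

include ha hr hβ in
lemma integrable_inner_rpow_mul_normSq_mul_gaussian :
    Integrable fun y : Space (n + 1) =>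
      |inner ℝ a y| ^ r * ‖y‖ ^ 2 * Real.exp (-β * ‖y‖ ^ 2) := by
  obtain ⟨b, hb⟩ := exists_orthonormalBasis_zero_eq ha
  rw [← integrable_ofCoords b]
  have h : Integrable fun v : Fin (n + 1) → ℝ => ‖a‖ ^ r *
      ∑ k, v k ^ 2 * gaussMonomial β (zeroExponent r) v :=
    (integrable_finsetSum _ fun k _ =>
      integrable_sq_mul_gaussMonomial hβ (neg_one_lt_zeroExponent hr) k).const_mul _
  refine h.congr (ae_of_all _ fun v => ?_)
  simp only
  rw [inner_ofCoords_of_zero_eq ha hb, norm_sq_ofCoords, ← Finset.sum_mul,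
    gaussMonomial_zeroExponent, abs_mul, abs_norm,
    Real.mul_rpow (norm_nonneg _) (abs_nonneg _)]
  ring

include ha hr hβ in
/-- The moment identity behind the normalized `p`-Laplacian, for `r = p - 2`. -/
theorem integral_inner_rpow_mul_quadratic_gaussian
    (H : Space (n + 1) →L[ℝ] Space (n + 1)) {l : ℝ}
    (hl : (n + 1 + r) * l = (n + 1 + r + 2) / (4 * β) *
      (LinearMap.trace ℝ _ (H : Space (n + 1) →ₗ[ℝ] Space (n + 1)) +
        r * (inner ℝ (H a) a / ‖a‖ ^ 2))) :
    ∫ y : Space (n + 1), |inner ℝ a y| ^ r * ‖y‖ ^ 2 * Real.exp (-β * ‖y‖ ^ 2) *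
      (1 / 2 * inner ℝ (H y) y - l) = 0 := by
  obtain ⟨b, hb⟩ := exists_orthonormalBasis_zero_eq ha
  rw [← integral_ofCoords b]
  have e1 : ∑ k : Fin (n + 1), (zeroExponent r k + 1) = n + 1 + r := by
    simp [Finset.sum_add_distrib, zeroExponent]; ring
  have e2 : inner ℝ (H (b 0)) (b 0) = inner ℝ (H a) a / ‖a‖ ^ 2 := by
    rw [hb, map_smul, real_inner_smul_left, real_inner_smul_right]
    have := norm_ne_zero_iff.2 ha
    field_simp
  have e3 : ∑ i, inner ℝ (H (b i)) (b i) * (zeroExponent r i + 1) =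
      LinearMap.trace ℝ _ (H : Space (n + 1) →ₗ[ℝ] Space (n + 1)) +
        r * (inner ℝ (H a) a / ‖a‖ ^ 2) := by
    rw [LinearMap.trace_eq_sum_inner _ b]
    simp only [mul_add, mul_one, Finset.sum_add_distrib, zeroExponent, mul_ite, mul_zero]
    rw [Finset.sum_ite_eq' _ _ _, if_pos (Finset.mem_univ _), e2]
    simp only [ContinuousLinearMap.coe_coe, real_inner_comm]
    ring
  have h := integral_normSq_mul_quadratic_gaussMonomial hβ (neg_one_lt_zeroExponent hr)
    (fun i j => inner ℝ (H (b i)) (b j)) (l := l) (by rw [e1, e3]; exact hl)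
  have h2 : ∀ v, |inner ℝ a (ofCoords b v)| ^ r * ‖ofCoords b v‖ ^ 2 *
      Real.exp (-β * ‖ofCoords b v‖ ^ 2) *
      (1 / 2 * inner ℝ (H (ofCoords b v)) (ofCoords b v) - l) =
      ‖a‖ ^ r * ((∑ k, v k ^ 2) * (1 / 2 * (∑ i, ∑ j, inner ℝ (H (b i)) (b j) * (v i * v j)) - l) *
      gaussMonomial β (zeroExponent r) v) := by
    intro v
    rw [inner_ofCoords_of_zero_eq ha hb, norm_sq_ofCoords, inner_map_ofCoords,
      gaussMonomial_zeroExponent, abs_mul, abs_norm,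
      Real.mul_rpow (norm_nonneg _) (abs_nonneg _)]
    ring
  simp_rw [h2]
  rw [integral_const_mul, h, mul_zero]

end SpaceMoments

/-! ### Best constants in `L^p` -/

section BestConstant

variable {X : Type*} [MeasurableSpace X] {μ : Measure X}

/-- `m` minimizes `l ↦ ‖f - l‖_{L^p(μ)}` over the constants. -/
def IsBestConst (p : ℝ≥0∞) (μ : Measure X) (f : X → ℝ) (m : ℝ) : Prop :=
  ∀ l : ℝ, eLpNorm (fun q => f q - m) p μ ≤ eLpNorm (fun q => f q - l) p μ

lemma IsBestConst.neg {p : ℝ≥0∞} {f : X → ℝ} {m : ℝ} (h : IsBestConst p μ f m) :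
    IsBestConst p μ (fun q => -f q) (-m) := by
  intro l
  have h1 : (fun q => -f q - -m) = -(fun q => f q - m) := by ext q; simp; ring
  have h2 : (fun q => -f q - l) = -(fun q => f q - -l) := by ext q; simp; ring
  rw [h1, h2, eLpNorm_neg, eLpNorm_neg]
  exact h (-l)

lemma IsBestConst.affine {p : ℝ≥0∞} {f : X → ℝ} {m c : ℝ} (k : ℝ) (hc : c ≠ 0)
    (h : IsBestConst p μ f m) : IsBestConst p μ (fun q => c * (f q - k)) (c * (m - k)) := by
  intro l
  have h1 : (fun q => c * (f q - k) - c * (m - k)) = c • (fun q => f q - m) := by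
    ext q; simp; ring
  have h2 : (fun q => c * (f q - k) - l) = c • (fun q => f q - (l / c + k)) := by
    ext q; simp; field_simp; ring
  rw [h1, h2, eLpNorm_const_smul, eLpNorm_const_smul]
  gcongr
  exact h _

/-- For finite exponents, minimizing the `L^p` norm is minimizing the integral of the power. -/
lemma isBestConst_iff_integral {p : ℝ≥0∞} (hp : 1 ≤ p) (hp' : p ≠ ∞) {f : X → ℝ} [IsFiniteMeasure μ]
    (hf : MemLp f p μ) (m : ℝ) : IsBestConst p μ f m ↔
      ∀ l : ℝ, ∫ q, |f q - m| ^ p.toReal ∂μ ≤ ∫ q, |f q - l| ^ p.toReal ∂μ := by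
  have hp0 : p ≠ 0 := by positivity
  have hpr : 0 < p.toReal := ENNReal.toReal_pos hp0 hp'
  have h : ∀ l : ℝ, eLpNorm (fun q => f q - l) p μ =
      ENNReal.ofReal ((∫ q, |f q - l| ^ p.toReal ∂μ) ^ p.toReal⁻¹) := fun l =>
    (hf.sub (memLp_const l)).eLpNorm_eq_integral_rpow_norm hp0 hp'
  have h0 : ∀ l : ℝ, 0 ≤ ∫ q, |f q - l| ^ p.toReal ∂μ := fun l =>
    integral_nonneg fun q => by positivity
  refine forall_congr' fun l => ?_
  rw [h, h, ENNReal.ofReal_le_ofReal_iff (by have := h0 l; positivity),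
    Real.rpow_le_rpow_iff (h0 m) (h0 l) (by positivity)]

/-- The norm of `f - l` is continuous and coercive in the constant `l`. -/
lemma exists_isBestConst {p : ℝ≥0∞} (hp : 1 ≤ p) {f : X → ℝ} [IsFiniteMeasure μ] (hμ : μ ≠ 0)
    (hf : MemLp f p μ) : ∃ m, IsBestConst p μ f m := by
  have : Fact (1 ≤ p) := ⟨hp⟩
  set F : Lp ℝ p μ := hf.toLp f
  have h1m : MemLp (fun _ : X => (1 : ℝ)) p μ := memLp_const 1
  set e : Lp ℝ p μ := h1m.toLp _
  have he : 0 < ‖e‖ := by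
    rw [Lp.norm_toLp, eLpNorm_const _ (by positivity) hμ]
    refine ENNReal.toReal_pos ?_ ?_
    · simp
      intro h
      exact absurd h (by simp [hμ])
    · refine ENNReal.mul_ne_top (by simp) ?_
      exact (ENNReal.rpow_lt_top_of_nonneg (by positivity) (measure_ne_top _ _)).ne
  have hval : ∀ l : ℝ, eLpNorm (fun q => f q - l) p μ = ENNReal.ofReal ‖F - l • e‖ := by
    intro l
    have hl : F - l • e = (hf.sub (h1m.const_smul l)).toLp _ := rfl
    rw [hl, Lp.norm_toLp, ENNReal.ofReal_toReal (hf.sub (h1m.const_smul l)).2.ne]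
    congr 1
    ext q
    simp
  have hcont : Continuous fun l : ℝ => ‖F - l • e‖ := by fun_prop
  have hlim : Tendsto (fun l : ℝ => ‖F - l • e‖) (cocompact ℝ) atTop := by
    have h2 : Tendsto (fun l : ℝ => ‖l‖ * ‖e‖ - ‖F‖) (cocompact ℝ) atTop :=
      tendsto_atTop_add_const_right _ _ (tendsto_norm_cocompact_atTop.atTop_mul_const he)
    refine tendsto_atTop_mono (fun l => ?_) h2
    have := norm_sub_norm_le (l • e) F
    rw [norm_smul] at this
    rw [norm_sub_rev]
    exact this
  obtain ⟨m, hm⟩ := hcont.exists_forall_le hlim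
  exact ⟨m, fun l => by rw [hval, hval]; exact ENNReal.ofReal_le_ofReal (hm l)⟩

/-- In `L^∞` the midpoint of two distinct best constants would be strictly better than both. -/
lemma IsBestConst.not_lt_of_top {f : X → ℝ} [IsFiniteMeasure μ] (hμ : μ ≠ 0)
    (hf : MemLp f ∞ μ) {m₁ m₂ : ℝ} (h₁ : IsBestConst ∞ μ f m₁) (h₂ : IsBestConst ∞ μ f m₂) :
    ¬ m₁ < m₂ := by
  intro hlt
  have : NeZero μ := ⟨hμ⟩
  set R := (eLpNorm (fun q => f q - m₁) ∞ μ).toReal with hR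
  have hae : ∀ m, IsBestConst ∞ μ f m → ∀ᵐ q ∂μ, |f q - m| ≤ R := by
    intro m hm
    have heq : eLpNorm (fun q => f q - m) ∞ μ = eLpNorm (fun q => f q - m₁) ∞ μ :=
      le_antisymm (hm _) (h₁ _)
    have hfin : eLpNorm (fun q => f q - m) ∞ μ ≠ ∞ := (hf.sub (memLp_const m)).2.ne
    have := ae_le_eLpNormEssSup (μ := μ) (f := fun q => f q - m)
    filter_upwards [this] with q hq
    rw [hR, ← heq, ← Real.norm_eq_abs, ← toReal_enorm]
    exact ENNReal.toReal_mono hfin hq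
  obtain ⟨q, hq1, hq2⟩ := ((hae _ h₁).and (hae _ h₂)).exists
  have hRpos : 0 < R := by
    rw [abs_le] at hq1 hq2
    linarith [hq1.2, hq2.1]
  have hmid : eLpNorm (fun q => f q - (m₁ + m₂) / 2) ∞ μ ≤
      ENNReal.ofReal (R - (m₂ - m₁) / 2) := by
    refine eLpNormEssSup_le_of_ae_bound ?_
    filter_upwards [hae _ h₁, hae _ h₂] with q h1 h2
    rw [abs_le] at h1 h2
    rw [Real.norm_eq_abs, abs_le]
    constructor <;> linarith [h1.1, h1.2, h2.1, h2.2]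
  have h3 := (h₁ _).trans hmid
  rw [← ENNReal.ofReal_toReal (a := eLpNorm (fun q => f q - m₁) ∞ μ)
    (hf.sub (memLp_const m₁)).2.ne, ← hR, ENNReal.ofReal_le_ofReal_iff'] at h3
  rcases h3 with h3 | h3 <;> linarith

variable [TopologicalSpace X]

/-- For finite exponents two distinct best constants `m₁ < m₂` do not exist: the midpoint is
strictly better unless `f` avoids `(m₁, m₂)`, and then by connectedness all values of `f` lie on one
side, so that one of the two is worse. -/
lemma IsBestConst.not_lt {p : ℝ≥0∞} (hp : 1 ≤ p) (hp' : p ≠ ∞) [IsFiniteMeasure μ] {U : Set X}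
    (hU : IsOpen U) (hUc : IsPreconnected U) (hμU : ∀ᵐ q ∂μ, q ∈ U)
    (hpos : ∀ V ⊆ U, IsOpen V → V.Nonempty → μ V ≠ 0) (hUne : U.Nonempty)
    {f : X → ℝ} (hf : ContinuousOn f U) (hfb : MemLp f p μ) {m₁ m₂ : ℝ}
    (h₁ : IsBestConst p μ f m₁) (h₂ : IsBestConst p μ f m₂) : ¬ m₁ < m₂ := by
  intro hlt
  rw [isBestConst_iff_integral hp hp' hfb] at h₁ h₂
  have hp0 : p ≠ 0 := by positivity
  have hpr : 1 ≤ p.toReal := by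
    rw [← ENNReal.toReal_one]; exact ENNReal.toReal_mono hp' hp
  have hint : ∀ l : ℝ, Integrable (fun q => |f q - l| ^ p.toReal) μ := fun l =>
    (hfb.sub (memLp_const l)).integrable_norm_rpow hp0 hp'
  -- if `G₁ ≤ G₂` and the integrals are in the opposite order, strict inequality is negligible
  have key : ∀ G₁ G₂ : X → ℝ, Integrable G₁ μ → Integrable G₂ μ → (∀ q, q ∈ U → G₁ q ≤ G₂ q) →
      ∫ q, G₂ q ∂μ ≤ ∫ q, G₁ q ∂μ → ∀ᵐ q ∂μ, ¬ G₁ q < G₂ q := by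
    intro G₁ G₂ hG₁ hG₂ hle hi
    have h0 : 0 ≤ᵐ[μ] fun q => G₂ q - G₁ q := by
      filter_upwards [hμU] with q hq
      exact sub_nonneg.2 (hle q hq)
    have h1 : ∫ q, (G₂ q - G₁ q) ∂μ = 0 := by
      refine le_antisymm ?_ (integral_nonneg_of_ae h0)
      rw [integral_sub hG₂ hG₁]; linarith
    rw [integral_eq_zero_iff_of_nonneg_ae h0 (hG₂.sub hG₁)] at h1
    filter_upwards [h1] with q hq
    simp only [Pi.zero_apply] at hq
    linarith
  have hconv : ∀ q, |f q - (m₁ + m₂) / 2| ^ p.toReal ≤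
      (|f q - m₁| ^ p.toReal + |f q - m₂| ^ p.toReal) / 2 ∧ (m₁ < f q ∧ f q < m₂ →
      |f q - (m₁ + m₂) / 2| ^ p.toReal < (|f q - m₁| ^ p.toReal + |f q - m₂| ^ p.toReal) / 2) := by
    intro q
    have h2 : ((|f q - m₁| + |f q - m₂|) / 2) ^ p.toReal ≤
        (|f q - m₁| ^ p.toReal + |f q - m₂| ^ p.toReal) / 2 := by
      have := (convexOn_rpow hpr).2 (mem_Ici.2 (abs_nonneg (f q - m₁)))
        (mem_Ici.2 (abs_nonneg (f q - m₂))) (by norm_num : (0 : ℝ) ≤ 1 / 2)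
        (by norm_num : (0 : ℝ) ≤ 1 / 2) (by norm_num)
      simp only [smul_eq_mul] at this
      rw [show (|f q - m₁| + |f q - m₂|) / 2 = 1 / 2 * |f q - m₁| + 1 / 2 * |f q - m₂| by ring]
      linarith
    constructor
    · refine le_trans (Real.rpow_le_rpow (abs_nonneg _) ?_ (by linarith)) h2
      have := abs_add_le (f q - m₁) (f q - m₂)
      have h4 : f q - (m₁ + m₂) / 2 = ((f q - m₁) + (f q - m₂)) / 2 := by ring
      rw [h4, abs_div, abs_two]
      linarith
    · rintro ⟨ha, hb⟩
      refine lt_of_lt_of_le (Real.rpow_lt_rpow (abs_nonneg _) ?_ (by linarith)) h2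
      rw [abs_of_pos (sub_pos.2 ha), abs_of_neg (sub_neg.2 hb), abs_lt]
      constructor <;> linarith
  have hnull := key _ _ (hint _) (((hint m₁).add (hint m₂)).div_const 2)
    (fun q _ => (hconv q).1) (by
      rw [integral_div]
      simp only [Pi.add_apply]
      rw [integral_add (hint _) (hint _)]
      linarith [h₁ ((m₁ + m₂) / 2), h₂ ((m₁ + m₂) / 2)])
  have hopen : IsOpen (U ∩ f ⁻¹' Ioo m₁ m₂) := hf.isOpen_inter_preimage hU isOpen_Ioo
  have hempty : ¬ (U ∩ f ⁻¹' Ioo m₁ m₂).Nonempty := by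
    intro hne
    refine hpos _ inter_subset_left hopen hne ?_
    refine measure_mono_null ?_ hnull
    rintro q ⟨_, hq⟩
    simpa using (hconv q).2 hq
  obtain ⟨q₀, hq₀⟩ := hUne
  have hμU0 : μ U ≠ 0 := hpos U subset_rfl hU ⟨q₀, hq₀⟩
  have hfinal : ∀ l₁ l₂ : ℝ, (∫ q, |f q - l₂| ^ p.toReal ∂μ ≤ ∫ q, |f q - l₁| ^ p.toReal ∂μ) →
      ¬ ∀ q ∈ U, |f q - l₁| < |f q - l₂| := by
    intro l₁ l₂ hle hlt'
    have := key _ _ (hint l₁) (hint l₂) (fun q hq =>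
      Real.rpow_le_rpow (abs_nonneg _) (hlt' q hq).le (by linarith)) hle
    refine hμU0 (measure_mono_null ?_ this)
    intro q hq
    simpa using Real.rpow_lt_rpow (abs_nonneg _) (hlt' q hq) (by linarith)
  have himg : (f '' U).OrdConnected := (hUc.image f hf).ordConnected
  have halt : (∀ q ∈ U, f q ≤ m₁) ∨ (∀ q ∈ U, m₂ ≤ f q) := by
    by_contra! hcon
    obtain ⟨⟨q, hq, hq1⟩, ⟨q', hq', hq1'⟩⟩ := hcon
    rcases lt_or_ge (f q) m₂ with h | h
    · exact hempty ⟨q, hq, hq1, h⟩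
    rcases lt_or_ge m₁ (f q') with h' | h'
    · exact hempty ⟨q', hq', h', hq1'⟩
    obtain ⟨z, hz, hz'⟩ := himg.out (mem_image_of_mem f hq') (mem_image_of_mem f hq)
      (show (m₁ + m₂) / 2 ∈ Icc (f q') (f q) by constructor <;> linarith)
    exact hempty ⟨z, hz, by rw [mem_preimage, hz']; constructor <;> linarith⟩
  rcases halt with h | h
  · refine hfinal m₁ m₂ (h₂ _) fun q hq => ?_
    rw [abs_of_nonpos (by linarith [h q hq]), abs_of_neg (by linarith [h q hq])]
    linarith
  · refine hfinal m₂ m₁ (h₁ _) fun q hq => ?_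
    rw [abs_of_nonneg (by linarith [h q hq]), abs_of_pos (by linarith [h q hq])]
    linarith

variable [OpensMeasurableSpace X]

lemma aestronglyMeasurable_of_continuousOn {U : Set X} (hU : IsOpen U) (hμU : ∀ᵐ q ∂μ, q ∈ U)
    {f : X → ℝ} (hf : ContinuousOn f U) : AEStronglyMeasurable f μ := by
  have := hf.aestronglyMeasurable (μ := μ) hU.measurableSet
  rwa [Measure.restrict_eq_self_of_ae_mem hμU] at this

/-- Existence and uniqueness of the best constant in `L^p`, `1 ≤ p ≤ ∞`, for a bounded continuous
function on a connected open set. Connectedness matters only for `p = 1`. -/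
theorem existsUnique_isBestConst {p : ℝ≥0∞} (hp : 1 ≤ p) [IsFiniteMeasure μ] {U : Set X}
    (hU : IsOpen U) (hUc : IsPreconnected U) (hμU : ∀ᵐ q ∂μ, q ∈ U)
    (hpos : ∀ V ⊆ U, IsOpen V → V.Nonempty → μ V ≠ 0) (hUne : U.Nonempty)
    {f : X → ℝ} (hf : ContinuousOn f U) {B : ℝ} (hB : ∀ q ∈ U, |f q| ≤ B) :
    ∃! m, IsBestConst p μ f m := by
  have hμ : μ ≠ 0 := fun h => hpos U subset_rfl hU hUne (by simp [h])
  have hfb : MemLp f p μ := MemLp.of_bound (aestronglyMeasurable_of_continuousOn hU hμU hf) B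
    (hμU.mono hB)
  obtain ⟨m, hm⟩ := exists_isBestConst hp hμ hfb
  refine ⟨m, hm, fun m' hm' => ?_⟩
  rcases eq_or_ne p ∞ with rfl | hp'
  · exact le_antisymm (not_lt.1 (hm.not_lt_of_top hμ hfb hm'))
      (not_lt.1 (hm'.not_lt_of_top hμ hfb hm))
  · exact le_antisymm (not_lt.1 (hm.not_lt hp hp' hU hUc hμU hpos hUne hf hfb hm'))
      (not_lt.1 (hm'.not_lt hp hp' hU hUc hμU hpos hUne hf hfb hm))

end BestConstant

/-! ### The measure in parabolic coordinates and the heat `p`-mean -/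

section ChartMeasure

variable {N : ℕ}

lemma profile_pow (k : ℝ) (y : Space N) :
    profile y ^ k = (√(4 * Real.pi))⁻¹ ^ k * Real.exp (-(k / (4 * N)) * ‖y‖ ^ 2) := by
  rw [profile, div_eq_inv_mul, Real.mul_rpow (by positivity) (by positivity), ← Real.exp_mul]
  congr 2
  ring

lemma profile_sq (y : Space N) :
    profile y ^ 2 = Real.exp (-(‖y‖ ^ 2 / (2 * N))) / (4 * Real.pi) := by
  rw [profile, div_pow, Real.sq_sqrt (by positivity), ← Real.exp_nat_mul]
  congr 2
  push_cast; ring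

/-- The largest value of `γ(y)² |y|²`, attained for `|y|² = 2N`. -/
noncomputable def maxRadiusSq (N : ℕ) : ℝ := 2 * N * (Real.exp (-1) / (4 * Real.pi))

/-- The inequality amounts to `v e^{-v} ≤ e^{-1}` for `v = |y|² / (2N)`. -/
lemma profile_sq_mul_norm_sq_le (hN : 1 ≤ N) (y : Space N) :
    profile y ^ 2 * ‖y‖ ^ 2 ≤ maxRadiusSq N := by
  have hN' : (0 : ℝ) < N := by positivity
  rw [profile_sq, maxRadiusSq]
  set v := ‖y‖ ^ 2 / (2 * N) with hv
  have h1 : ‖y‖ ^ 2 = 2 * N * v := by rw [hv]; field_simp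
  have h2 : v ≤ Real.exp (v - 1) := by linarith [Real.add_one_le_exp (v - 1)]
  have h3 : Real.exp (-v) * v ≤ Real.exp (-1) := by
    calc Real.exp (-v) * v ≤ Real.exp (-v) * Real.exp (v - 1) := by gcongr
      _ = Real.exp (-1) := by rw [← Real.exp_add]; congr 1; ring
  rw [h1]
  calc Real.exp (-v) / (4 * Real.pi) * (2 * N * v)
      = 2 * N * ((Real.exp (-v) * v) / (4 * Real.pi)) := by ring
    _ ≤ _ := by gcongr

lemma profile_mul_norm_le (hN : 1 ≤ N) (y : Space N) : profile y * ‖y‖ ≤ √(maxRadiusSq N) := by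
  apply Real.le_sqrt_of_sq_le
  rw [mul_pow]
  exact profile_sq_mul_norm_sq_le hN y

lemma profile_le_one (y : Space N) : profile y ≤ 1 := by
  have hpi := Real.pi_gt_three
  rw [profile, div_le_one (by positivity)]
  calc Real.exp (-‖y‖ ^ 2 / (4 * N)) ≤ 1 := by
        rw [Real.exp_le_one_iff, neg_div]
        exact neg_nonpos.2 (by positivity)
    _ ≤ √(4 * Real.pi) := by
        rw [Real.one_le_sqrt]; linarith

lemma isOpen_chartDomain : IsOpen (chartDomain N) := isOpen_univ.prod isOpen_Ioo

lemma isPreconnected_chartDomain : IsPreconnected (chartDomain N) :=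
  isPreconnected_univ.prod isPreconnected_Ioo

lemma chartDomain_nonempty : (chartDomain N).Nonempty := ⟨(0, 1 / 2), by
  simp [chartDomain]; norm_num⟩

lemma chart_mem_heatBall (hN : 1 ≤ N) {ε : ℝ} (hε : 0 < ε) (x : Space N) (t : ℝ)
    {q : Space N × ℝ} (hq : q ∈ chartDomain N) : chart ε x t q ∈ heatBall ε x t := by
  have h0 : 0 < q.2 := hq.2.1
  have h1 : q.2 < 1 := hq.2.2
  have hγ := profile_pos q.1
  rw [chart, mem_heatBall_iff hN hε _ _ _ (by positivity)]
  have : q.2 * profile q.1 < profile q.1 := by nlinarith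
  gcongr

lemma heatBall_subset_prod (hN : 1 ≤ N) {ε : ℝ} (hε : 0 < ε) (x : Space N) (t : ℝ) :
    heatBall ε x t ⊆
      Metric.closedBall x (ε * √(maxRadiusSq N)) ×ˢ Metric.closedBall t (ε ^ 2) := by
  rintro ⟨z, s⟩ h
  have hs : s < t := h.1
  have hR : 0 < √(t - s) := Real.sqrt_pos.2 (by linarith)
  have hR2 : √(t - s) ^ 2 = t - s := Real.sq_sqrt (by linarith)
  obtain ⟨y, rfl⟩ : ∃ y, z = x + √(t - s) • y :=
    ⟨(√(t - s))⁻¹ • (z - x), by rw [smul_smul, mul_inv_cancel₀ hR.ne', one_smul]; abel⟩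
  have h2 : (x + √(t - s) • y, t - √(t - s) ^ 2) ∈ heatBall ε x t := by
    rw [hR2, sub_sub_cancel]; exact h
  rw [mem_heatBall_iff hN hε _ _ _ hR] at h2
  constructor
  · simp only [Metric.mem_closedBall, dist_self_add_left, norm_smul, Real.norm_eq_abs,
      abs_of_pos hR]
    calc √(t - s) * ‖y‖ ≤ ε * profile y * ‖y‖ := by gcongr
      _ = ε * (profile y * ‖y‖) := by ring
      _ ≤ _ := by gcongr; exact profile_mul_norm_le hN y
  · simp only [Metric.mem_closedBall, Real.dist_eq]
    rw [abs_of_neg (by linarith), neg_sub, ← hR2]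
    have := profile_le_one y
    have h3 : √(t - s) ≤ ε := h2.le.trans (by nlinarith)
    gcongr

lemma isCompact_closure_heatBall (hN : 1 ≤ N) {ε : ℝ} (hε : 0 < ε) (x : Space N) (t : ℝ) :
    IsCompact (closure (heatBall ε x t)) :=
  (((isCompact_closedBall _ _).prod (isCompact_closedBall _ _)).of_isClosed_subset isClosed_closure
    (closure_minimal (heatBall_subset_prod hN hε x t)
      (Metric.isClosed_closedBall.prod Metric.isClosed_closedBall)))

lemma integrable_normSq_mul_profile_rpow (hN : 1 ≤ N) {a : Space N} (ha : a ≠ 0) {r k : ℝ}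
    (hr : -1 < r) (hk : 0 < k) :
    Integrable fun y : Space N => |inner ℝ a y| ^ r * ‖y‖ ^ 2 * profile y ^ k := by
  obtain ⟨n, rfl⟩ : ∃ n, N = n + 1 := ⟨N - 1, by lia⟩
  have hn : (0 : ℝ) < ((n + 1 : ℕ) : ℝ) := by positivity
  have := (integrable_inner_rpow_mul_normSq_mul_gaussian ha hr
    (β := k / (4 * ((n + 1 : ℕ) : ℝ))) (by positivity)).const_mul ((√(4 * Real.pi))⁻¹ ^ k)
  refine this.congr (ae_of_all _ fun y => ?_)
  simp only
  rw [profile_pow]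
  ring

lemma isFiniteMeasure_spaceWeight (hN : 1 ≤ N) : IsFiniteMeasure (spaceWeight N) := by
  have hN' : (0 : ℝ) < N := by positivity
  have h := integrable_normSq_mul_profile_rpow hN (a := EuclideanSpace.single ⟨0, hN⟩ (1 : ℝ))
    (by simp) (r := 0) (by norm_num) hN'
  refine isFiniteMeasure_withDensity_ofReal (Integrable.hasFiniteIntegral ?_)
  refine h.congr (ae_of_all _ fun y => ?_)
  simp

lemma isFiniteMeasure_radialWeight : IsFiniteMeasure (radialWeight N) := by
  refine isFiniteMeasure_withDensity_ofReal (Integrable.hasFiniteIntegral ?_)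
  have h : IntegrableOn (fun r : ℝ => 2 * r ^ (N - 1)) (Icc 0 1) :=
    Continuous.integrableOn_Icc (by fun_prop)
  exact h.mono_set Ioo_subset_Icc_self

lemma isFiniteMeasure_chartMeasure (hN : 1 ≤ N) : IsFiniteMeasure (chartMeasure N) := by
  have := isFiniteMeasure_spaceWeight hN
  have := isFiniteMeasure_radialWeight (N := N)
  unfold chartMeasure
  infer_instance

lemma volume_absolutelyContinuous_spaceWeight (hN : 1 ≤ N) :
    (volume : Measure (Space N)) ≪ spaceWeight N := by
  have : Nonempty (Fin N) := ⟨⟨0, hN⟩⟩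
  refine withDensity_absolutelyContinuous' (by fun_prop) ?_
  filter_upwards [Measure.ae_ne volume (0 : Space N)] with y hy
  have h1 := profile_pos y
  have h2 : 0 < ‖y‖ := norm_pos_iff.2 hy
  simp only [ne_eq, ENNReal.ofReal_eq_zero, not_le]
  positivity

lemma volume_absolutelyContinuous_radialWeight :
    (volume : Measure ℝ).restrict (Ioo 0 1) ≪ radialWeight N := by
  refine withDensity_absolutelyContinuous' (by fun_prop) ?_
  filter_upwards [ae_restrict_mem measurableSet_Ioo] with r hr
  have h2 : 0 < r := hr.1
  simp only [ne_eq, ENNReal.ofReal_eq_zero, not_le]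
  positivity

lemma spaceWeight_absolutelyContinuous : spaceWeight N ≪ volume :=
  withDensity_absolutelyContinuous _ _

lemma radialWeight_absolutelyContinuous :
    radialWeight N ≪ (volume : Measure ℝ).restrict (Ioo 0 1) :=
  withDensity_absolutelyContinuous _ _

lemma restrict_chartDomain : (volume : Measure (Space N × ℝ)).restrict (chartDomain N) =
    (volume : Measure (Space N)).prod ((volume : Measure ℝ).restrict (Ioo 0 1)) := by
  rw [chartDomain, Measure.volume_eq_prod, ← Measure.prod_restrict, Measure.restrict_univ]

lemma ae_mem_chartDomain : ∀ᵐ q ∂(chartMeasure N), q ∈ chartDomain N := by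
  have h : chartMeasure N ≪ (volume : Measure (Space N × ℝ)).restrict (chartDomain N) := by
    rw [restrict_chartDomain]
    exact spaceWeight_absolutelyContinuous.prod radialWeight_absolutelyContinuous
  exact h.ae_le (ae_restrict_mem isOpen_chartDomain.measurableSet)

lemma chartMeasure_ne_zero (hN : 1 ≤ N) {V : Set (Space N × ℝ)} (hV : V ⊆ chartDomain N)
    (hVo : IsOpen V) (hne : V.Nonempty) : chartMeasure N V ≠ 0 := by
  intro h0
  have h : (volume : Measure (Space N × ℝ)).restrict (chartDomain N) ≪ chartMeasure N := by
    rw [restrict_chartDomain]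
    exact (volume_absolutelyContinuous_spaceWeight hN).prod
      volume_absolutelyContinuous_radialWeight
  have h1 := h h0
  rw [Measure.restrict_apply hVo.measurableSet, inter_eq_left.2 hV] at h1
  exact hVo.measure_ne_zero _ hne h1

lemma eLpNorm_heatMeasure (hN : 1 ≤ N) {ε : ℝ} (hε : 0 < ε) (x : Space N) (t : ℝ)
    {φ : Space N × ℝ → ℝ} (hφ : ContinuousOn φ (heatBall ε x t)) {p : ℝ≥0∞} (l : ℝ) :
    eLpNorm (fun q => φ q - l) p (heatMeasure ε x t) =
      ENNReal.ofReal (ε ^ N) ^ (1 / p).toReal *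
        eLpNorm (fun q => φ (chart ε x t q) - l) p (chartMeasure N) := by
  have hm := (continuous_chart ε x t).measurable
  have hc : ENNReal.ofReal (ε ^ N) ≠ 0 := by
    simp only [ne_eq, ENNReal.ofReal_eq_zero, not_le]; positivity
  rw [heatMeasure_eq hN hε, eLpNorm_smul_measure_of_ne_zero hc, smul_eq_mul]
  congr 1
  refine eLpNorm_map_measure ?_ hm.aemeasurable
  have hE := measurableSet_heatBall ε x t
  have hae : ∀ᵐ q ∂((chartMeasure N).map (chart ε x t)), q ∈ heatBall ε x t := by
    refine (ae_map_iff hm.aemeasurable hE).2 ?_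
    exact ae_mem_chartDomain.mono fun q hq => chart_mem_heatBall hN hε x t hq
  have h := (hφ.sub (continuousOn_const (c := l))).aestronglyMeasurable
    (μ := (chartMeasure N).map (chart ε x t)) hE
  rwa [Measure.restrict_eq_self_of_ae_mem hae] at h

/-- Parabolic coordinates change the norms by a factor independent of the constant, hence do not
change the best constant. -/
lemma isBestConstant_iff (hN : 1 ≤ N) {ε : ℝ} (hε : 0 < ε) (x : Space N) (t : ℝ)
    {φ : Space N × ℝ → ℝ} (hφ : ContinuousOn φ (heatBall ε x t)) {p : ℝ≥0∞} (m : ℝ) :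
    IsBestConstant p ε φ x t m ↔
      IsBestConst p (chartMeasure N) (fun q => φ (chart ε x t q)) m := by
  refine forall_congr' fun l => ?_
  rw [eLpNorm_heatMeasure hN hε x t hφ, eLpNorm_heatMeasure hN hε x t hφ]
  refine ENNReal.mul_le_mul_iff_right ?_ ?_
  · refine (ENNReal.rpow_pos ?_ ENNReal.ofReal_ne_top).ne'
    rw [ENNReal.ofReal_pos]; positivity
  · exact (ENNReal.rpow_lt_top_of_nonneg ENNReal.toReal_nonneg ENNReal.ofReal_ne_top).ne

/-- The heat `p`-mean is well defined. -/
theorem existsUnique_isBestConstant (hN : 1 ≤ N) {ε : ℝ} (hε : 0 < ε) (x : Space N) (t : ℝ)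
    {φ : Space N × ℝ → ℝ} (hφ : ContinuousOn φ (closure (heatBall ε x t))) {p : ℝ≥0∞}
    (hp : 1 ≤ p) : ∃! m, IsBestConstant p ε φ x t m := by
  simp_rw [isBestConstant_iff hN hε x t (hφ.mono subset_closure)]
  have := isFiniteMeasure_chartMeasure hN
  have hmaps : MapsTo (chart ε x t) (chartDomain N) (heatBall ε x t) := fun q hq =>
    chart_mem_heatBall hN hε x t hq
  obtain ⟨B, hB⟩ := (isCompact_closure_heatBall hN hε x t).exists_bound_of_continuousOn hφ
  exact existsUnique_isBestConst hp isOpen_chartDomain isPreconnected_chartDomain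
    ae_mem_chartDomain (fun V hV hVo hne => chartMeasure_ne_zero hN hV hVo hne)
    chartDomain_nonempty
    ((hφ.mono subset_closure).comp (continuous_chart ε x t).continuousOn hmaps)
    (B := B) (fun q hq => hB _ (subset_closure (hmaps hq)))

lemma isBestConstant_heatPMean (hN : 1 ≤ N) {ε : ℝ} (hε : 0 < ε) (x : Space N) (t : ℝ)
    {φ : Space N × ℝ → ℝ} (hφ : ContinuousOn φ (closure (heatBall ε x t))) {p : ℝ≥0∞}
    (hp : 1 ≤ p) : IsBestConstant p ε φ x t (heatPMean p ε φ x t) :=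
  Classical.epsilon_spec (existsUnique_isBestConstant hN hε x t hφ hp).exists

end ChartMeasure

/-! ### Signed powers and the Euler-Lagrange inequality -/

section SignedPower

/-- The odd power `sgn(x) |x|^q`; for `q = 0` it is the sign function. -/
noncomputable def signedPow (q x : ℝ) : ℝ := Real.sign x * |x| ^ q

lemma signedPow_of_pos {x : ℝ} (hx : 0 < x) (q : ℝ) : signedPow q x = x ^ q := by
  rw [signedPow, Real.sign_of_pos hx, abs_of_pos hx, one_mul]

lemma signedPow_neg (q x : ℝ) : signedPow q (-x) = -signedPow q x := by
  simp [signedPow, Real.sign_neg]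

lemma signedPow_of_neg {x : ℝ} (hx : x < 0) (q : ℝ) : signedPow q x = -(-x) ^ q := by
  rw [← signedPow_of_pos (neg_pos.2 hx), signedPow_neg, neg_neg]

@[simp] lemma signedPow_zero (q : ℝ) : signedPow q 0 = 0 := by simp [signedPow]

lemma signedPow_zero_left (x : ℝ) : signedPow 0 x = Real.sign x := by simp [signedPow]

lemma sign_mul' (x y : ℝ) : Real.sign (x * y) = Real.sign x * Real.sign y := by
  rcases lt_trichotomy x 0 with hx | rfl | hx <;> rcases lt_trichotomy y 0 with hy | rfl | hy <;>
    simp [Real.sign_of_pos, Real.sign_of_neg, mul_pos_of_neg_of_neg, mul_neg_of_neg_of_pos,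
      mul_neg_of_pos_of_neg, *]

lemma signedPow_mul (q x y : ℝ) : signedPow q (x * y) = signedPow q x * signedPow q y := by
  simp only [signedPow]
  rw [sign_mul', abs_mul, Real.mul_rpow (abs_nonneg _) (abs_nonneg _)]
  ring

lemma abs_signedPow_le (q x : ℝ) : |signedPow q x| ≤ |x| ^ q := by
  rw [signedPow, abs_mul, abs_of_nonneg (by positivity : 0 ≤ |x| ^ q)]
  have : |Real.sign x| ≤ 1 := by
    rcases lt_trichotomy x 0 with hx | rfl | hx <;> simp [Real.sign_of_pos, Real.sign_of_neg, *]
  exact mul_le_of_le_one_left (by positivity) this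

lemma measurable_sign_real : Measurable Real.sign := by
  unfold Real.sign
  exact Measurable.ite measurableSet_Iio measurable_const
    (Measurable.ite measurableSet_Ioi measurable_const measurable_const)

lemma measurable_signedPow (q : ℝ) : Measurable (signedPow q) := by
  have := measurable_sign_real
  unfold signedPow
  fun_prop

lemma signedPow_nonneg (q : ℝ) {x : ℝ} (hx : 0 ≤ x) : 0 ≤ signedPow q x := by
  rcases hx.eq_or_lt with rfl | hx
  · simp
  · rw [signedPow_of_pos hx]; positivity

lemma monotone_signedPow {q : ℝ} (hq : 0 ≤ q) : Monotone (signedPow q) := by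
  have hpos : ∀ x y, 0 ≤ x → x ≤ y → signedPow q x ≤ signedPow q y := by
    intro x y hx hxy
    rcases hx.eq_or_lt with rfl | hx
    · rw [signedPow_zero]; exact signedPow_nonneg q hxy
    · rw [signedPow_of_pos hx, signedPow_of_pos (hx.trans_le hxy)]
      exact Real.rpow_le_rpow hx.le hxy hq
  intro x y hxy
  rcases le_total 0 x with hx | hx
  · exact hpos x y hx hxy
  rcases le_total 0 y with hy | hy
  · have := signedPow_nonneg q (neg_nonneg.2 hx)
    rw [signedPow_neg] at this
    linarith [signedPow_nonneg q hy]
  · have := hpos (-y) (-x) (by linarith) (by linarith)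
    rw [signedPow_neg, signedPow_neg] at this
    linarith

/-- The graph of `|y|^p` lies above its tangents; for `p = 1` the signed power `sgn x` is a
subgradient. -/
lemma abs_rpow_add_mul_le {p : ℝ} (hp : 1 ≤ p) (x y : ℝ) :
    |x| ^ p + p * signedPow (p - 1) x * (y - x) ≤ |y| ^ p := by
  have hpos : ∀ x y : ℝ, 0 < x → |x| ^ p + p * signedPow (p - 1) x * (y - x) ≤ |y| ^ p := by
    intro x y hx
    rw [signedPow_of_pos hx, abs_of_pos hx]
    have h1 : x ^ p = x ^ (p - 1) * x := by
      rw [← Real.rpow_add_one hx.ne']; congr 1; ring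
    have hx1 : 0 < x ^ (p - 1) := by positivity
    rcases le_or_gt 0 y with hy | hy
    · have h2 := one_add_mul_self_le_rpow_one_add (s := y / x - 1)
        (by have : 0 ≤ y / x := by positivity
            linarith) hp
      rw [add_sub_cancel, Real.div_rpow hy hx.le, le_div_iff₀ (by positivity)] at h2
      rw [abs_of_nonneg hy]
      refine le_trans (le_of_eq ?_) h2
      rw [h1]; field_simp
    · have h3 : 0 ≤ |y| ^ p := by positivity
      have h4 : x ^ p + p * x ^ (p - 1) * (y - x) = x ^ (p - 1) * ((1 - p) * x + p * y) := by
        rw [h1]; ring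
      have h5 : (1 - p) * x + p * y ≤ 0 := by nlinarith
      rw [h4]
      nlinarith
  rcases lt_trichotomy x 0 with hx | rfl | hx
  · have := hpos (-x) (-y) (by linarith)
    rw [abs_neg, abs_neg, signedPow_neg] at this
    linarith
  · simp only [signedPow_zero, abs_zero, mul_zero, zero_mul, add_zero]
    rw [Real.zero_rpow (by linarith)]
    positivity
  · exact hpos x y hx

lemma hasDerivAt_signedPow (q : ℝ) {x : ℝ} (hx : x ≠ 0) :
    HasDerivAt (signedPow q) (q * |x| ^ (q - 1)) x := by
  rcases lt_or_gt_of_ne hx with hx | hx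
  · have h1 : HasDerivAt (fun y : ℝ => -(-y) ^ q) (q * |x| ^ (q - 1)) x := by
      have h := ((hasDerivAt_id x).neg.rpow_const (p := q) (Or.inl (by simpa using hx.ne))).neg
      refine h.congr_deriv ?_
      simp only [abs_of_neg hx, Pi.neg_apply, id]
      ring
    refine h1.congr_of_eventuallyEq ?_
    filter_upwards [eventually_lt_nhds hx] with y hy using signedPow_of_neg hy q
  · have h1 : HasDerivAt (fun y : ℝ => y ^ q) (q * |x| ^ (q - 1)) x := by
      have h := Real.hasDerivAt_rpow_const (x := x) (p := q) (Or.inl hx.ne')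
      rwa [abs_of_pos hx]
    refine h1.congr_of_eventuallyEq ?_
    filter_upwards [eventually_gt_nhds hx] with y hy using signedPow_of_pos hy q

lemma abs_signedPow_sub_one_le {q : ℝ} (hq : 0 ≤ q) (hq1 : q ≤ 1) (u : ℝ) :
    |signedPow q u - 1| ≤ 2 * |u - 1| := by
  have hle : ∀ v : ℝ, 0 ≤ v → v ^ q ≤ 1 + v := by
    intro v hv
    rcases le_total v 1 with h | h
    · exact (Real.rpow_le_one hv h hq).trans (by linarith)
    · have := Real.rpow_le_rpow_of_exponent_le h hq1
      rw [Real.rpow_one] at this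
      linarith
  rcases lt_trichotomy u 0 with hu | rfl | hu
  · rw [signedPow_of_neg hu, abs_of_neg (by linarith : u - 1 < 0)]
    have h1 := hle (-u) (by linarith)
    have h2 : 0 ≤ (-u) ^ q := Real.rpow_nonneg (by linarith) _
    rw [abs_le]; constructor <;> linarith
  · simp
  · rw [signedPow_of_pos hu]
    rcases le_total u 1 with h | h
    · have h1 := Real.rpow_le_rpow_of_exponent_ge hu h hq1
      rw [Real.rpow_one] at h1
      have h2 := Real.rpow_le_one hu.le h hq
      rw [abs_of_nonpos (by linarith), abs_of_nonpos (by linarith)]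
      linarith
    · have h1 := Real.rpow_le_rpow_of_exponent_le h hq1
      rw [Real.rpow_one] at h1
      have h2 := Real.one_le_rpow h hq
      rw [abs_of_nonneg (by linarith), abs_of_nonneg (by linarith)]
      linarith

/-- Growth of the signed power for `q ≤ 1`, with the singular weight `|x|^{q-1}`. -/
lemma abs_signedPow_add_sub_le_of_le_one {q : ℝ} (hq : 0 ≤ q) (hq1 : q ≤ 1) {x : ℝ} (hx : x ≠ 0)
    (h : ℝ) : |signedPow q (x + h) - signedPow q x| ≤ 2 * |x| ^ (q - 1) * |h| := by
  have e1 : x + h = x * (1 + h / x) := by field_simp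
  have hx' : 0 < |x| := abs_pos.2 hx
  rw [e1, signedPow_mul, ← mul_sub_one, abs_mul]
  calc |signedPow q x| * |signedPow q (1 + h / x) - 1|
      ≤ |x| ^ q * (2 * |1 + h / x - 1|) := by
        gcongr
        · exact abs_signedPow_le q x
        · exact abs_signedPow_sub_one_le hq hq1 _
    _ = 2 * |x| ^ (q - 1) * |h| := by
        rw [add_sub_cancel_left, abs_div, Real.rpow_sub_one hx'.ne']
        field_simp

/-- The signed power with `q ≥ 1` is locally Lipschitz. -/
lemma abs_signedPow_sub_le_of_one_le {q : ℝ} (hq : 1 ≤ q) {M x y : ℝ} (hx : |x| ≤ M)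
    (hy : |y| ≤ M) : |signedPow q x - signedPow q y| ≤ q * M ^ (q - 1) * |x - y| := by
  have hM : 0 ≤ M := (abs_nonneg x).trans hx
  have hmain : ∀ x y : ℝ, |x| ≤ M → |y| ≤ M → 0 < x → y ≤ x →
      signedPow q x - signedPow q y ≤ q * M ^ (q - 1) * (x - y) := by
    intro x y hx hy hx0 hyx
    rw [abs_of_pos hx0] at hx
    have h1 : x ^ (q - 1) ≤ M ^ (q - 1) := Real.rpow_le_rpow hx0.le hx (by linarith)
    have e1 : ∀ z : ℝ, 0 < z → z ^ q = z ^ (q - 1) * z := by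
      intro z hz; rw [← Real.rpow_add_one hz.ne']; congr 1; ring
    rcases le_or_gt 0 y with hy0 | hy0
    · have h2 := abs_rpow_add_mul_le hq x y
      have h3 : signedPow q y = |y| ^ q := by
        rcases hy0.eq_or_lt with rfl | hy0
        · rw [signedPow_zero, abs_zero, Real.zero_rpow (by linarith)]
        · rw [signedPow_of_pos hy0, abs_of_pos hy0]
      rw [signedPow_of_pos hx0, abs_of_pos hx0] at h2
      rw [h3, signedPow_of_pos hx0]
      have h4 : q * x ^ (q - 1) * (x - y) ≤ q * M ^ (q - 1) * (x - y) := by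
        have : 0 ≤ x - y := by linarith
        gcongr
      linarith
    · have h5 : (-y) ^ (q - 1) ≤ M ^ (q - 1) :=
        Real.rpow_le_rpow (by linarith) ((neg_le_abs y).trans hy) (by linarith)
      rw [signedPow_of_pos hx0, signedPow_of_neg hy0, e1 x hx0, e1 (-y) (by linarith)]
      have h6 : x ^ (q - 1) * x ≤ M ^ (q - 1) * x := by gcongr
      have h7 : (-y) ^ (q - 1) * (-y) ≤ M ^ (q - 1) * (-y) := by
        have : 0 ≤ -y := by linarith
        gcongr
      have h8 : 0 ≤ M ^ (q - 1) * (x - y) := by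
        have : 0 ≤ x - y := by linarith
        positivity
      nlinarith
  have hgen : ∀ x y : ℝ, |x| ≤ M → |y| ≤ M → y ≤ x →
      signedPow q x - signedPow q y ≤ q * M ^ (q - 1) * (x - y) := by
    intro x y hx hy hyx
    rcases lt_or_ge 0 x with h | h
    · exact hmain x y hx hy h hyx
    rcases h.lt_or_eq with h | rfl
    · have := hmain (-y) (-x) (by rwa [abs_neg]) (by rwa [abs_neg]) (by linarith) (by linarith)
      rw [signedPow_neg, signedPow_neg] at this
      linarith
    rcases hyx.lt_or_eq with h | rfl
    · have := hmain (-y) 0 (by rwa [abs_neg]) (by simpa) (by linarith) (by linarith)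
      rw [signedPow_neg] at this
      simp only [signedPow_zero] at this ⊢
      linarith
    · simp
  rcases le_total y x with h | h
  · rw [abs_of_nonneg (sub_nonneg.2 (monotone_signedPow (by linarith) h)),
      abs_of_nonneg (sub_nonneg.2 h)]
    exact hgen x y hx hy h
  · rw [abs_sub_comm, abs_sub_comm x, abs_of_nonneg
      (sub_nonneg.2 (monotone_signedPow (by linarith) h)), abs_of_nonneg (sub_nonneg.2 h)]
    exact hgen y x hy hx h

end SignedPower

section FirstOrder

variable {X : Type*} [MeasurableSpace X] {μ : Measure X} [IsFiniteMeasure μ]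

lemma integrable_signedPow {q : ℝ} (hq : 0 ≤ q) {f : X → ℝ} (hf : AEStronglyMeasurable f μ) {B : ℝ}
    (hB : ∀ᵐ x ∂μ, |f x| ≤ B) : Integrable (fun x => signedPow q (f x)) μ := by
  refine Integrable.of_bound
    ((measurable_signedPow q).comp_aemeasurable hf.aemeasurable).aestronglyMeasurable (B ^ q) ?_
  filter_upwards [hB] with x hx
  exact (abs_signedPow_le q _).trans (Real.rpow_le_rpow (abs_nonneg _) hx hq)

/-- The Euler-Lagrange inequality: the integral of the signed power is, up to a negative factor, a
subgradient in `l` of the convex function `∫ |f - l|^p`, so its sign tells on which side of `l` the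
best constant lies. -/
lemma IsBestConst.le_of_integral_signedPow_neg {p : ℝ≥0∞} (hp : 1 ≤ p) (hp' : p ≠ ∞) {f : X → ℝ}
    (hf : AEStronglyMeasurable f μ) {B : ℝ} (hB : ∀ᵐ x ∂μ, |f x| ≤ B) {m l : ℝ}
    (hm : IsBestConst p μ f m) (hl : ∫ x, signedPow (p.toReal - 1) (f x - l) ∂μ < 0) : m ≤ l := by
  by_contra! hlt
  have hp0 : p ≠ 0 := by positivity
  have hpr : 1 ≤ p.toReal := by
    rw [← ENNReal.toReal_one]; exact ENNReal.toReal_mono hp' hp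
  have hfp : MemLp f p μ := MemLp.of_bound hf B hB
  have hint : ∀ l : ℝ, Integrable (fun q => |f q - l| ^ p.toReal) μ := fun l =>
    (hfp.sub (memLp_const l)).integrable_norm_rpow hp0 hp'
  have hJ : Integrable (fun x => signedPow (p.toReal - 1) (f x - l)) μ := by
    refine integrable_signedPow (by linarith) (hf.sub aestronglyMeasurable_const) (B := B + |l|) ?_
    filter_upwards [hB] with x hx
    exact (abs_sub _ _).trans (by linarith)
  have h1 : ∫ x, |f x - l| ^ p.toReal ∂μ +
      p.toReal * (l - m) * ∫ x, signedPow (p.toReal - 1) (f x - l) ∂μ ≤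
      ∫ x, |f x - m| ^ p.toReal ∂μ := by
    rw [← integral_const_mul, ← integral_add (hint l) (hJ.const_mul _)]
    refine integral_mono ((hint l).add (hJ.const_mul _)) (hint m) fun x => ?_
    have := abs_rpow_add_mul_le hpr (f x - l) (f x - m)
    simp only
    linarith
  have h2 := (isBestConst_iff_integral hp hp' hfp m).1 hm l
  have h3 : 0 < p.toReal * (l - m) * ∫ x, signedPow (p.toReal - 1) (f x - l) ∂μ := by
    refine mul_pos_of_neg_of_neg ?_ hl
    nlinarith
  linarith

/-- Differentiation of `∫ sgn(s + εg) |s + εg|^q` at `ε = 0⁺`, allowing the derivative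
`q |s|^{q-1}` of the signed power to be singular at the zeros of `s`. -/
lemma tendsto_integral_signedPow_sub {q : ℝ} (hq : 0 < q) {s g : X → ℝ}
    (hs : AEStronglyMeasurable s μ) (hg : AEStronglyMeasurable g μ) {B : ℝ}
    (hsB : ∀ᵐ x ∂μ, |s x| ≤ B) (hgB : ∀ᵐ x ∂μ, |g x| ≤ B) (hs0 : ∀ᵐ x ∂μ, s x ≠ 0)
    (hint : Integrable (fun x => |s x| ^ (q - 1)) μ) :
    Tendsto (fun ε : ℝ => ∫ x, ε⁻¹ * (signedPow q (s x + ε * g x) - signedPow q (s x)) ∂μ)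
      (𝓝[>] 0) (𝓝 (∫ x, q * |s x| ^ (q - 1) * g x ∂μ)) := by
  have hmJ := measurable_signedPow q
  refine tendsto_integral_filter_of_dominated_convergence
    (fun x => 2 * |s x| ^ (q - 1) * B + q * (2 * B) ^ (q - 1) * B) ?_ ?_ ?_ ?_
  · refine Eventually.of_forall fun ε => ?_
    have h1 := hmJ.comp_aemeasurable (hs.add (hg.const_mul ε)).aemeasurable
    have h2 := hmJ.comp_aemeasurable hs.aemeasurable
    exact ((h1.sub h2).const_mul _).aestronglyMeasurable
  · have : ∀ᶠ ε : ℝ in 𝓝[>] 0, ε ∈ Ioo 0 1 := Ioo_mem_nhdsGT one_pos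
    filter_upwards [this] with ε hε
    filter_upwards [hsB, hgB, hs0] with x h1 h2 h3
    have hB0 : 0 ≤ B := (abs_nonneg _).trans h1
    have hε0 := hε.1
    have habs : |ε * g x| ≤ ε * B := by rw [abs_mul, abs_of_pos hε0]; gcongr
    have hinc : |signedPow q (s x + ε * g x) - signedPow q (s x)| ≤
        ε * (2 * |s x| ^ (q - 1) * B + q * (2 * B) ^ (q - 1) * B) := by
      rcases le_total q 1 with hq1 | hq1
      · refine (abs_signedPow_add_sub_le_of_le_one hq.le hq1 h3 _).trans ?_
        have h5 : 2 * |s x| ^ (q - 1) * |ε * g x| ≤ 2 * |s x| ^ (q - 1) * (ε * B) := by gcongr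
        have h6 : 0 ≤ ε * (q * (2 * B) ^ (q - 1) * B) := by positivity
        nlinarith
      · refine (abs_signedPow_sub_le_of_one_le hq1 (M := 2 * B) ?_ (by linarith)).trans ?_
        · refine (abs_add_le _ _).trans ?_
          have : ε * B ≤ 1 * B := by gcongr; exact hε.2.le
          linarith
        · rw [add_sub_cancel_left]
          have h5 : q * (2 * B) ^ (q - 1) * |ε * g x| ≤ q * (2 * B) ^ (q - 1) * (ε * B) := by
            gcongr
          have h6 : 0 ≤ ε * (2 * |s x| ^ (q - 1) * B) := by positivity
          nlinarith
    rw [Real.norm_eq_abs, abs_mul, abs_of_pos (inv_pos.2 hε0), inv_mul_le_iff₀ hε0]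
    exact hinc
  · exact ((hint.const_mul 2).mul_const B).add (integrable_const _)
  · filter_upwards [hs0] with x h3
    have h1 : HasDerivAt (fun ε : ℝ => signedPow q (s x + ε * g x))
        (q * |s x| ^ (q - 1) * g x) 0 := by
      have h2 : HasDerivAt (fun ε : ℝ => s x + ε * g x) (g x) 0 := by
        simpa using ((hasDerivAt_id (0 : ℝ)).mul_const (g x)).const_add (s x)
      have h4 := hasDerivAt_signedPow q h3
      have h5 : HasDerivAt (signedPow q) (q * |s x| ^ (q - 1)) (s x + 0 * g x) := by simpa using h4
      exact h5.comp (0 : ℝ) h2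
    have h6 := h1.hasDerivWithinAt (s := Ioi 0)
    rw [hasDerivWithinAt_iff_tendsto_slope' (by simp)] at h6
    refine h6.congr fun ε => ?_
    simp [slope_def_field, div_eq_inv_mul]

end FirstOrder

/-! ### The model problem for finite exponents greater than one -/

section Model

variable {N : ℕ}

/-- The first order part `r γ(y) ⟨a, y⟩` of a test function with gradient `a`, in parabolic
coordinates and after division by `ε`. -/
noncomputable def linPart (a : Space N) (q : Space N × ℝ) : ℝ :=
  q.2 * profile q.1 * inner ℝ a q.1

/-- The second order part `r² γ(y)² (½ ⟨H y, y⟩ - θ)` of a test function with Hessian `H` and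
time derivative `θ`, in parabolic coordinates and after division by `ε²`. -/
noncomputable def quadPart (H : Space N →L[ℝ] Space N) (θ : ℝ) (q : Space N × ℝ) : ℝ :=
  (q.2 * profile q.1) ^ 2 * (1 / 2 * inner ℝ (H q.1) q.1 - θ)

/-- The operator `N / (N + p - 2) Δ_p^n` (`N Δ_∞^n` for `p = ∞`) at a point with gradient `a` and
Hessian `H`. -/
noncomputable def modelOp (p : ℝ≥0∞) (H : Space N →L[ℝ] Space N) (a : Space N) : ℝ :=
  if p = ∞ then N * (inner ℝ (H a) a / ‖a‖ ^ 2)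
  else N / (N + p.toReal - 2) * (LinearMap.trace ℝ _ (H : Space N →ₗ[ℝ] Space N) +
    (p.toReal - 2) * (inner ℝ (H a) a / ‖a‖ ^ 2))

/-- Asymptotic upper bound `ε κ`, up to `o(ε)`, for the best constants of all bounded continuous
functions below `linPart + ε quadPart + o(ε)`. The bound is uniform in the function, so it applies
to a family depending on `ε`. -/
def UpperBound (p : ℝ≥0∞) (a : Space N) (H : Space N →L[ℝ] Space N) (θ κ : ℝ) : Prop :=
  ∀ δ : ℝ, 0 < δ → ∀ᶠ ε in 𝓝[>] (0 : ℝ), ∀ (f : Space N × ℝ → ℝ) (m : ℝ),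
    ContinuousOn f (chartDomain N) → (∃ B, ∀ q ∈ chartDomain N, |f q| ≤ B) →
    (∀ q ∈ chartDomain N, f q ≤ linPart a q + ε * (quadPart H θ q + δ)) →
    IsBestConst p (chartMeasure N) f m → m ≤ ε * (κ + 2 * δ)

lemma continuous_linPart (a : Space N) : Continuous (linPart a) := by
  have := continuous_profile (N := N)
  unfold linPart
  fun_prop

lemma continuous_quadPart (H : Space N →L[ℝ] Space N) (θ : ℝ) : Continuous (quadPart H θ) := by
  have := continuous_profile (N := N)
  unfold quadPart
  fun_prop

lemma abs_linPart_le (hN : 1 ≤ N) (a : Space N) {q : Space N × ℝ} (hq : q.2 ∈ Icc (0 : ℝ) 1) :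
    |linPart a q| ≤ ‖a‖ * √(maxRadiusSq N) := by
  have hγ := profile_pos q.1
  have h0 := hq.1
  rw [linPart, abs_mul, abs_of_nonneg (by positivity : 0 ≤ q.2 * profile q.1)]
  calc q.2 * profile q.1 * |inner ℝ a q.1| ≤ 1 * profile q.1 * (‖a‖ * ‖q.1‖) := by
        gcongr
        · exact hq.2
        · exact abs_real_inner_le_norm _ _
    _ = ‖a‖ * (profile q.1 * ‖q.1‖) := by ring
    _ ≤ _ := by gcongr; exact profile_mul_norm_le hN _

lemma abs_quadPart_le (hN : 1 ≤ N) (H : Space N →L[ℝ] Space N) (θ : ℝ) {q : Space N × ℝ}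
    (hq : q.2 ∈ Icc (0 : ℝ) 1) : |quadPart H θ q| ≤ 1 / 2 * ‖H‖ * maxRadiusSq N + |θ| := by
  have hγ := profile_pos q.1
  have h0 := hq.1
  have h1 : |1 / 2 * inner ℝ (H q.1) q.1 - θ| ≤ 1 / 2 * (‖H‖ * ‖q.1‖ * ‖q.1‖) + |θ| := by
    refine (abs_sub _ _).trans ?_
    rw [abs_mul, abs_of_pos (by norm_num : (0 : ℝ) < 1 / 2)]
    gcongr
    refine (abs_real_inner_le_norm _ _).trans ?_
    gcongr
    exact H.le_opNorm _
  rw [quadPart, abs_mul, abs_of_nonneg (by positivity : 0 ≤ (q.2 * profile q.1) ^ 2)]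
  calc (q.2 * profile q.1) ^ 2 * |1 / 2 * inner ℝ (H q.1) q.1 - θ|
      ≤ (1 * profile q.1) ^ 2 * (1 / 2 * (‖H‖ * ‖q.1‖ * ‖q.1‖) + |θ|) := by
        gcongr
        exact hq.2
    _ = 1 / 2 * ‖H‖ * (profile q.1 ^ 2 * ‖q.1‖ ^ 2) + profile q.1 ^ 2 * |θ| := by ring
    _ ≤ 1 / 2 * ‖H‖ * maxRadiusSq N + 1 ^ 2 * |θ| := by
        gcongr
        · exact profile_sq_mul_norm_sq_le hN _
        · exact profile_le_one _
    _ = _ := by ring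

lemma mem_Icc_of_mem_chartDomain {q : Space N × ℝ} (hq : q ∈ chartDomain N) :
    q.2 ∈ Icc (0 : ℝ) 1 := Ioo_subset_Icc_self hq.2

lemma integrable_signedPow_model (hN : 1 ≤ N) {k : ℝ} (hk : 0 ≤ k) (a : Space N)
    (H : Space N →L[ℝ] Space N) (θ l : ℝ) {ε : ℝ} (hε : 0 < ε) :
    Integrable (fun q => signedPow k (linPart a q + ε * (quadPart H θ q - l)))
      (chartMeasure N) := by
  have := isFiniteMeasure_chartMeasure hN
  have h1 := continuous_linPart a
  have h2 := continuous_quadPart H θ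
  refine integrable_signedPow hk (Continuous.aestronglyMeasurable (by fun_prop))
    (B := ‖a‖ * √(maxRadiusSq N) + ε * (1 / 2 * ‖H‖ * maxRadiusSq N + |θ| + |l|)) ?_
  filter_upwards [ae_mem_chartDomain] with q hq
  have hq' := mem_Icc_of_mem_chartDomain hq
  refine (abs_add_le _ _).trans (add_le_add (abs_linPart_le hN a hq') ?_)
  rw [abs_mul, abs_of_pos hε]
  gcongr
  exact (abs_sub _ _).trans (add_le_add (abs_quadPart_le hN H θ hq') le_rfl)

/-- For finite `p`, the upper bound follows from the sign of the Euler-Lagrange integral of the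
model function. -/
lemma upperBound_of_integral_neg (hN : 1 ≤ N) {p : ℝ≥0∞} (hp : 1 ≤ p) (hp' : p ≠ ∞)
    {a : Space N} {H : Space N →L[ℝ] Space N} {θ κ : ℝ}
    (h : ∀ δ : ℝ, 0 < δ → ∀ᶠ ε in 𝓝[>] (0 : ℝ), ∫ q, signedPow (p.toReal - 1)
      (linPart a q + ε * (quadPart H θ q - (κ + δ))) ∂(chartMeasure N) < 0) :
    UpperBound p a H θ κ := by
  intro δ hδ
  have := isFiniteMeasure_chartMeasure hN
  have hpr : 0 ≤ p.toReal - 1 := by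
    have : (1 : ℝ) ≤ p.toReal := by
      rw [← ENNReal.toReal_one]; exact ENNReal.toReal_mono hp' hp
    linarith
  filter_upwards [h δ hδ, self_mem_nhdsWithin] with ε hε hε0 f m hf ⟨B, hB⟩ hle hm
  have hfm := aestronglyMeasurable_of_continuousOn (μ := chartMeasure N) isOpen_chartDomain
    ae_mem_chartDomain hf
  refine hm.le_of_integral_signedPow_neg hp hp' hfm (ae_mem_chartDomain.mono hB) ?_
  refine lt_of_le_of_lt (integral_mono_ae ?_ ?_ ?_) hε
  · refine integrable_signedPow hpr (hfm.sub aestronglyMeasurable_const)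
      (B := B + |ε * (κ + 2 * δ)|) ?_
    filter_upwards [ae_mem_chartDomain] with q hq
    exact (abs_sub _ _).trans (by linarith [hB q hq])
  · exact integrable_signedPow_model hN hpr a H θ (κ + δ) hε0
  · filter_upwards [ae_mem_chartDomain] with q hq
    refine monotone_signedPow hpr ?_
    have := hle q hq
    linarith

lemma integral_pos_of_ae_pos {X : Type*} [MeasurableSpace X] {μ : Measure X} (hμ : μ ≠ 0)
    {f : X → ℝ} (hf : Integrable f μ) (h : ∀ᵐ x ∂μ, 0 < f x) : 0 < ∫ x, f x ∂μ := by
  have h0 : 0 ≤ᵐ[μ] f := h.mono fun x hx => hx.le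
  refine lt_of_le_of_ne (integral_nonneg_of_ae h0) fun heq => ?_
  rw [eq_comm, integral_eq_zero_iff_of_nonneg_ae h0 hf] at heq
  refine hμ (ae_eq_bot.1 (eventually_false_iff_eq_bot.1 ?_))
  filter_upwards [h, heq] with x h1 h2
  exact h1.ne' h2

end Model

section FiniteExponent

variable {N : ℕ}

lemma integral_spaceWeight (F : Space N → ℝ) :
    ∫ y, F y ∂(spaceWeight N) = ∫ y, ‖y‖ ^ 2 * profile y ^ N * F y := by
  rw [spaceWeight, integral_withDensity_eq_integral_toReal_smul (by fun_prop)
    (ae_of_all _ fun _ => ENNReal.ofReal_lt_top)]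
  refine integral_congr_ae (ae_of_all _ fun y => ?_)
  have := profile_pos y
  simp only [smul_eq_mul]
  rw [ENNReal.toReal_ofReal (by positivity)]

lemma integrable_spaceWeight_iff (F : Space N → ℝ) :
    Integrable F (spaceWeight N) ↔ Integrable fun y => ‖y‖ ^ 2 * profile y ^ N * F y := by
  rw [spaceWeight, integrable_withDensity_iff_integrable_smul' (by fun_prop)
    (ae_of_all _ fun _ => ENNReal.ofReal_lt_top)]
  refine integrable_congr (ae_of_all _ fun y => ?_)
  have := profile_pos y
  simp only [smul_eq_mul]
  rw [ENNReal.toReal_ofReal (by positivity)]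

lemma integrable_rpow_radialWeight (hN : 1 ≤ N) {k : ℝ} (hk : -(N : ℝ) < k) :
    Integrable (fun r : ℝ => r ^ k) (radialWeight N) := by
  rw [radialWeight, integrable_withDensity_iff_integrable_smul' (by fun_prop)
    (ae_of_all _ fun _ => ENNReal.ofReal_lt_top)]
  have h : IntegrableOn (fun r : ℝ => 2 * r ^ (k + (N - 1))) (Ioo 0 1) :=
    ((intervalIntegral.integrableOn_Ioo_rpow_iff one_pos).2 (by linarith)).const_mul 2
  refine h.congr ?_
  filter_upwards [ae_restrict_mem measurableSet_Ioo] with r hr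
  have hr0 : 0 < r := hr.1
  rw [ENNReal.toReal_ofReal (by positivity), smul_eq_mul, Real.rpow_add hr0]
  have : r ^ ((N : ℝ) - 1) = r ^ (N - 1) := by
    rw [← Real.rpow_natCast, Nat.cast_sub hN, Nat.cast_one]
  rw [this]; ring

lemma ae_fst_chartMeasure {P : Space N → Prop} (h : ∀ᵐ y, P y) :
    ∀ᵐ q ∂(chartMeasure N), P q.1 :=
  (Measure.quasiMeasurePreserving_fst (μ := spaceWeight N) (ν := radialWeight N)).ae
    (spaceWeight_absolutelyContinuous.ae_le h)

lemma ae_inner_ne_zero {a : Space N} (ha : a ≠ 0) : ∀ᵐ y : Space N, inner ℝ a y ≠ 0 := by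
  have h := Measure.addHaar_submodule (volume : Measure (Space N))
    (LinearMap.ker (innerSL ℝ a : Space N →ₗ[ℝ] ℝ)) (by
      intro htop
      have : a ∈ LinearMap.ker (innerSL ℝ a : Space N →ₗ[ℝ] ℝ) := by rw [htop]; trivial
      simp at this
      exact ha this)
  refine measure_mono_null ?_ h
  intro y hy
  simpa using hy

variable {a : Space N} (ha : a ≠ 0)

include ha in
lemma ae_linPart_ne_zero : ∀ᵐ q ∂(chartMeasure N), linPart a q ≠ 0 := by
  filter_upwards [ae_fst_chartMeasure (ae_inner_ne_zero ha), ae_mem_chartDomain] with q h1 h2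
  have := profile_pos q.1
  have h3 : 0 < q.2 := h2.2.1
  exact mul_ne_zero (by positivity) h1

lemma abs_linPart_rpow {q : Space N × ℝ} (hq : q ∈ chartDomain N) (k : ℝ) :
    |linPart a q| ^ k = (|inner ℝ a q.1| ^ k * profile q.1 ^ k) * q.2 ^ k := by
  have := profile_pos q.1
  have h3 : 0 < q.2 := hq.2.1
  rw [linPart, abs_mul, abs_of_pos (by positivity : 0 < q.2 * profile q.1),
    Real.mul_rpow (by positivity) (abs_nonneg _), Real.mul_rpow h3.le (by positivity)]
  ring

include ha in
lemma integrable_abs_linPart_rpow (hN : 1 ≤ N) {k : ℝ} (hk : -1 < k) :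
    Integrable (fun q => |linPart a q| ^ k) (chartMeasure N) := by
  have hN' : (1 : ℝ) ≤ N := by exact_mod_cast hN
  have h1 : Integrable (fun y : Space N => |inner ℝ a y| ^ k * profile y ^ k) (spaceWeight N) := by
    rw [integrable_spaceWeight_iff]
    refine (integrable_normSq_mul_profile_rpow hN ha hk (k := N + k) (by linarith)).congr
      (ae_of_all _ fun y => ?_)
    simp only
    rw [Real.rpow_add (profile_pos y), Real.rpow_natCast]; ring
  refine (h1.mul_prod (integrable_rpow_radialWeight hN (k := k) (by linarith))).congr ?_
  exact ae_mem_chartDomain.mono fun q hq => (abs_linPart_rpow hq k).symm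

lemma integral_signedPow_linPart (k : ℝ) :
    ∫ q, signedPow k (linPart a q) ∂(chartMeasure N) = 0 := by
  have h1 : ∀ᵐ q ∂(chartMeasure N), signedPow k (linPart a q) =
      (profile q.1 ^ k * signedPow k (inner ℝ a q.1)) * q.2 ^ k := by
    filter_upwards [ae_mem_chartDomain] with q hq
    have h3 : 0 < q.2 := hq.2.1
    rw [linPart, signedPow_mul, signedPow_mul, signedPow_of_pos h3,
      signedPow_of_pos (profile_pos _)]
    ring
  rw [integral_congr_ae h1, chartMeasure,
    integral_prod_mul (fun y : Space N => profile y ^ k * signedPow k (inner ℝ a y))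
      (fun r : ℝ => r ^ k), integral_spaceWeight]
  have h2 := integral_neg_eq_self (fun y : Space N => ‖y‖ ^ 2 * profile y ^ N *
    (profile y ^ k * signedPow k (inner ℝ a y))) volume
  simp only [norm_neg, profile_neg, inner_neg_right, signedPow_neg, mul_neg, integral_neg] at h2
  rw [show ∫ y : Space N, ‖y‖ ^ 2 * profile y ^ N *
    (profile y ^ k * signedPow k (inner ℝ a y)) = 0 by linarith, zero_mul]

include ha in
/-- With weight `|linPart|^{p-2}` the quadratic part has mean zero exactly for the time derivative
prescribed by the equation. -/
lemma integral_abs_linPart_rpow_mul (hN : 1 ≤ N) {p : ℝ} (hp : 1 < p)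
    (H : Space N →L[ℝ] Space N) {l : ℝ}
    (hl : l = N / (N + p - 2) * (LinearMap.trace ℝ _ (H : Space N →ₗ[ℝ] Space N) +
      (p - 2) * (inner ℝ (H a) a / ‖a‖ ^ 2))) :
    ∫ q, |linPart a q| ^ (p - 2) * quadPart H l q ∂(chartMeasure N) = 0 := by
  obtain ⟨n, rfl⟩ : ∃ n, N = n + 1 := ⟨N - 1, by lia⟩
  have hn : (0 : ℝ) ≤ n := by positivity
  have h1 : ∀ᵐ q ∂(chartMeasure (n + 1)), |linPart a q| ^ (p - 2) * quadPart H l q =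
      (|inner ℝ a q.1| ^ (p - 2) * profile q.1 ^ p * (1 / 2 * inner ℝ (H q.1) q.1 - l)) *
        (q.2 ^ (p - 2) * q.2 ^ 2) := by
    filter_upwards [ae_mem_chartDomain] with q hq
    have h3 : profile q.1 ^ p = profile q.1 ^ (p - 2) * profile q.1 ^ 2 := by
      rw [← Real.rpow_two, ← Real.rpow_add (profile_pos _)]; congr 1; ring
    rw [abs_linPart_rpow hq, quadPart, h3]
    ring
  have hβ : (0 : ℝ) < ((n + 1 : ℕ) + p) / (4 * (n + 1 : ℕ)) := by positivity
  have hm := integral_inner_rpow_mul_quadratic_gaussian ha (r := p - 2) (by linarith) hβ H (l := l)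
    (by
      rw [hl]
      have : (n : ℝ) + 1 + p - 2 ≠ 0 := by linarith
      have h4 : (n : ℝ) + 1 + (p - 2) = (n : ℝ) + 1 + p - 2 := by ring
      have h5 : (n : ℝ) + 1 + p ≠ 0 := by linarith
      have h6 : (n : ℝ) + 1 ≠ 0 := by linarith
      push_cast
      rw [h4]
      field_simp
      ring)
  rw [integral_congr_ae h1, chartMeasure, integral_prod_mul (fun y : Space (n + 1) =>
    |inner ℝ a y| ^ (p - 2) * profile y ^ p * (1 / 2 * inner ℝ (H y) y - l))
      (fun r : ℝ => r ^ (p - 2) * r ^ 2), integral_spaceWeight]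
  have h2 : ∀ y : Space (n + 1), ‖y‖ ^ 2 * profile y ^ (n + 1) *
      (|inner ℝ a y| ^ (p - 2) * profile y ^ p * (1 / 2 * inner ℝ (H y) y - l)) =
      (√(4 * Real.pi))⁻¹ ^ (((n + 1 : ℕ) : ℝ) + p) * (|inner ℝ a y| ^ (p - 2) * ‖y‖ ^ 2 *
        Real.exp (-(((n + 1 : ℕ) + p) / (4 * (n + 1 : ℕ))) * ‖y‖ ^ 2) *
          (1 / 2 * inner ℝ (H y) y - l)) := by
    intro y
    have h3 : profile y ^ (n + 1) * profile y ^ p = profile y ^ (((n + 1 : ℕ) : ℝ) + p) := by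
      rw [Real.rpow_add (profile_pos y), Real.rpow_natCast]
    rw [show ‖y‖ ^ 2 * profile y ^ (n + 1) *
      (|inner ℝ a y| ^ (p - 2) * profile y ^ p * (1 / 2 * inner ℝ (H y) y - l)) =
      (profile y ^ (n + 1) * profile y ^ p) * (|inner ℝ a y| ^ (p - 2) * ‖y‖ ^ 2 *
        (1 / 2 * inner ℝ (H y) y - l)) by ring, h3, profile_pow]
    ring
  simp_rw [h2]
  rw [integral_const_mul, hm, mul_zero, zero_mul]

include ha in
/-- The asymptotic upper bound for `1 < p < ∞`: the Euler-Lagrange integral vanishes at `ε = 0` by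
oddness, and its derivative is a moment of the quadratic part. -/
theorem exists_upperBound_of_one_lt (hN : 1 ≤ N) {p : ℝ≥0∞} (hp : 1 < p) (hp' : p ≠ ∞)
    (H : Space N →L[ℝ] Space N) (θ : ℝ) :
    ∃ c : ℝ, 0 < c ∧ UpperBound p a H θ (c * (modelOp p H a - θ)) := by
  have := isFiniteMeasure_chartMeasure hN
  have hpr : 1 < p.toReal := by
    rw [← ENNReal.toReal_one]; exact (ENNReal.toReal_lt_toReal (by simp) hp').2 hp
  set P := p.toReal with hP
  have hμ : chartMeasure N ≠ 0 := fun h =>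
    chartMeasure_ne_zero hN subset_rfl isOpen_chartDomain chartDomain_nonempty (by simp [h])
  have hI := integrable_abs_linPart_rpow ha hN (k := P - 2) (by linarith)
  have hpos : ∀ᵐ q ∂(chartMeasure N), 0 < |linPart a q| ^ (P - 2) := by
    filter_upwards [ae_linPart_ne_zero ha] with q hq
    have := abs_pos.2 hq
    positivity
  set I := ∫ q, |linPart a q| ^ (P - 2) ∂(chartMeasure N) with hIdef
  have hI0 : 0 < I := integral_pos_of_ae_pos hμ hI hpos
  have hbdd : ∀ g : Space N × ℝ → ℝ, Continuous g → ∀ B, (∀ q ∈ chartDomain N, |g q| ≤ B) →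
      Integrable (fun q => |linPart a q| ^ (P - 2) * g q) (chartMeasure N) := by
    intro g hg B hB
    exact hI.mul_bdd (c := B) hg.aestronglyMeasurable (ae_mem_chartDomain.mono hB)
  have hquad : ∀ l, Integrable (fun q => |linPart a q| ^ (P - 2) * quadPart H l q)
      (chartMeasure N) := fun l => hbdd _ (continuous_quadPart H l) _
    fun q hq => abs_quadPart_le hN H l (mem_Icc_of_mem_chartDomain hq)
  have hcp := continuous_profile (N := N)
  have hS : Integrable (fun q => |linPart a q| ^ (P - 2) * (q.2 * profile q.1) ^ 2)
      (chartMeasure N) := by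
    refine hbdd _ (by fun_prop) 1 fun q hq => ?_
    have h1 := mem_Icc_of_mem_chartDomain hq
    have h2 := profile_pos q.1
    rw [abs_of_nonneg (by positivity)]
    exact pow_le_one₀ (mul_nonneg h1.1 h2.le)
      (mul_le_one₀ h1.2 h2.le (profile_le_one _))
  set S := ∫ q, |linPart a q| ^ (P - 2) * (q.2 * profile q.1) ^ 2 ∂(chartMeasure N) with hSdef
  have hS0 : 0 < S := by
    refine integral_pos_of_ae_pos hμ hS ?_
    filter_upwards [hpos, ae_mem_chartDomain] with q h1 h2
    have h3 := profile_pos q.1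
    have h4 : 0 < q.2 := h2.2.1
    positivity
  have hL : modelOp p H a = N / (N + P - 2) * (LinearMap.trace ℝ _ (H : Space N →ₗ[ℝ] Space N) +
    (P - 2) * (inner ℝ (H a) a / ‖a‖ ^ 2)) := by rw [modelOp, if_neg hp']
  have hmom := integral_abs_linPart_rpow_mul ha hN hpr H hL
  have hval : ∫ q, |linPart a q| ^ (P - 2) * quadPart H θ q ∂(chartMeasure N) =
      (modelOp p H a - θ) * S := by
    have : ∀ q, |linPart a q| ^ (P - 2) * quadPart H θ q =
        |linPart a q| ^ (P - 2) * quadPart H (modelOp p H a) q +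
        (modelOp p H a - θ) * (|linPart a q| ^ (P - 2) * (q.2 * profile q.1) ^ 2) := by
      intro q; simp only [quadPart]; ring
    simp_rw [this]
    rw [integral_add (hquad _) (hS.const_mul _), hmom, integral_const_mul, zero_add]
  refine ⟨S / I, by positivity, upperBound_of_integral_neg hN hp.le hp' fun δ hδ => ?_⟩
  set κ := S / I * (modelOp p H a - θ) with hκ
  have hlim := tendsto_integral_signedPow_sub (μ := chartMeasure N) (q := P - 1) (by linarith)
    (s := linPart a) (g := fun q => quadPart H θ q - (κ + δ))
    (B := ‖a‖ * √(maxRadiusSq N) + (1 / 2 * ‖H‖ * maxRadiusSq N + |θ| + |κ + δ|))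
    (continuous_linPart a).aestronglyMeasurable
    ((continuous_quadPart H θ).sub continuous_const).aestronglyMeasurable
    (by
      filter_upwards [ae_mem_chartDomain] with q hq
      have h1 := mem_Icc_of_mem_chartDomain hq
      have h2 := abs_linPart_le hN a h1
      have h3 := abs_quadPart_le hN H θ h1
      linarith [abs_nonneg (quadPart H θ q), abs_nonneg (κ + δ)])
    (by
      filter_upwards [ae_mem_chartDomain] with q hq
      have h1 := mem_Icc_of_mem_chartDomain hq
      have h2 := abs_linPart_le hN a h1
      have h3 := abs_quadPart_le hN H θ h1
      refine (abs_sub _ _).trans ?_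
      linarith [abs_nonneg (linPart a q)])
    (ae_linPart_ne_zero ha) (by
      rw [show P - 1 - 1 = P - 2 by ring]; exact hI)
  have hneg : ∫ q, (P - 1) * |linPart a q| ^ (P - 1 - 1) * (quadPart H θ q - (κ + δ))
      ∂(chartMeasure N) < 0 := by
    have : ∀ q, (P - 1) * |linPart a q| ^ (P - 1 - 1) * (quadPart H θ q - (κ + δ)) =
        (P - 1) * (|linPart a q| ^ (P - 2) * quadPart H θ q -
          (κ + δ) * |linPart a q| ^ (P - 2)) := by
      intro q; rw [show P - 1 - 1 = P - 2 by ring]; ring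
    simp_rw [this]
    rw [integral_const_mul, integral_sub (hquad _) (hI.const_mul _), integral_const_mul, hval,
      ← hIdef]
    have h5 : (modelOp p H a - θ) * S - (κ + δ) * I = -(δ * I) := by
      rw [hκ]; field_simp; ring
    rw [h5]
    have h6 : 0 < δ * I := by positivity
    nlinarith
  filter_upwards [hlim.eventually_lt_const hneg, self_mem_nhdsWithin] with ε h1 hε
  have hε0 : 0 < ε := hε
  rw [integral_const_mul] at h1
  have hJ1 : Integrable (fun q => signedPow (P - 1) (linPart a q)) (chartMeasure N) :=
    integrable_signedPow (by linarith) (continuous_linPart a).aestronglyMeasurable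
      (ae_mem_chartDomain.mono fun q hq => abs_linPart_le hN a (mem_Icc_of_mem_chartDomain hq))
  have hJ2 := integrable_signedPow_model hN (by linarith : 0 ≤ P - 1) a H θ (κ + δ) hε0
  rw [integral_sub hJ2 hJ1, integral_signedPow_linPart, sub_zero] at h1
  exact (mul_neg_iff.1 h1).elim (fun h => h.2) fun h => absurd h.1 (not_lt.2 (by positivity))

end FiniteExponent

/-! ### The model problem for the infinite exponent -/

section InfiniteExponent

variable {N : ℕ}

lemma maxRadiusSq_pos (hN : 1 ≤ N) : 0 < maxRadiusSq N := by
  have hN' : (0 : ℝ) < N := by positivity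
  have := Real.pi_pos
  unfold maxRadiusSq
  positivity

lemma profile_sq_of_norm_sq_eq (hN : 1 ≤ N) {y : Space N} (hy : ‖y‖ ^ 2 = 2 * N) :
    profile y ^ 2 = maxRadiusSq N / (2 * N) := by
  have hN' : (0 : ℝ) < N := by positivity
  rw [profile_sq, hy, maxRadiusSq, div_self (by positivity)]
  field_simp

/-- The equality case of `profile_sq_mul_norm_sq_le`. -/
lemma norm_sq_eq_of_profile_sq_mul (hN : 1 ≤ N) {y : Space N}
    (hy : profile y ^ 2 * ‖y‖ ^ 2 = maxRadiusSq N) : ‖y‖ ^ 2 = 2 * N := by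
  have hN' : (0 : ℝ) < N := by positivity
  have hpi := Real.pi_pos
  by_contra hne
  rw [profile_sq, maxRadiusSq] at hy
  set v := ‖y‖ ^ 2 / (2 * N) with hv
  have h1 : ‖y‖ ^ 2 = 2 * N * v := by rw [hv]; field_simp
  have hv1 : v - 1 ≠ 0 := by
    intro h
    apply hne
    rw [h1, sub_eq_zero.1 h, mul_one]
  have h2 : v < Real.exp (v - 1) := by linarith [Real.add_one_lt_exp hv1]
  have h3 : Real.exp (-v) * v < Real.exp (-1) := by
    calc Real.exp (-v) * v < Real.exp (-v) * Real.exp (v - 1) := by gcongr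
      _ = Real.exp (-1) := by rw [← Real.exp_add]; congr 1; ring
  rw [h1] at hy
  have h4 : Real.exp (-v) * v = Real.exp (-1) := by
    field_simp at hy
    linarith
  linarith

lemma profile_sq_mul_norm_pow_four_le (hN : 1 ≤ N) (y : Space N) :
    profile y ^ 2 * ‖y‖ ^ 4 ≤ (2 * N) ^ 2 := by
  have hN' : (0 : ℝ) < N := by positivity
  have hpi := Real.pi_gt_three
  rw [profile_sq]
  set v := ‖y‖ ^ 2 / (2 * N) with hv
  have hv0 : 0 ≤ v := by positivity
  have h1 : ‖y‖ ^ 4 = (2 * N * v) ^ 2 := by rw [hv]; field_simp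
  have h2 : v ^ 2 ≤ 2 * Real.exp v := by linarith [Real.quadratic_le_exp_of_nonneg hv0]
  have h3 : Real.exp (-v) * v ^ 2 ≤ 2 := by
    calc Real.exp (-v) * v ^ 2 ≤ Real.exp (-v) * (2 * Real.exp v) := by gcongr
      _ = 2 := by rw [Real.exp_neg]; field_simp
  rw [h1]
  calc Real.exp (-v) / (4 * Real.pi) * (2 * N * v) ^ 2
      = (2 * (N : ℝ)) ^ 2 * ((Real.exp (-v) * v ^ 2) / (4 * Real.pi)) := by ring
    _ ≤ (2 * (N : ℝ)) ^ 2 * 1 := by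
        gcongr
        rw [div_le_one (by positivity)]
        linarith
    _ = _ := mul_one _

variable {a : Space N} (ha : a ≠ 0) (hN : 1 ≤ N)

include ha hN

/-- At a maximum point of the linear part the quadratic part takes a value determined by the
normalized infinity Laplacian. -/
lemma quadPart_eq_of_linPart_eq_max (H : Space N →L[ℝ] Space N) (θ : ℝ) {q : Space N × ℝ}
    (hq : q.2 ∈ Icc (0 : ℝ) 1) (hmax : linPart a q = ‖a‖ * √(maxRadiusSq N)) :
    quadPart H θ q = maxRadiusSq N / (2 * N) * (modelOp ∞ H a - θ) := by
  have hN' : (0 : ℝ) < N := by positivity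
  have ha0 : 0 < ‖a‖ := norm_pos_iff.2 ha
  have hR := maxRadiusSq_pos hN
  have hRs : 0 < √(maxRadiusSq N) := Real.sqrt_pos.2 hR
  have hγ := profile_pos q.1
  obtain ⟨y, r⟩ := q
  simp only [linPart, quadPart] at *
  have h1 : inner ℝ a y ≤ ‖a‖ * ‖y‖ := real_inner_le_norm a y
  have h2 : profile y * ‖y‖ ≤ √(maxRadiusSq N) := profile_mul_norm_le hN y
  have h3 : r * profile y * inner ℝ a y ≤ r * profile y * (‖a‖ * ‖y‖) := by
    have := hq.1
    gcongr
  have h4 : r * profile y * (‖a‖ * ‖y‖) = r * (‖a‖ * (profile y * ‖y‖)) := by ring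
  have h5 : ‖a‖ * (profile y * ‖y‖) ≤ ‖a‖ * √(maxRadiusSq N) := by gcongr
  have hA : 0 < ‖a‖ * √(maxRadiusSq N) := by positivity
  have hr0 := hq.1
  have hr1 : r = 1 := by
    have : r * (‖a‖ * (profile y * ‖y‖)) ≤ r * (‖a‖ * √(maxRadiusSq N)) := by gcongr
    have h6 : 1 * (‖a‖ * √(maxRadiusSq N)) ≤ r * (‖a‖ * √(maxRadiusSq N)) := by linarith
    exact le_antisymm hq.2 (le_of_mul_le_mul_right h6 hA)
  subst hr1
  have h6 : profile y * ‖y‖ = √(maxRadiusSq N) := by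
    refine le_antisymm h2 (le_of_mul_le_mul_left ?_ ha0)
    linarith
  have h7 : profile y ^ 2 * ‖y‖ ^ 2 = maxRadiusSq N := by
    rw [← mul_pow, h6, Real.sq_sqrt hR.le]
  have h8 := norm_sq_eq_of_profile_sq_mul hN h7
  have h9 : inner ℝ a y = ‖a‖ * ‖y‖ := by
    refine le_antisymm h1 (le_of_mul_le_mul_left ?_ hγ)
    linarith
  have h10 : y = (‖y‖ / ‖a‖) • a := by
    rw [inner_eq_norm_mul_iff_real] at h9
    rw [div_eq_inv_mul, mul_smul, h9, smul_smul, inv_mul_cancel₀ ha0.ne', one_smul]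
  have h11 : inner ℝ (H y) y = 2 * N * (inner ℝ (H a) a / ‖a‖ ^ 2) := by
    rw [← h8]
    conv_lhs => rw [h10, map_smul, real_inner_smul_left, real_inner_smul_right]
    field_simp
  rw [one_mul, h11, profile_sq_of_norm_sq_eq hN h8, modelOp, if_pos rfl]
  ring

lemma exists_linPart_eq_max : ∃ q : Space N × ℝ, q.2 = 1 ∧
    linPart a q = ‖a‖ * √(maxRadiusSq N) := by
  have hN' : (0 : ℝ) < N := by positivity
  have ha0 : 0 < ‖a‖ := norm_pos_iff.2 ha
  refine ⟨((√(2 * N) / ‖a‖) • a, 1), rfl, ?_⟩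
  set y := (√(2 * N) / ‖a‖) • a with hy
  have hny : ‖y‖ = √(2 * N) := by
    rw [hy, norm_smul, norm_div, norm_norm, Real.norm_eq_abs, abs_of_nonneg (Real.sqrt_nonneg _)]
    field_simp
  have hn2 : ‖y‖ ^ 2 = 2 * N := by rw [hny, Real.sq_sqrt (by positivity)]
  have h1 : profile y * ‖y‖ = √(maxRadiusSq N) := by
    rw [eq_comm, Real.sqrt_eq_iff_mul_self_eq (maxRadiusSq_pos hN).le
      (mul_nonneg (profile_pos y).le (norm_nonneg _))]
    have h2 := profile_sq_of_norm_sq_eq hN hn2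
    calc maxRadiusSq N = profile y ^ 2 * ‖y‖ ^ 2 := by rw [h2, hn2]; field_simp
      _ = _ := by ring
  have h2 : inner ℝ a y = ‖a‖ * ‖y‖ := by
    rw [hny, hy, real_inner_smul_right, real_inner_self_eq_norm_sq]
    field_simp
  simp only [linPart, one_mul]
  rw [h2, ← h1]
  ring

/-- The maximum of a small perturbation of the linear part is, to first order, governed by the
perturbation at the maximum points. -/
lemma eventually_linPart_add_le (H : Space N →L[ℝ] Space N) (θ : ℝ) {δ : ℝ} (hδ : 0 < δ) :
    ∀ᶠ ε in 𝓝[>] (0 : ℝ), ∀ q : Space N × ℝ, q.2 ∈ Icc (0 : ℝ) 1 →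
      linPart a q + ε * quadPart H θ q ≤
        ‖a‖ * √(maxRadiusSq N) + ε * (maxRadiusSq N / (2 * N) * (modelOp ∞ H a - θ) + δ) := by
  have hN' : (0 : ℝ) < N := by positivity
  have ha0 : 0 < ‖a‖ := norm_pos_iff.2 ha
  have hRs : 0 < √(maxRadiusSq N) := Real.sqrt_pos.2 (maxRadiusSq_pos hN)
  set M := ‖a‖ * √(maxRadiusSq N) with hM
  have hM0 : 0 < M := by positivity
  set κ := maxRadiusSq N / (2 * N) * (modelOp ∞ H a - θ) with hκ
  -- away from the maximum points the linear part stays below its maximum by a fixed gap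
  obtain ⟨η, hη, hgap⟩ : ∃ η > 0, ∀ q : Space N × ℝ, q.2 ∈ Icc (0 : ℝ) 1 → κ + δ ≤ quadPart H θ q →
      linPart a q ≤ M - η := by
    -- `W` is compact because `γ(y)|y|²` is bounded while `γ(y)|y|` stays away from zero on it
    set W : Set (Space N × ℝ) := {q | q.2 ∈ Icc (0 : ℝ) 1 ∧ κ + δ ≤ quadPart H θ q ∧
      M / 2 ≤ linPart a q} with hW
    have hWc : IsClosed W := by
      refine (isClosed_Icc.preimage continuous_snd).inter
        ((isClosed_le continuous_const (continuous_quadPart H θ)).inter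
          (isClosed_le continuous_const (continuous_linPart a)))
    have hWb : W ⊆ Metric.closedBall 0 (2 * ‖a‖ * (2 * N) / M) ×ˢ Icc (0 : ℝ) 1 := by
      rintro ⟨y, r⟩ ⟨hr, -, hlin⟩
      refine ⟨?_, hr⟩
      simp only at hr
      have hγ := profile_pos y
      simp only [linPart] at hlin
      have h1 : M / 2 ≤ ‖a‖ * (profile y * ‖y‖) := by
        calc M / 2 ≤ r * profile y * inner ℝ a y := hlin
          _ ≤ r * profile y * (‖a‖ * ‖y‖) := by
              have := hr.1
              gcongr
              exact real_inner_le_norm a y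
          _ ≤ 1 * profile y * (‖a‖ * ‖y‖) := by gcongr; exact hr.2
          _ = _ := by ring
      have h2 : (profile y * ‖y‖ ^ 2) ^ 2 ≤ (2 * N) ^ 2 :=
        (le_of_eq (by ring)).trans (profile_sq_mul_norm_pow_four_le hN y)
      have h3 : profile y * ‖y‖ ^ 2 ≤ 2 * N := by
        rwa [pow_le_pow_iff_left₀ (by positivity) (by positivity) two_ne_zero] at h2
      rw [mem_closedBall_zero_iff, le_div_iff₀ hM0]
      calc ‖y‖ * M = 2 * (‖y‖ * (M / 2)) := by ring
        _ ≤ 2 * (‖y‖ * (‖a‖ * (profile y * ‖y‖))) := by gcongr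
        _ = 2 * ‖a‖ * (profile y * ‖y‖ ^ 2) := by ring
        _ ≤ _ := by gcongr
    have hWk : IsCompact W :=
      ((isCompact_closedBall _ _).prod isCompact_Icc).of_isClosed_subset hWc hWb
    rcases W.eq_empty_or_nonempty with hWe | hWne
    · refine ⟨M / 2, by positivity, fun q hq hquad => ?_⟩
      by_contra! hlt
      have : q ∈ W := ⟨hq, hquad, by linarith⟩
      rw [hWe] at this
      exact this
    · obtain ⟨q₀, hq₀, hmax⟩ := hWk.exists_isMaxOn hWne (continuous_linPart a).continuousOn
      have hle := (le_abs_self _).trans (abs_linPart_le hN a hq₀.1)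
      have hlt : linPart a q₀ < M := by
        refine lt_of_le_of_ne hle fun heq => ?_
        have := quadPart_eq_of_linPart_eq_max ha hN H θ hq₀.1 heq
        have h2 := hq₀.2.1
        rw [this] at h2
        linarith
      refine ⟨M - linPart a q₀, by linarith, fun q hq hquad => ?_⟩
      rw [sub_sub_cancel]
      by_cases h : M / 2 ≤ linPart a q
      · exact hmax ⟨hq, hquad, h⟩
      · exact (not_le.1 h).le.trans hq₀.2.2
  set B := 1 / 2 * ‖H‖ * maxRadiusSq N + |θ| with hB
  have hsmall : ∀ᶠ ε in 𝓝[>] (0 : ℝ), ε * (B + |κ + δ|) < η := by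
    have : Tendsto (fun ε : ℝ => ε * (B + |κ + δ|)) (𝓝[>] 0) (𝓝 0) := by
      have h : Tendsto (fun ε : ℝ => ε * (B + |κ + δ|)) (𝓝 0) (𝓝 (0 * (B + |κ + δ|))) :=
        (continuous_id.mul continuous_const).tendsto 0
      rw [zero_mul] at h
      exact h.mono_left nhdsWithin_le_nhds
    exact this.eventually_lt_const hη
  filter_upwards [hsmall, self_mem_nhdsWithin] with ε hε hε0 q hq
  have hε0' : 0 < ε := hε0
  by_cases h : κ + δ ≤ quadPart H θ q
  · have h1 := hgap q hq h
    have h2 := (le_abs_self _).trans (abs_quadPart_le hN H θ hq)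
    have h3 : ε * quadPart H θ q ≤ ε * B := by gcongr
    have h4 : ε * (-|κ + δ|) ≤ ε * (κ + δ) := by gcongr; exact neg_abs_le _
    linarith
  · have h1 := (le_abs_self _).trans (abs_linPart_le hN a hq)
    have h3 : ε * quadPart H θ q ≤ ε * (κ + δ) := by gcongr; exact (not_le.1 h).le
    linarith

/-- The asymptotic upper bound for `p = ∞`. The best constant is the midrange, the maximum and the
minimum of the linear part cancel, and the quadratic part has the same value at both extremal
points. -/
theorem exists_upperBound_top (H : Space N →L[ℝ] Space N) (θ : ℝ) :
    ∃ c : ℝ, 0 < c ∧ UpperBound ∞ a H θ (c * (modelOp ∞ H a - θ)) := by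
  have hN' : (0 : ℝ) < N := by positivity
  have hRpos := maxRadiusSq_pos hN
  refine ⟨maxRadiusSq N / (2 * N), by positivity, fun δ hδ => ?_⟩
  set κ := maxRadiusSq N / (2 * N) * (modelOp ∞ H a - θ) with hκ
  set M := ‖a‖ * √(maxRadiusSq N) with hM
  have hM0 : 0 ≤ M := by positivity
  have := isFiniteMeasure_chartMeasure hN
  obtain ⟨⟨y₀, r₀⟩, hr₀, hmax⟩ := exists_linPart_eq_max ha hN
  simp only at hr₀
  subst hr₀
  have hquad₀ := quadPart_eq_of_linPart_eq_max ha hN H θ (q := (y₀, 1)) (by simp) hmax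
  -- the antipode of the maximum point is the minimum point, with the same quadratic part
  have hmin : linPart a (-y₀, 1) = -M := by
    rw [hM, ← hmax]; simp [linPart, profile_neg]
  have hquadmin : quadPart H θ (-y₀, 1) = κ := by
    rw [hκ, ← hquad₀]; simp [quadPart, profile_neg]
  filter_upwards [eventually_linPart_add_le ha hN H θ hδ, self_mem_nhdsWithin]
    with ε hε hε0 f m hf ⟨B, hB⟩ hle hm
  have hε0' : 0 < ε := hε0
  by_contra! hlt
  have hfm := aestronglyMeasurable_of_continuousOn (μ := chartMeasure N) isOpen_chartDomain
    ae_mem_chartDomain hf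
  have hfp : MemLp f ∞ (chartMeasure N) := MemLp.of_bound hfm B (ae_mem_chartDomain.mono hB)
  set A := (eLpNorm (fun q => f q - m) ∞ (chartMeasure N)).toReal with hA
  have hfin : eLpNorm (fun q => f q - m) ∞ (chartMeasure N) ≠ ∞ := (hfp.sub (memLp_const m)).2.ne
  have hae : ∀ᵐ q ∂(chartMeasure N), m - A ≤ f q := by
    filter_upwards [ae_le_eLpNormEssSup (μ := chartMeasure N) (f := fun q => f q - m)] with q hq
    have h1 : |f q - m| ≤ A := by
      rw [hA, ← Real.norm_eq_abs, ← toReal_enorm]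
      exact ENNReal.toReal_mono hfin hq
    linarith [(abs_le.1 h1).1]
  have hall : ∀ q ∈ chartDomain N, m - A ≤ f q := by
    by_contra! hcon
    obtain ⟨q, hq, hqlt⟩ := hcon
    refine chartMeasure_ne_zero hN inter_subset_left
      (hf.isOpen_inter_preimage isOpen_chartDomain (isOpen_Iio (a := m - A))) ⟨q, hq, hqlt⟩ ?_
    refine measure_mono_null ?_ hae
    rintro q ⟨-, hq⟩
    exact (show f q < m - A from hq).not_ge
  have hclosed : IsClosed {q : Space N × ℝ | m - A ≤ linPart a q + ε * (quadPart H θ q + δ)} := by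
    have h1 := continuous_linPart a
    have h2 := continuous_quadPart H θ
    exact isClosed_le continuous_const (by fun_prop)
  have hsub := closure_minimal (fun q hq => (hall q hq).trans (hle q hq)) hclosed
  have hmem : ((-y₀, 1) : Space N × ℝ) ∈ closure (chartDomain N) := by
    rw [chartDomain, closure_prod_eq, closure_Ioo zero_ne_one]
    simp
  -- `f ≥ m - A` on the domain, so the model function at the minimum point bounds `m - A`
  have hlow : m - A ≤ -M + ε * (κ + δ) := by
    have h : m - A ≤ linPart a (-y₀, 1) + ε * (quadPart H θ (-y₀, 1) + δ) := hsub hmem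
    rwa [hmin, hquadmin] at h
  have hεδ : 0 < ε * δ := by positivity
  have hnorm : eLpNorm (fun q => f q - ε * (κ + 2 * δ)) ∞ (chartMeasure N) ≤
      ENNReal.ofReal (A - (m - ε * (κ + 2 * δ))) := by
    refine eLpNormEssSup_le_of_ae_bound ?_
    filter_upwards [ae_mem_chartDomain] with q hq
    have h1 := hall q hq
    have h2 := hle q hq
    have h3 := hε q (mem_Icc_of_mem_chartDomain hq)
    rw [Real.norm_eq_abs, abs_le]
    constructor <;> linarith
  have h3 := (hm _).trans hnorm
  rw [← ENNReal.ofReal_toReal hfin, ← hA, ENNReal.ofReal_le_ofReal_iff'] at h3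
  rcases h3 with h3 | h3 <;> linarith

end InfiniteExponent

/-! ### Slicing transversally to the gradient -/

section SymSign

/-- The symmetrization of `s ↦ sgn (s + h)` under `s ↦ -s`: equal to `sgn h` for `|s| < |h|` and to
`0` for `|s| > |h|`. -/
noncomputable def symSign (s h : ℝ) : ℝ := (Real.sign (s + h) + Real.sign (h - s)) / 2

lemma abs_symSign_le_one (s h : ℝ) : |symSign s h| ≤ 1 := by
  have hs : ∀ x, |Real.sign x| ≤ 1 := fun x => by
    have := abs_signedPow_le 0 x
    rwa [signedPow_zero_left, Real.rpow_zero] at this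
  have := abs_add_le (Real.sign (s + h)) (Real.sign (h - s))
  rw [symSign, abs_div, abs_two, div_le_one two_pos]
  linarith [hs (s + h), hs (h - s)]

lemma symSign_eq_zero {s h : ℝ} (hsh : |h| < |s|) : symSign s h = 0 := by
  rw [symSign]
  obtain ⟨h1, h2⟩ := abs_lt.1 hsh
  rcases lt_abs.1 hsh with h3 | h3
  · have hs : 0 < s := (abs_nonneg h).trans_lt h3
    rw [abs_of_pos hs] at h1 h2
    rw [Real.sign_of_pos (by linarith), Real.sign_of_neg (by linarith)]
    norm_num
  · have hs : s < 0 := by linarith [(abs_nonneg h).trans_lt h3]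
    rw [abs_of_neg hs] at h1 h2
    rw [Real.sign_of_neg (by linarith), Real.sign_of_pos (by linarith)]
    norm_num

lemma symSign_of_abs_lt {s h : ℝ} (hsh : |s| < h) : symSign s h = 1 := by
  obtain ⟨h1, h2⟩ := abs_lt.1 hsh
  rw [symSign, Real.sign_of_pos (by linarith), Real.sign_of_pos (by linarith)]
  norm_num

lemma symSign_neg_right (s h : ℝ) : symSign s (-h) = -symSign s h := by
  rw [symSign, symSign, show s + -h = -(h - s) by ring, show -h - s = -(s + h) by ring,
    Real.sign_neg, Real.sign_neg]
  ring

lemma symSign_zero_right (s : ℝ) : symSign s 0 = 0 := by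
  rw [symSign, add_zero, zero_sub, Real.sign_neg]
  simp

lemma symSign_mul_mul {c : ℝ} (hc : 0 < c) (s h : ℝ) : symSign (c * s) (c * h) = symSign s h := by
  rw [symSign, symSign, ← mul_add, ← mul_sub, sign_mul', sign_mul', Real.sign_of_pos hc, one_mul,
    one_mul]

lemma integral_symSign {c : ℝ} (hc : 0 < c) (h : ℝ) :
    ∫ η : ℝ, symSign (c * η) h = 2 * h / c := by
  have hpos : ∀ h : ℝ, 0 < h → ∫ η : ℝ, symSign (c * η) h = 2 * h / c := by
    intro h hh
    have h1 : (fun η : ℝ => symSign (c * η) h) =ᵐ[volume]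
        (Ioo (-(h / c)) (h / c)).indicator fun _ => (1 : ℝ) := by
      filter_upwards [Measure.ae_ne volume (h / c), Measure.ae_ne volume (-(h / c))] with η h2 h3
      have hmem : η ∈ Ioo (-(h / c)) (h / c) ↔ |η| < h / c := by rw [abs_lt, mem_Ioo]
      by_cases h4 : |η| < h / c
      · rw [indicator_of_mem (hmem.2 h4), symSign_of_abs_lt]
        rw [abs_mul, abs_of_pos hc, mul_comm]
        exact (lt_div_iff₀ hc).1 h4
      · rw [indicator_of_notMem (mt hmem.1 h4), symSign_eq_zero]
        have h6 : h / c < |η| := by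
          refine lt_of_le_of_ne (not_lt.1 h4) fun h7 => ?_
          rcases abs_choice η with h8 | h8
          · exact h2 (by rw [h7, h8])
          · exact h3 (by rw [h7, h8, neg_neg])
        rw [abs_of_pos hh, abs_mul, abs_of_pos hc, mul_comm]
        exact (div_lt_iff₀ hc).1 h6
    rw [integral_congr_ae h1, integral_indicator measurableSet_Ioo]
    have h9 : 0 < h / c := by positivity
    simp only [integral_const, MeasurableSet.univ, measureReal_restrict_apply, univ_inter,
      smul_eq_mul, mul_one]
    rw [Measure.real, Real.volume_Ioo, ENNReal.toReal_ofReal (by linarith)]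
    ring
  rcases lt_trichotomy h 0 with hh | rfl | hh
  · have := hpos (-h) (by linarith)
    simp_rw [symSign_neg_right] at this
    rw [integral_neg] at this
    linear_combination -this
  · simp [symSign_zero_right]
  · exact hpos h hh

lemma tendsto_sign {α : Type*} {l : Filter α} {f : α → ℝ} {x : ℝ} (hx : x ≠ 0)
    (hf : Tendsto f l (𝓝 x)) : Tendsto (fun t => Real.sign (f t)) l (𝓝 (Real.sign x)) := by
  refine Tendsto.congr' ?_ tendsto_const_nhds
  rcases lt_or_gt_of_ne hx with hx | hx
  · filter_upwards [hf.eventually_lt_const hx] with t ht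
    rw [Real.sign_of_neg hx, Real.sign_of_neg ht]
  · filter_upwards [hf.eventually_const_lt hx] with t ht
    rw [Real.sign_of_pos hx, Real.sign_of_pos ht]

lemma tendsto_symSign {α : Type*} {l : Filter α} {f g : α → ℝ} {s h : ℝ} (h1 : s + h ≠ 0)
    (h2 : h - s ≠ 0) (hf : Tendsto f l (𝓝 s)) (hg : Tendsto g l (𝓝 h)) :
    Tendsto (fun t => symSign (f t) (g t)) l (𝓝 (symSign s h)) :=
  ((tendsto_sign h1 (hf.add hg)).add (tendsto_sign h2 (hg.sub hf))).div_const 2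

end SymSign

section Slicing

variable {n : ℕ}

/-- Slicing of `ℝ^{n+1} × ℝ` by the first coordinate in an orthonormal basis. -/
noncomputable def sliceEquiv (b : OrthonormalBasis (Fin (n + 1)) ℝ (Space (n + 1))) :
    ((Fin n → ℝ) × ℝ) × ℝ ≃ᵐ Space (n + 1) × ℝ :=
  MeasurableEquiv.prodComm.trans (MeasurableEquiv.prodAssoc.symm.trans
    (MeasurableEquiv.prodCongr ((MeasurableEquiv.piFinSuccAbove (fun _ => ℝ) 0).symm.trans
      (ofCoordsEquiv b)) (MeasurableEquiv.refl ℝ)))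

/-- The measure `dv dr` on `ℝ^n × (0, 1)`. -/
noncomputable def sliceMeasure (n : ℕ) : Measure ((Fin n → ℝ) × ℝ) :=
  (volume : Measure (Fin n → ℝ)).prod ((volume : Measure ℝ).restrict (Ioo 0 1))

instance : SFinite (sliceMeasure n) := by unfold sliceMeasure; infer_instance

variable (b : OrthonormalBasis (Fin (n + 1)) ℝ (Space (n + 1)))

lemma sliceEquiv_apply (z : (Fin n → ℝ) × ℝ) (η : ℝ) :
    sliceEquiv b (z, η) = (ofCoords b (Fin.cons η z.1), z.2) := by
  rw [← coe_ofCoordsEquiv, ← Fin.insertNth_zero']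
  rfl

lemma measurePreserving_sliceEquiv :
    MeasurePreserving (sliceEquiv b) ((sliceMeasure n).prod volume)
      ((volume : Measure (Space (n + 1))).prod ((volume : Measure ℝ).restrict (Ioo 0 1))) := by
  have h1 : MeasurePreserving (MeasurableEquiv.prodComm : ((Fin n → ℝ) × ℝ) × ℝ ≃ᵐ _)
      ((sliceMeasure n).prod volume) ((volume : Measure ℝ).prod (sliceMeasure n)) :=
    Measure.measurePreserving_swap
  have h2 : MeasurePreserving (MeasurableEquiv.prodAssoc.symm : ℝ × ((Fin n → ℝ) × ℝ) ≃ᵐ _)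
      ((volume : Measure ℝ).prod (sliceMeasure n))
      (((volume : Measure ℝ).prod volume).prod ((volume : Measure ℝ).restrict (Ioo 0 1))) :=
    (measurePreserving_prodAssoc _ _ _).symm _
  have h3 : MeasurePreserving ((MeasurableEquiv.piFinSuccAbove (fun _ => ℝ) 0).symm.trans
      (ofCoordsEquiv b)) ((volume : Measure ℝ).prod volume) volume :=
    ((volume_preserving_piFinSuccAbove (fun _ : Fin (n + 1) => ℝ) 0).symm _).trans
      (measurePreserving_ofCoords b)
  have h4 := h3.prod (MeasurePreserving.id ((volume : Measure ℝ).restrict (Ioo 0 1)))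
  exact h4.comp (h2.comp h1)

/-- Slicing, combined with stretching the first coordinate by the factor `1 / ε`. -/
lemma integral_slice_scaled (F : Space (n + 1) × ℝ → ℝ) {ε : ℝ} (hε : 0 < ε) :
    ∫ q, F q ∂((volume : Measure (Space (n + 1))).prod ((volume : Measure ℝ).restrict (Ioo 0 1))) =
      ε * ∫ z, F (ofCoords b (Fin.cons (ε * z.2) z.1.1), z.1.2)
        ∂((sliceMeasure n).prod volume) := by
  rw [← (measurePreserving_sliceEquiv b).integral_comp' F]
  have h1 : Measure.map (Prod.map id (ε * ·)) ((sliceMeasure n).prod (volume : Measure ℝ)) =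
      ENNReal.ofReal ε⁻¹ • (sliceMeasure n).prod volume := by
    rw [← Measure.map_prod_map _ _ measurable_id (measurable_const_mul ε), Measure.map_id,
      Real.map_volume_mul_left hε.ne', abs_of_pos (inv_pos.2 hε), Measure.prod_smul_right]
  have hemb : MeasurableEmbedding (Prod.map id (ε * ·) : ((Fin n → ℝ) × ℝ) × ℝ → _) :=
    (MeasurableEquiv.prodCongr (MeasurableEquiv.refl ((Fin n → ℝ) × ℝ))
      (MeasurableEquiv.mulLeft₀ ε hε.ne')).measurableEmbedding
  have h2 := hemb.integral_map (μ := (sliceMeasure n).prod volume) (fun z => F (sliceEquiv b z))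
  rw [h1, integral_smul_measure, ENNReal.toReal_ofReal (by positivity)] at h2
  have h3 : ∀ z : ((Fin n → ℝ) × ℝ) × ℝ, F (sliceEquiv b (Prod.map id (ε * ·) z)) =
      F (ofCoords b (Fin.cons (ε * z.2) z.1.1), z.1.2) := by
    intro z
    rw [← sliceEquiv_apply]
    rfl
  simp_rw [h3] at h2
  rw [← h2, smul_eq_mul, ← mul_assoc, mul_inv_cancel₀ hε.ne', one_mul]

/-- The density of `chartMeasure` on the chart domain. -/
noncomputable def chartDensity {N : ℕ} (q : Space N × ℝ) : ℝ :=
  ‖q.1‖ ^ 2 * profile q.1 ^ N * (2 * q.2 ^ (N - 1))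

lemma continuous_chartDensity {N : ℕ} : Continuous (chartDensity (N := N)) := by
  have := continuous_profile (N := N)
  unfold chartDensity
  fun_prop

lemma ae_snd_mem_Ioo {X : Type*} [MeasurableSpace X] (μ : Measure X) [SFinite μ] :
    ∀ᵐ q ∂(μ.prod ((volume : Measure ℝ).restrict (Ioo 0 1))), q.2 ∈ Ioo (0 : ℝ) 1 :=
  Measure.quasiMeasurePreserving_snd.ae (ae_restrict_mem measurableSet_Ioo)

lemma integral_chartMeasure {N : ℕ} (F : Space N × ℝ → ℝ) :
    ∫ q, F q ∂(chartMeasure N) = ∫ q, chartDensity q * F q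
      ∂((volume : Measure (Space N)).prod ((volume : Measure ℝ).restrict (Ioo 0 1))) := by
  rw [chartMeasure, spaceWeight, radialWeight, prod_withDensity (by fun_prop) (by fun_prop),
    integral_withDensity_eq_integral_toReal_smul (by fun_prop)
      (ae_of_all _ fun _ => ENNReal.mul_lt_top ENNReal.ofReal_lt_top ENNReal.ofReal_lt_top)]
  refine integral_congr_ae ?_
  filter_upwards [ae_snd_mem_Ioo _] with q hq
  have h1 := profile_pos q.1
  have h2 := hq.1
  rw [smul_eq_mul, ENNReal.toReal_mul, ENNReal.toReal_ofReal (by positivity),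
    ENNReal.toReal_ofReal (by positivity), chartDensity]

lemma integral_chartMeasure_neg {N : ℕ} (F : Space N × ℝ → ℝ) :
    ∫ q, F (-q.1, q.2) ∂(chartMeasure N) = ∫ q, F q ∂(chartMeasure N) := by
  rw [integral_chartMeasure, integral_chartMeasure]
  have h := (Measure.measurePreserving_neg (volume : Measure (Space N))).prod
    (MeasurePreserving.id ((volume : Measure ℝ).restrict (Ioo 0 1)))
  have hemb : MeasurableEmbedding (Prod.map (Neg.neg : Space N → Space N) (id : ℝ → ℝ)) :=
    (MeasurableEquiv.prodCongr (MeasurableEquiv.neg (Space N))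
      (MeasurableEquiv.refl ℝ)).measurableEmbedding
  rw [← h.integral_comp hemb]
  refine integral_congr_ae (ae_of_all _ fun q => ?_)
  simp [chartDensity, profile_neg]

end Slicing

/-! ### The model problem for the exponent one -/

section ExponentOne

lemma profile_rpow_mul_norm_sq_le {N : ℕ} (hN : 1 ≤ N) {k : ℝ} (hk : 0 < k) (y : Space N) :
    profile y ^ k * ‖y‖ ^ 2 ≤ 4 * N / k := by
  have hN' : (0 : ℝ) < N := by positivity
  have hpi := Real.pi_gt_three
  have h1 : (√(4 * Real.pi))⁻¹ ^ k ≤ 1 :=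
    Real.rpow_le_one (by positivity)
      (inv_le_one_of_one_le₀ (by rw [Real.one_le_sqrt]; linarith)) hk.le
  set u := k / (4 * N) * ‖y‖ ^ 2 with hu
  have hy : ‖y‖ ^ 2 = 4 * N / k * u := by rw [hu]; field_simp
  have hu0 : 0 ≤ u := by positivity
  have h2 : Real.exp (-u) * u ≤ 1 := by
    rw [Real.exp_neg, inv_mul_le_iff₀ (Real.exp_pos u), mul_one]
    linarith [Real.add_one_le_exp u]
  rw [profile_pow, neg_mul, ← hu, hy]
  calc (√(4 * Real.pi))⁻¹ ^ k * Real.exp (-u) * (4 * N / k * u)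
      = (√(4 * Real.pi))⁻¹ ^ k * (4 * N / k) * (Real.exp (-u) * u) := by ring
    _ ≤ 1 * (4 * N / k) * 1 := by gcongr
    _ = 4 * N / k := by ring

variable {n : ℕ} (b : OrthonormalBasis (Fin (n + 1)) ℝ (Space (n + 1)))

lemma continuous_ofCoords_cons : Continuous fun w : ℝ × (Fin n → ℝ) =>
    ofCoords b (Fin.cons w.1 w.2) := by
  unfold ofCoords
  simp only [Fin.sum_univ_succ, Fin.cons_zero, Fin.cons_succ]
  fun_prop

lemma norm_sq_ofCoords_cons (η : ℝ) (v : Fin n → ℝ) :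
    ‖ofCoords b (Fin.cons η v)‖ ^ 2 = η ^ 2 + ∑ k, v k ^ 2 := by
  rw [norm_sq_ofCoords, Fin.sum_univ_succ]
  simp

lemma profile_ofCoords_cons_le (η : ℝ) (v : Fin n → ℝ) :
    profile (ofCoords b (Fin.cons η v)) ≤ profile (ofCoords b (Fin.cons 0 v)) := by
  unfold profile
  rw [norm_sq_ofCoords_cons, norm_sq_ofCoords_cons]
  refine div_le_div_of_nonneg_right (Real.exp_le_exp.2
    (div_le_div_of_nonneg_right ?_ (by positivity))) (by positivity)
  nlinarith [sq_nonneg η]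

/-- The integrand obtained from the symmetrized Euler-Lagrange integral for `p = 1` by stretching
the coordinate along `a` by the factor `1 / ε`. It makes sense also for `ε = 0`. -/
noncomputable def stretched (H : Space (n + 1) →L[ℝ] Space (n + 1)) (A θ l ε : ℝ)
    (z : ((Fin n → ℝ) × ℝ) × ℝ) : ℝ :=
  chartDensity (ofCoords b (Fin.cons (ε * z.2) z.1.1), z.1.2) *
    symSign (z.1.2 * profile (ofCoords b (Fin.cons (ε * z.2) z.1.1)) * A * z.2)
      (quadPart H θ (ofCoords b (Fin.cons (ε * z.2) z.1.1), z.1.2) - l)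

/-- The majorant of the stretched integrands, up to a constant. -/
noncomputable def stretchedBound (z : ((Fin n → ℝ) × ℝ) × ℝ) : ℝ :=
  profile (ofCoords b (Fin.cons 0 z.1.1)) ^ (1 / 4 : ℝ) * z.1.2 ^ (-(1 / 2) : ℝ) *
    (1 + ‖z.2‖) ^ (-(3 / 2) : ℝ)

variable (H : Space (n + 1) →L[ℝ] Space (n + 1)) {A : ℝ} (hA : 0 < A) (θ l : ℝ)

include hA in
/-- The symmetrized sign vanishes unless `r γ |η| ≤ B / A`, which allows trading the factor
`(r γ)^{3/2}` of the density for the decay `(1 + |η|)^{-3/2}`. -/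
lemma abs_stretched_le (hn : 1 ≤ n) : ∃ C : ℝ, ∀ (ε : ℝ) (z : ((Fin n → ℝ) × ℝ) × ℝ),
    z.1.2 ∈ Ioo (0 : ℝ) 1 → |stretched b H A θ l ε z| ≤ C * stretchedBound b z := by
  have hn' : (1 : ℝ) ≤ n := by exact_mod_cast hn
  have hN1 : 1 ≤ n + 1 := by lia
  set B := 1 / 2 * ‖H‖ * maxRadiusSq (n + 1) + |θ| + |l| with hB
  have hB0 : 0 ≤ B := by
    have := maxRadiusSq_pos hN1
    positivity
  set D := 1 + B / A with hD
  have hD0 : 0 ≤ D := by positivity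
  refine ⟨2 * D ^ (3 / 2 : ℝ) * (4 * ((n + 1 : ℕ) : ℝ) / (1 / 4)), fun ε z hr => ?_⟩
  obtain ⟨⟨v, r⟩, η⟩ := z
  simp only at hr
  obtain ⟨hr0, hr1⟩ := hr
  simp only [stretched, stretchedBound]
  set y := ofCoords b (Fin.cons (ε * η) v) with hy
  have hγ := profile_pos y
  have hγ1 := profile_le_one y
  have hγ0 := profile_pos (ofCoords b (Fin.cons 0 v))
  have hdens : 0 ≤ chartDensity (y, r) := by simp only [chartDensity]; positivity
  rw [abs_mul, abs_of_nonneg hdens]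
  by_cases hbig : |quadPart H θ (y, r) - l| < |r * profile y * A * η|
  · rw [symSign_eq_zero hbig, abs_zero, mul_zero]
    positivity
  have hquad : |quadPart H θ (y, r) - l| ≤ B := by
    refine (abs_sub _ _).trans ?_
    have := abs_quadPart_le hN1 H θ (q := (y, r)) ⟨hr0.le, hr1.le⟩
    linarith
  have hX : r * profile y * |η| ≤ B / A := by
    rw [le_div_iff₀ hA]
    have h1 := (not_lt.1 hbig).trans hquad
    rw [abs_mul, abs_of_pos (by positivity : 0 < r * profile y * A)] at h1
    linarith
  have hrγ : r * profile y ≤ 1 := mul_le_one₀ hr1.le hγ.le hγ1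
  have hw : r * profile y * (1 + ‖η‖) ≤ D := by rw [Real.norm_eq_abs]; linarith
  have hw2 : (r * profile y) ^ (3 / 2 : ℝ) ≤ D ^ (3 / 2 : ℝ) * (1 + ‖η‖) ^ (-(3 / 2) : ℝ) := by
    have h1 : 0 < (1 + ‖η‖) ^ (3 / 2 : ℝ) := by positivity
    rw [Real.rpow_neg (by positivity), ← div_eq_mul_inv, le_div_iff₀ h1,
      ← Real.mul_rpow (by positivity) (by positivity)]
    exact Real.rpow_le_rpow (by positivity) hw (by norm_num)
  have hsplit : chartDensity (y, r) = 2 * ‖y‖ ^ 2 * (r * profile y) ^ (3 / 2 : ℝ) *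
      profile y ^ ((n : ℝ) - 1 / 2) * r ^ ((n : ℝ) - 3 / 2) := by
    have h1 : profile y ^ (n + 1) = profile y ^ (3 / 2 : ℝ) * profile y ^ ((n : ℝ) - 1 / 2) := by
      rw [← Real.rpow_add hγ, ← Real.rpow_natCast]; congr 1; push_cast; ring
    have h2 : r ^ n = r ^ (3 / 2 : ℝ) * r ^ ((n : ℝ) - 3 / 2) := by
      rw [← Real.rpow_add hr0, ← Real.rpow_natCast]; congr 1; ring
    simp only [chartDensity]
    rw [h1, Nat.add_sub_cancel, h2, Real.mul_rpow hr0.le hγ.le]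
    ring
  have h3 : profile y ^ ((n : ℝ) - 1 / 2) ≤ profile y ^ (1 / 4 : ℝ) * profile y ^ (1 / 4 : ℝ) := by
    rw [← Real.rpow_add hγ]
    exact Real.rpow_le_rpow_of_exponent_ge hγ hγ1 (by linarith)
  have h4 : r ^ ((n : ℝ) - 3 / 2) ≤ r ^ (-(1 / 2) : ℝ) :=
    Real.rpow_le_rpow_of_exponent_ge hr0 hr1.le (by linarith)
  have h5 := profile_rpow_mul_norm_sq_le hN1 (k := 1 / 4) (by norm_num) y
  have h6 : profile y ^ (1 / 4 : ℝ) ≤ profile (ofCoords b (Fin.cons 0 v)) ^ (1 / 4 : ℝ) :=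
    Real.rpow_le_rpow hγ.le (profile_ofCoords_cons_le b _ _) (by norm_num)
  calc chartDensity (y, r) * |symSign (r * profile y * A * η) (quadPart H θ (y, r) - l)|
      ≤ chartDensity (y, r) * 1 := by gcongr; exact abs_symSign_le_one _ _
    _ = 2 * ‖y‖ ^ 2 * (r * profile y) ^ (3 / 2 : ℝ) *
        profile y ^ ((n : ℝ) - 1 / 2) * r ^ ((n : ℝ) - 3 / 2) := by rw [mul_one, hsplit]
    _ ≤ 2 * ‖y‖ ^ 2 * (D ^ (3 / 2 : ℝ) * (1 + ‖η‖) ^ (-(3 / 2) : ℝ)) *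
        (profile y ^ (1 / 4 : ℝ) * profile y ^ (1 / 4 : ℝ)) * r ^ (-(1 / 2) : ℝ) := by gcongr
    _ = 2 * D ^ (3 / 2 : ℝ) * (profile y ^ (1 / 4 : ℝ) * ‖y‖ ^ 2) *
        (profile y ^ (1 / 4 : ℝ) * r ^ (-(1 / 2) : ℝ) * (1 + ‖η‖) ^ (-(3 / 2) : ℝ)) := by ring
    _ ≤ 2 * D ^ (3 / 2 : ℝ) * (4 * ((n + 1 : ℕ) : ℝ) / (1 / 4)) *
        (profile (ofCoords b (Fin.cons 0 v)) ^ (1 / 4 : ℝ) * r ^ (-(1 / 2) : ℝ) *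
          (1 + ‖η‖) ^ (-(3 / 2) : ℝ)) := by gcongr

lemma profile_cons_zero_rpow (k : ℝ) (v : Fin n → ℝ) :
    profile (ofCoords b (Fin.cons 0 v)) ^ k =
      (√(4 * Real.pi))⁻¹ ^ k * gaussMonomial (k / (4 * ((n + 1 : ℕ) : ℝ))) 0 v := by
  rw [profile_pow, norm_sq_ofCoords_cons, gaussMonomial_eq]
  simp

lemma neg_one_lt_zero_apply : ∀ k : Fin n, -1 < (0 : Fin n → ℝ) k := fun _ => by simp

lemma integrable_stretchedBound :
    Integrable (stretchedBound b) ((sliceMeasure n).prod volume) := by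
  have h1 : Integrable fun v : Fin n → ℝ =>
      profile (ofCoords b (Fin.cons 0 v)) ^ (1 / 4 : ℝ) := by
    simp_rw [profile_cons_zero_rpow]
    exact (integrable_gaussMonomial (by positivity) neg_one_lt_zero_apply).const_mul _
  have h2 : Integrable (fun r : ℝ => r ^ (-(1 / 2) : ℝ))
      ((volume : Measure ℝ).restrict (Ioo 0 1)) :=
    (intervalIntegral.integrableOn_Ioo_rpow_iff one_pos).2 (by norm_num)
  have h3 : Integrable fun η : ℝ => (1 + ‖η‖) ^ (-(3 / 2) : ℝ) :=
    integrable_one_add_norm (by simp; norm_num)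
  exact (h1.mul_prod h2).mul_prod h3

lemma measurable_symSign : Measurable fun w : ℝ × ℝ => symSign w.1 w.2 := by
  have h := measurable_sign_real
  unfold symSign
  fun_prop

lemma continuous_stretched_arg (ε : ℝ) : Continuous fun z : ((Fin n → ℝ) × ℝ) × ℝ =>
    (ofCoords b (Fin.cons (ε * z.2) z.1.1), z.1.2) := by
  have h := continuous_ofCoords_cons b
  exact (h.comp (by fun_prop : Continuous fun z : ((Fin n → ℝ) × ℝ) × ℝ =>
    (ε * z.2, z.1.1))).prodMk (by fun_prop)

lemma measurable_stretched (A ε : ℝ) : Measurable (stretched b H A θ l ε) := by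
  have h1 := continuous_stretched_arg b ε
  have h2 := (continuous_quadPart H θ).comp h1
  have h3 := (continuous_chartDensity (N := n + 1)).comp h1
  have h4 := (continuous_profile (N := n + 1)).comp (continuous_fst.comp h1)
  have h5 : Measurable fun z : ((Fin n → ℝ) × ℝ) × ℝ =>
      (z.1.2 * profile (ofCoords b (Fin.cons (ε * z.2) z.1.1)) * A * z.2,
        quadPart H θ (ofCoords b (Fin.cons (ε * z.2) z.1.1), z.1.2) - l) := by
    have h6 : Measurable fun z : ((Fin n → ℝ) × ℝ) × ℝ =>
      profile (ofCoords b (Fin.cons (ε * z.2) z.1.1)) := h4.measurable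
    have h7 : Measurable fun z : ((Fin n → ℝ) × ℝ) × ℝ =>
      quadPart H θ (ofCoords b (Fin.cons (ε * z.2) z.1.1), z.1.2) := h2.measurable
    fun_prop
  exact h3.measurable.mul (measurable_symSign.comp h5)

lemma ae_sliceMeasure_prod : ∀ᵐ z ∂((sliceMeasure n).prod (volume : Measure ℝ)),
    z.1.2 ∈ Ioo (0 : ℝ) 1 :=
  Measure.quasiMeasurePreserving_fst.ae (ae_snd_mem_Ioo (volume : Measure (Fin n → ℝ)))

include hA in
lemma integrable_stretched (hn : 1 ≤ n) (ε : ℝ) :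
    Integrable (stretched b H A θ l ε) ((sliceMeasure n).prod volume) := by
  obtain ⟨C, hC⟩ := abs_stretched_le b H hA θ l hn
  refine ((integrable_stretchedBound b).const_mul C).mono'
    (measurable_stretched b H θ l A ε).aestronglyMeasurable ?_
  filter_upwards [ae_sliceMeasure_prod] with z hz using hC ε z hz

/-- A line of slope different from zero meets zero in a single point. -/
lemma ae_mul_add_ne_zero {Z : Type*} [MeasurableSpace Z] {μ : Measure Z} [SFinite μ] {c h : Z → ℝ}
    (hc : Measurable c) (hh : Measurable h) (hc0 : ∀ᵐ z ∂μ, c z ≠ 0) :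
    ∀ᵐ w ∂(μ.prod (volume : Measure ℝ)), c w.1 * w.2 + h w.1 ≠ 0 := by
  have hs : MeasurableSet {w : Z × ℝ | c w.1 * w.2 + h w.1 ≠ 0} :=
    (measurableSet_eq_fun (by fun_prop) measurable_const).compl
  refine (Measure.ae_prod_mem_iff_ae_ae_mem hs).2 ?_
  filter_upwards [hc0] with z hz
  filter_upwards [Measure.ae_ne volume (-h z / c z)] with η hη h0
  apply hη
  field_simp
  linarith

include hA in
lemma tendsto_integral_stretched (hn : 1 ≤ n) :
    Tendsto (fun ε => ∫ z, stretched b H A θ l ε z ∂((sliceMeasure n).prod volume)) (𝓝[>] 0)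
      (𝓝 (∫ z, stretched b H A θ l 0 z ∂((sliceMeasure n).prod volume))) := by
  obtain ⟨C, hC⟩ := abs_stretched_le b H hA θ l hn
  have hm : Measurable fun z : (Fin n → ℝ) × ℝ => (ofCoords b (Fin.cons 0 z.1), z.2) :=
    ((continuous_ofCoords_cons b).comp (by fun_prop : Continuous fun z : (Fin n → ℝ) × ℝ =>
      ((0 : ℝ), z.1))).prodMk continuous_snd |>.measurable
  have hmγ : Measurable fun z : (Fin n → ℝ) × ℝ => profile (ofCoords b (Fin.cons 0 z.1)) :=
    measurable_profile.comp (measurable_fst.comp hm)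
  have hmq : Measurable fun z : (Fin n → ℝ) × ℝ =>
      quadPart H θ (ofCoords b (Fin.cons 0 z.1), z.2) :=
    (continuous_quadPart H θ).measurable.comp hm
  have hc : ∀ᵐ z ∂(sliceMeasure n), z.2 * profile (ofCoords b (Fin.cons 0 z.1)) * A ≠ 0 := by
    filter_upwards [ae_snd_mem_Ioo (volume : Measure (Fin n → ℝ))] with z hz
    have := profile_pos (ofCoords b (Fin.cons 0 z.1))
    have := hz.1
    positivity
  refine tendsto_integral_filter_of_dominated_convergence (fun z => C * stretchedBound b z)
    (Eventually.of_forall fun ε => (measurable_stretched b H θ l A ε).aestronglyMeasurable)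
    (Eventually.of_forall fun ε => ?_) ((integrable_stretchedBound b).const_mul C) ?_
  · filter_upwards [ae_sliceMeasure_prod] with z hz using hC ε z hz
  · filter_upwards [ae_mul_add_ne_zero (by fun_prop : Measurable fun z : (Fin n → ℝ) × ℝ =>
        z.2 * profile (ofCoords b (Fin.cons 0 z.1)) * A) (hmq.sub measurable_const) hc,
      ae_mul_add_ne_zero (by fun_prop : Measurable fun z : (Fin n → ℝ) × ℝ =>
        z.2 * profile (ofCoords b (Fin.cons 0 z.1)) * A)
        ((measurable_const (a := l)).sub hmq) hc] with z h1 h2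
    have hlim : Tendsto (fun ε : ℝ => ofCoords b (Fin.cons (ε * z.2) z.1.1)) (𝓝[>] 0)
        (𝓝 (ofCoords b (Fin.cons (0 * z.2) z.1.1))) :=
      (((continuous_ofCoords_cons b).comp (by fun_prop : Continuous fun ε : ℝ =>
        (ε * z.2, z.1.1))).tendsto 0).mono_left nhdsWithin_le_nhds
    have hlim2 := hlim.prodMk_nhds (tendsto_const_nhds (x := z.1.2))
    unfold stretched
    refine ((continuous_chartDensity.tendsto _).comp hlim2).mul (tendsto_symSign ?_ ?_
      ((((continuous_profile.tendsto _).comp hlim).const_mul _).mul_const _ |>.mul_const _)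
      ((((continuous_quadPart H θ).tendsto _).comp hlim2).sub_const l))
    · rw [zero_mul]
      exact h1
    · rw [zero_mul]
      intro h3
      apply h2
      simp only [Pi.sub_apply]
      linarith

/-- The weight `|v|² γ^n r^{n-1}` on the slice orthogonal to the gradient. -/
noncomputable def sliceWeight (z : (Fin n → ℝ) × ℝ) : ℝ :=
  (∑ k, z.1 k ^ 2) * profile (ofCoords b (Fin.cons 0 z.1)) ^ n * z.2 ^ (n - 1)

include hA in
/-- The limit integral lives on the slice orthogonal to the gradient. -/
lemma integral_stretched_zero (hn : 1 ≤ n) :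
    ∫ z, stretched b H A θ l 0 z ∂((sliceMeasure n).prod volume) =
      ∫ z, 4 / A * (sliceWeight b z * (quadPart H θ (ofCoords b (Fin.cons 0 z.1), z.2) - l))
        ∂(sliceMeasure n) := by
  rw [integral_prod _ (integrable_stretched b H hA θ l hn 0)]
  refine integral_congr_ae ?_
  filter_upwards [ae_snd_mem_Ioo (volume : Measure (Fin n → ℝ))] with z hz
  have h1 := profile_pos (ofCoords b (Fin.cons 0 z.1))
  have h2 := hz.1
  simp only [stretched, zero_mul]
  rw [integral_const_mul, integral_symSign (by positivity)]
  simp only [chartDensity, sliceWeight, norm_sq_ofCoords_cons]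
  obtain ⟨m, rfl⟩ : ∃ m, n = m + 1 := ⟨n - 1, by lia⟩
  simp only [Nat.add_sub_cancel]
  field_simp
  ring

lemma integrable_sq_mul_profile_cons_zero {k : ℝ} (hk : 0 < k) :
    Integrable fun v : Fin n → ℝ =>
      (∑ i, v i ^ 2) * profile (ofCoords b (Fin.cons 0 v)) ^ k := by
  have h : ∀ v : Fin n → ℝ, (∑ i, v i ^ 2) * profile (ofCoords b (Fin.cons 0 v)) ^ k =
      (√(4 * Real.pi))⁻¹ ^ k *
        ∑ i, v i ^ 2 * gaussMonomial (k / (4 * ((n + 1 : ℕ) : ℝ))) 0 v := by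
    intro v
    rw [profile_cons_zero_rpow, ← Finset.sum_mul]
    ring
  simp_rw [h]
  exact (integrable_finsetSum _ fun i _ =>
    integrable_sq_mul_gaussMonomial (by positivity) neg_one_lt_zero_apply i).const_mul _

lemma integrable_sliceWeight (hn : 1 ≤ n) : Integrable (sliceWeight b) (sliceMeasure n) := by
  have hn' : (0 : ℝ) < n := by positivity
  have h1 : Integrable fun v : Fin n → ℝ =>
      (∑ i, v i ^ 2) * profile (ofCoords b (Fin.cons 0 v)) ^ n := by
    simpa only [Real.rpow_natCast] using integrable_sq_mul_profile_cons_zero b hn'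
  have h2 : Integrable (fun r : ℝ => r ^ (n - 1)) ((volume : Measure ℝ).restrict (Ioo 0 1)) := by
    have h : IntegrableOn (fun r : ℝ => r ^ (n - 1)) (Icc 0 1) :=
      Continuous.integrableOn_Icc (by fun_prop)
    exact h.mono_set Ioo_subset_Icc_self
  exact h1.mul_prod h2

lemma ae_sliceWeight_pos (hn : 1 ≤ n) : ∀ᵐ z ∂(sliceMeasure n), 0 < sliceWeight b z := by
  have : Nonempty (Fin n) := ⟨⟨0, hn⟩⟩
  have h : ∀ᵐ z ∂(sliceMeasure n), z.1 ≠ 0 :=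
    Measure.quasiMeasurePreserving_fst.ae (Measure.ae_ne (volume : Measure (Fin n → ℝ)) 0)
  filter_upwards [h, ae_snd_mem_Ioo (volume : Measure (Fin n → ℝ))] with z h1 h2
  have h3 := h2.1
  have h4 := profile_pos (ofCoords b (Fin.cons 0 z.1))
  obtain ⟨k, hk⟩ := Function.ne_iff.1 h1
  have h5 : 0 < ∑ i, z.1 i ^ 2 :=
    Finset.sum_pos' (fun i _ => sq_nonneg _) ⟨k, Finset.mem_univ k, by
      have : z.1 k ≠ 0 := hk
      positivity⟩
  unfold sliceWeight
  positivity

/-- On the slice orthogonal to the gradient, the quadratic part has mean zero for the time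
derivative given by the trace of `H` over the slice, which is the case `p = 1` of the operator. -/
lemma integral_sliceWeight_mul_quadPart (hn : 1 ≤ n) {L : ℝ}
    (hL : n * L = (n + 1) * ∑ i : Fin n, inner ℝ (H (b i.succ)) (b i.succ)) :
    ∫ z, sliceWeight b z * quadPart H L (ofCoords b (Fin.cons 0 z.1), z.2) ∂(sliceMeasure n) =
      0 := by
  have hn' : (0 : ℝ) < n := by positivity
  set β := ((n : ℝ) + 2) / (4 * ((n + 1 : ℕ) : ℝ)) with hβ
  have hm := integral_normSq_mul_quadratic_gaussMonomial (b := β) (by positivity)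
    (neg_one_lt_zero_apply (n := n)) (fun i j => inner ℝ (H (b i.succ)) (b j.succ)) (l := L) (by
      simp only [Pi.zero_apply, zero_add, mul_one, Finset.sum_const, Finset.card_univ,
        Fintype.card_fin, nsmul_eq_mul]
      rw [hL, hβ]
      push_cast
      field_simp)
  have h1 : ∀ z : (Fin n → ℝ) × ℝ,
      sliceWeight b z * quadPart H L (ofCoords b (Fin.cons 0 z.1), z.2) =
      ((√(4 * Real.pi))⁻¹ ^ ((n : ℝ) + 2) * ((∑ k, z.1 k ^ 2) * (1 / 2 * (∑ i, ∑ j,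
        inner ℝ (H (b i.succ)) (b j.succ) * (z.1 i * z.1 j)) - L) * gaussMonomial β 0 z.1)) *
        (z.2 ^ (n - 1) * z.2 ^ 2) := by
    rintro ⟨v, r⟩
    have h2 : profile (ofCoords b (Fin.cons 0 v)) ^ n * profile (ofCoords b (Fin.cons 0 v)) ^ 2 =
        (√(4 * Real.pi))⁻¹ ^ ((n : ℝ) + 2) * gaussMonomial β 0 v := by
      rw [← profile_cons_zero_rpow, Real.rpow_add (profile_pos _), Real.rpow_natCast,
        Real.rpow_two]
    have h3 : inner ℝ (H (ofCoords b (Fin.cons 0 v))) (ofCoords b (Fin.cons 0 v)) =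
        ∑ i, ∑ j, inner ℝ (H (b i.succ)) (b j.succ) * (v i * v j) := by
      rw [inner_map_ofCoords]
      simp [Fin.sum_univ_succ]
    simp only [sliceWeight, quadPart, h3]
    rw [show ∀ x y z w u t : ℝ, x * y * z * ((w * u) ^ 2 * t) = (y * u ^ 2) * (x * z * w ^ 2 * t)
      from fun x y z w u t => by ring, h2]
    ring
  simp_rw [h1]
  rw [sliceMeasure, integral_prod_mul (fun v : Fin n → ℝ => (√(4 * Real.pi))⁻¹ ^ ((n : ℝ) + 2) *
    ((∑ k, v k ^ 2) * (1 / 2 * (∑ i, ∑ j, inner ℝ (H (b i.succ)) (b j.succ) * (v i * v j)) - L) *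
      gaussMonomial β 0 v)) (fun r : ℝ => r ^ (n - 1) * r ^ 2), integral_const_mul, hm, mul_zero,
    zero_mul]

lemma linPart_neg_fst {N : ℕ} (a : Space N) (q : Space N × ℝ) :
    linPart a (-q.1, q.2) = -linPart a q := by simp [linPart, profile_neg]

lemma quadPart_neg_fst {N : ℕ} (H : Space N →L[ℝ] Space N) (θ : ℝ) (q : Space N × ℝ) :
    quadPart H θ (-q.1, q.2) = quadPart H θ q := by simp [quadPart, profile_neg]

lemma linPart_neg {N : ℕ} (a : Space N) (q : Space N × ℝ) :
    linPart (-a) q = -linPart a q := by simp [linPart]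

/-- The Euler-Lagrange integral for `p = 1`, symmetrized under `y ↦ -y`, in stretched
coordinates. -/
lemma integral_signedPow_zero_eq {a : Space (n + 1)} (ha : a ≠ 0) (hb : b 0 = ‖a‖⁻¹ • a) {ε : ℝ}
    (hε : 0 < ε) : ∫ q, signedPow 0 (linPart a q + ε * (quadPart H θ q - l))
      ∂(chartMeasure (n + 1)) =
      ε * ∫ z, stretched b H ‖a‖ θ l ε z ∂((sliceMeasure n).prod volume) := by
  have hN1 : 1 ≤ n + 1 := by lia
  have hI1 := integrable_signedPow_model hN1 le_rfl a H θ l hε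
  have hI2 := integrable_signedPow_model hN1 le_rfl (-a) H θ l hε
  have h1 := integral_chartMeasure_neg
    (fun q => signedPow 0 (linPart a q + ε * (quadPart H θ q - l)))
  simp only [linPart_neg_fst, quadPart_neg_fst] at h1
  simp only [linPart_neg] at hI2
  have h2 : ∫ q, signedPow 0 (linPart a q + ε * (quadPart H θ q - l)) ∂(chartMeasure (n + 1)) =
      ∫ q, symSign (linPart a q) (ε * (quadPart H θ q - l)) ∂(chartMeasure (n + 1)) := by
    have h3 : ∀ q, symSign (linPart a q) (ε * (quadPart H θ q - l)) =
        (signedPow 0 (linPart a q + ε * (quadPart H θ q - l)) +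
          signedPow 0 (-linPart a q + ε * (quadPart H θ q - l))) / 2 := by
      intro q
      rw [symSign, signedPow_zero_left, signedPow_zero_left,
        show -linPart a q + ε * (quadPart H θ q - l) = ε * (quadPart H θ q - l) - linPart a q by
          ring]
    simp_rw [h3]
    rw [integral_div, integral_add hI1 hI2, h1]
    ring
  rw [h2, integral_chartMeasure, integral_slice_scaled b _ hε]
  congr 1
  refine integral_congr_ae (ae_of_all _ fun z => ?_)
  simp only [stretched]
  congr 1
  have h4 : linPart a (ofCoords b (Fin.cons (ε * z.2) z.1.1), z.1.2) =
      ε * (z.1.2 * profile (ofCoords b (Fin.cons (ε * z.2) z.1.1)) * ‖a‖ * z.2) := by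
    simp only [linPart]
    rw [inner_ofCoords_of_zero_eq ha hb, Fin.cons_zero]
    ring
  rw [h4, symSign_mul_mul hε]

/-- The asymptotic upper bound for `p = 1`. The best constant is the median; its Euler-Lagrange
integrand is discontinuous on the slice orthogonal to `a`, where the integral concentrates. -/
theorem exists_upperBound_one (hn : 1 ≤ n) {a : Space (n + 1)} (ha : a ≠ 0) :
    ∃ c : ℝ, 0 < c ∧ UpperBound 1 a H θ (c * (modelOp 1 H a - θ)) := by
  have hn' : (0 : ℝ) < n := by positivity
  have hN1 : 1 ≤ n + 1 := by lia
  have ha0 : 0 < ‖a‖ := norm_pos_iff.2 ha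
  obtain ⟨b, hb⟩ := exists_orthonormalBasis_zero_eq ha
  have hμ : sliceMeasure n ≠ 0 := by
    intro h0
    have h1 : sliceMeasure n (univ ×ˢ univ) = 0 := by rw [h0]; rfl
    rw [sliceMeasure, Measure.prod_prod] at h1
    simp at h1
    exact NeZero.ne _ h1
  have hmem : ∀ᵐ z ∂(sliceMeasure n), z.2 ∈ Icc (0 : ℝ) 1 :=
    (ae_snd_mem_Ioo (volume : Measure (Fin n → ℝ))).mono fun z hz => Ioo_subset_Icc_self hz
  have hcont : Continuous fun z : (Fin n → ℝ) × ℝ => (ofCoords b (Fin.cons 0 z.1), z.2) :=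
    ((continuous_ofCoords_cons b).comp (by fun_prop : Continuous fun z : (Fin n → ℝ) × ℝ =>
      ((0 : ℝ), z.1))).prodMk continuous_snd
  have hW := integrable_sliceWeight b hn
  have hquad : ∀ L, Integrable (fun z => sliceWeight b z *
      quadPart H L (ofCoords b (Fin.cons 0 z.1), z.2)) (sliceMeasure n) := fun L =>
    hW.mul_bdd (c := 1 / 2 * ‖H‖ * maxRadiusSq (n + 1) + |L|)
      ((continuous_quadPart H L).comp hcont).aestronglyMeasurable
      (hmem.mono fun z hz => abs_quadPart_le hN1 H L (q := (_, z.2)) hz)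
  have hcp : Continuous fun z : (Fin n → ℝ) × ℝ =>
      (z.2 * profile (ofCoords b (Fin.cons 0 z.1))) ^ 2 :=
    (continuous_snd.mul (continuous_profile.comp (continuous_fst.comp hcont))).pow 2
  have hS : Integrable (fun z => sliceWeight b z *
      (z.2 * profile (ofCoords b (Fin.cons 0 z.1))) ^ 2) (sliceMeasure n) := by
    refine hW.mul_bdd (c := 1) hcp.aestronglyMeasurable (hmem.mono fun z hz => ?_)
    have h2 := profile_pos (ofCoords b (Fin.cons 0 z.1))
    rw [Real.norm_eq_abs, abs_of_nonneg (by positivity)]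
    exact pow_le_one₀ (mul_nonneg hz.1 h2.le) (mul_le_one₀ hz.2 h2.le (profile_le_one _))
  set I := ∫ z, sliceWeight b z ∂(sliceMeasure n) with hI
  have hI0 : 0 < I := integral_pos_of_ae_pos hμ hW (ae_sliceWeight_pos b hn)
  set S := ∫ z, sliceWeight b z * (z.2 * profile (ofCoords b (Fin.cons 0 z.1))) ^ 2
    ∂(sliceMeasure n) with hSdef
  have hS0 : 0 < S := by
    refine integral_pos_of_ae_pos hμ hS ?_
    filter_upwards [ae_sliceWeight_pos b hn, ae_snd_mem_Ioo (volume : Measure (Fin n → ℝ))]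
      with z h1 h2
    have h3 := profile_pos (ofCoords b (Fin.cons 0 z.1))
    have h4 := h2.1
    positivity
  set L := modelOp 1 H a with hLdef
  have hL : n * L = (n + 1) * ∑ i : Fin n, inner ℝ (H (b i.succ)) (b i.succ) := by
    have e2 : inner ℝ (H (b 0)) (b 0) = inner ℝ (H a) a / ‖a‖ ^ 2 := by
      rw [hb, map_smul, real_inner_smul_left, real_inner_smul_right]
      field_simp
    rw [hLdef, modelOp, if_neg (by simp), LinearMap.trace_eq_sum_inner _ b, Fin.sum_univ_succ,
      ← e2]
    simp only [ContinuousLinearMap.coe_coe, real_inner_comm, ENNReal.toReal_one]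
    have h6 : (n : ℝ) + 1 + 1 - 2 = n := by ring
    push_cast
    rw [h6]
    field_simp
    ring
  have hmom := integral_sliceWeight_mul_quadPart b H hn hL
  have hval : ∫ z, sliceWeight b z * quadPart H θ (ofCoords b (Fin.cons 0 z.1), z.2)
      ∂(sliceMeasure n) = (L - θ) * S := by
    have : ∀ z : (Fin n → ℝ) × ℝ,
        sliceWeight b z * quadPart H θ (ofCoords b (Fin.cons 0 z.1), z.2) =
        sliceWeight b z * quadPart H L (ofCoords b (Fin.cons 0 z.1), z.2) +
        (L - θ) * (sliceWeight b z * (z.2 * profile (ofCoords b (Fin.cons 0 z.1))) ^ 2) := by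
      intro z; simp only [quadPart]; ring
    simp_rw [this]
    rw [integral_add (hquad _) (hS.const_mul _), hmom, integral_const_mul, zero_add]
  refine ⟨S / I, by positivity, upperBound_of_integral_neg hN1 le_rfl (by simp) fun δ hδ => ?_⟩
  set κ := S / I * (L - θ) with hκ
  have hlim := tendsto_integral_stretched b H ha0 θ (κ + δ) hn
  have hneg : ∫ z, stretched b H ‖a‖ θ (κ + δ) 0 z ∂((sliceMeasure n).prod volume) < 0 := by
    rw [integral_stretched_zero b H ha0 θ (κ + δ) hn, integral_const_mul]
    simp_rw [mul_sub]
    rw [integral_sub (hquad _) (hW.mul_const _), hval, integral_mul_const, ← hI]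
    have h5 : (L - θ) * S - I * (κ + δ) = -(δ * I) := by
      rw [hκ]; field_simp; ring
    rw [h5]
    have h6 : 0 < δ * I := by positivity
    have h7 : 0 < 4 / ‖a‖ := by positivity
    nlinarith
  filter_upwards [hlim.eventually_lt_const hneg, self_mem_nhdsWithin] with ε h1 hε
  have hε0 : 0 < ε := hε
  rw [ENNReal.toReal_one, sub_self, integral_signedPow_zero_eq b H θ (κ + δ) ha hb hε0]
  exact mul_neg_of_pos_of_neg hε0 h1

end ExponentOne

/-! ### Parabolic expansions and the normalized operators -/

section Expansion

variable {N : ℕ}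

/-- The asymptotic upper bound for all admissible exponents. -/
theorem exists_upperBound (hN : 1 ≤ N) {p : ℝ≥0∞} (hp : 1 ≤ p) (hNp : ¬ (N = 1 ∧ p = 1))
    {a : Space N} (ha : a ≠ 0) (H : Space N →L[ℝ] Space N) (θ : ℝ) :
    ∃ c : ℝ, 0 < c ∧ UpperBound p a H θ (c * (modelOp p H a - θ)) := by
  rcases eq_or_ne p ∞ with rfl | hp'
  · exact exists_upperBound_top ha hN H θ
  rcases hp.eq_or_lt with rfl | hp1
  · obtain ⟨n, rfl⟩ : ∃ n, N = n + 1 := ⟨N - 1, by lia⟩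
    have hn : 1 ≤ n := by
      by_contra h
      exact hNp ⟨by lia, rfl⟩
    exact exists_upperBound_one H θ hn ha
  · exact exists_upperBound_of_one_lt ha hN hp1 hp' H θ

/-- Second order Taylor expansion in terms of the gradient and its derivative, by the mean value
inequality along the segment. -/
lemma eventually_abs_taylor_two_le {f : Space N → ℝ} {x : Space N} {H : Space N →L[ℝ] Space N}
    (hf : ∀ᶠ y in 𝓝 x, DifferentiableAt ℝ f y) (hH : HasFDerivAt (gradient f) H x) {η : ℝ}
    (hη : 0 < η) : ∀ᶠ h in 𝓝 (0 : Space N),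
      |f (x + h) - f x - inner ℝ (gradient f x) h - 1 / 2 * inner ℝ (H h) h| ≤ η * ‖h‖ ^ 2 := by
  have h1 : ∀ᶠ y in 𝓝 x, DifferentiableAt ℝ f y ∧
      ‖gradient f y - gradient f x - H (y - x)‖ ≤ η * ‖y - x‖ :=
    hf.and (hH.isLittleO.bound hη)
  obtain ⟨R, hR, hball⟩ := Metric.eventually_nhds_iff.1 h1
  filter_upwards [Metric.ball_mem_nhds (0 : Space N) hR] with h hh
  rw [mem_ball_zero_iff] at hh
  have hmem : ∀ s ∈ Icc (0 : ℝ) 1, dist (x + s • h) x < R := by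
    intro s hs
    rw [dist_self_add_left, norm_smul, Real.norm_eq_abs, abs_of_nonneg hs.1]
    exact (mul_le_of_le_one_left (norm_nonneg _) hs.2).trans_lt hh
  set g : ℝ → ℝ := fun s => f (x + s • h) - s * inner ℝ (gradient f x) h -
    s ^ 2 / 2 * inner ℝ (H h) h with hg
  have hderiv : ∀ s ∈ Icc (0 : ℝ) 1, HasDerivWithinAt g
      (inner ℝ (gradient f (x + s • h) - gradient f x - H (s • h)) h) (Icc 0 1) s := by
    intro s hs
    have h2 := (hball (hmem s hs)).1.hasGradientAt.hasFDerivAt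
    have h3 : HasDerivAt (fun s : ℝ => x + s • h) h s := by
      simpa using ((hasDerivAt_id s).smul_const h).const_add x
    have h4 : HasDerivAt (fun s : ℝ => f (x + s • h))
        (inner ℝ (gradient f (x + s • h)) h) s :=
      (h2.comp_hasDerivAt s h3).congr_deriv (InnerProductSpace.toDual_apply_apply ..)
    have h5 : HasDerivAt (fun s : ℝ => s * inner ℝ (gradient f x) h)
        (inner ℝ (gradient f x) h) s := by
      simpa using (hasDerivAt_id s).mul_const (inner ℝ (gradient f x) h)
    have h6 : HasDerivAt (fun s : ℝ => s ^ 2 / 2 * inner ℝ (H h) h)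
        (s * inner ℝ (H h) h) s := by
      have := (((hasDerivAt_id s).pow 2).div_const 2).mul_const (inner ℝ (H h) h)
      refine this.congr_deriv ?_
      simp
    refine ((h4.sub h5).sub h6).hasDerivWithinAt.congr_deriv ?_
    rw [inner_sub_left, inner_sub_left, map_smul, real_inner_smul_left]
  have hbound := norm_image_sub_le_of_norm_deriv_le_segment_01' (C := η * ‖h‖ ^ 2) hderiv
    (fun s hs => by
      have hs' := Ico_subset_Icc_self hs
      have h7 := (hball (hmem s hs')).2
      rw [add_sub_cancel_left] at h7
      calc ‖inner ℝ (gradient f (x + s • h) - gradient f x - H (s • h)) h‖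
          ≤ ‖gradient f (x + s • h) - gradient f x - H (s • h)‖ * ‖h‖ := norm_inner_le_norm _ _
        _ ≤ η * ‖s • h‖ * ‖h‖ := by gcongr
        _ ≤ η * (1 * ‖h‖) * ‖h‖ := by
            rw [norm_smul, Real.norm_eq_abs, abs_of_nonneg hs'.1]
            gcongr
            exact hs'.2
        _ = η * ‖h‖ ^ 2 := by ring)
  have hval : g 1 - g 0 =
      f (x + h) - f x - inner ℝ (gradient f x) h - 1 / 2 * inner ℝ (H h) h := by
    simp only [hg]
    simp
    ring
  rwa [hval, Real.norm_eq_abs] at hbound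

/-- `φ` has at `(x, t)` the parabolic second order expansion with gradient `a`, Hessian `H` and time
derivative `θ`, uniformly on heat balls. -/
structure HasParabolicExpansion (φ : Space N × ℝ → ℝ) (x : Space N) (t : ℝ) (a : Space N)
    (H : Space N →L[ℝ] Space N) (θ : ℝ) : Prop where
  continuousOn : ∀ᶠ ε in 𝓝[>] (0 : ℝ), ContinuousOn φ (closure (heatBall ε x t))
  error_le : ∀ η : ℝ, 0 < η → ∀ᶠ ε in 𝓝[>] (0 : ℝ), ∀ q ∈ chartDomain N,
    |φ (chart ε x t q) - φ (x, t) - ε * linPart a q - ε ^ 2 * quadPart H θ q| ≤ η * ε ^ 2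

lemma HasParabolicExpansion.neg {φ : Space N × ℝ → ℝ} {x : Space N} {t : ℝ} {a : Space N}
    {H : Space N →L[ℝ] Space N} {θ : ℝ} (h : HasParabolicExpansion φ x t a H θ) :
    HasParabolicExpansion (fun q => -φ q) x t (-a) (-H) (-θ) := by
  refine ⟨h.continuousOn.mono fun ε hε => hε.neg, fun η hη => ?_⟩
  filter_upwards [h.error_le η hη] with ε hε q hq
  rw [← abs_neg]
  refine le_of_eq_of_le ?_ (hε q hq)
  congr 1
  simp only [linPart, quadPart, inner_neg_left, neg_apply]
  ring

lemma eventually_closedBall_prod_subset (x : Space N) (t C : ℝ)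
    {U : Set (Space N × ℝ)} (hU : U ∈ 𝓝 (x, t)) :
    ∀ᶠ ε in 𝓝[>] (0 : ℝ), Metric.closedBall x (ε * C) ×ˢ Metric.closedBall t (ε ^ 2) ⊆ U := by
  obtain ⟨R, hR, hball⟩ := Metric.mem_nhds_iff.1 hU
  have h1 : Tendsto (fun ε : ℝ => ε * C) (𝓝[>] 0) (𝓝 0) := by
    have h : Tendsto (fun ε : ℝ => ε * C) (𝓝 0) (𝓝 (0 * C)) :=
      (continuous_id.mul continuous_const).tendsto 0
    rw [zero_mul] at h
    exact h.mono_left nhdsWithin_le_nhds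
  have h2 : Tendsto (fun ε : ℝ => ε ^ 2) (𝓝[>] 0) (𝓝 0) := by
    have h : Tendsto (fun ε : ℝ => ε ^ 2) (𝓝 0) (𝓝 (0 ^ 2)) := (continuous_pow 2).tendsto 0
    rw [zero_pow two_ne_zero] at h
    exact h.mono_left nhdsWithin_le_nhds
  filter_upwards [h1.eventually_lt_const hR, h2.eventually_lt_const hR] with ε h3 h4
  rintro ⟨y, s⟩ ⟨hy, hs⟩
  apply hball
  rw [Metric.mem_ball, Prod.dist_eq]
  exact max_lt ((Metric.mem_closedBall.1 hy).trans_lt h3) ((Metric.mem_closedBall.1 hs).trans_lt h4)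

lemma hasFDerivAt_gradient {f : Space N → ℝ} {x : Space N} (hf : ContDiffAt ℝ 2 f x) :
    HasFDerivAt (gradient f) (fderiv ℝ (gradient f) x) x := by
  have h1 : DifferentiableAt ℝ (fderiv ℝ f) x :=
    (hf.fderiv_right (m := 1) (by norm_num)).differentiableAt (by norm_num)
  have h2 : DifferentiableAt ℝ (gradient f) x :=
    (InnerProductSpace.toDual ℝ (Space N)).symm.toContinuousLinearEquiv.differentiableAt.comp x h1
  exact h2.hasFDerivAt

lemma hasParabolicExpansion_of_contDiffAt (hN : 1 ≤ N) {φ : Space N × ℝ → ℝ} {x : Space N} {t : ℝ}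
    (hφ : ContDiffAt ℝ 2 φ (x, t)) :
    HasParabolicExpansion φ x t (spatialGradient φ x t)
      (fderiv ℝ (gradient fun y => φ (y, t)) x) (timeDeriv φ x t) := by
  constructor
  · have h1 : ∀ᶠ q in 𝓝 (x, t), ContinuousAt φ q :=
      (hφ.eventually (by simp)).mono fun q hq => hq.continuousAt
    filter_upwards [eventually_closedBall_prod_subset x t (√(maxRadiusSq N)) h1,
      self_mem_nhdsWithin] with ε hε hε0 q hq
    refine ContinuousAt.continuousWithinAt (hε ?_)
    exact closure_minimal (heatBall_subset_prod hN hε0 x t)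
      (Metric.isClosed_closedBall.prod Metric.isClosed_closedBall) hq
  · intro η hη
    set f : Space N → ℝ := fun y => φ (y, t) with hf
    set a := spatialGradient φ x t with ha
    set H := fderiv ℝ (gradient f) x with hH
    have hfc : ContDiffAt ℝ 2 f x :=
      ContDiffAt.comp x hφ (contDiffAt_id.prodMk contDiffAt_const)
    have hR := maxRadiusSq_pos hN
    set η₁ := η / (2 * maxRadiusSq N) with hη₁
    have hη₁0 : 0 < η₁ := by positivity
    have htay := eventually_abs_taylor_two_le
      ((hfc.eventually (by simp)).mono fun y hy => hy.differentiableAt (by norm_num))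
      (hasFDerivAt_gradient hfc) hη₁0
    -- strict differentiability controls the increment in time at the shifted point
    have hstrict : HasStrictFDerivAt φ (fderiv ℝ φ (x, t)) (x, t) :=
      hφ.hasStrictFDerivAt (by norm_num)
    have hθ : timeDeriv φ x t = fderiv ℝ φ (x, t) (0, 1) := by
      have h1 : HasDerivAt (fun s : ℝ => (x, s)) ((0 : Space N), (1 : ℝ)) t :=
        (hasDerivAt_const t x).prodMk (hasDerivAt_id t)
      exact (hstrict.hasFDerivAt.comp_hasDerivAt t h1).deriv
    have hη2 : 0 < η / 2 := by positivity
    obtain ⟨U, hU, hUb⟩ : ∃ U ∈ 𝓝 (x, t), ∀ u ∈ U, ∀ v ∈ U,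
        ‖φ u - φ v - fderiv ℝ φ (x, t) (u - v)‖ ≤ η / 2 * ‖u - v‖ := by
      have h1 := hstrict.isLittleO.bound hη2
      rw [nhds_prod_eq] at h1
      obtain ⟨U, hU, h2⟩ := Filter.mem_prod_self_iff.1 h1
      exact ⟨U, hU, fun u hu v hv => h2 (⟨hu, hv⟩ : (u, v) ∈ U ×ˢ U)⟩
    have htay' : {h : Space N | |f (x + h) - f x - inner ℝ (gradient f x) h -
        1 / 2 * inner ℝ (H h) h| ≤ η₁ * ‖h‖ ^ 2} ∈ 𝓝 (0 : Space N) := htay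
    have hV : {q : Space N × ℝ | |f (x + q.1) - f x - inner ℝ (gradient f x) q.1 -
        1 / 2 * inner ℝ (H q.1) q.1| ≤ η₁ * ‖q.1‖ ^ 2} ∈ 𝓝 ((0 : Space N), (0 : ℝ)) :=
      (continuous_fst.tendsto ((0 : Space N), (0 : ℝ))) htay'
    filter_upwards [eventually_closedBall_prod_subset x t (√(maxRadiusSq N)) hU,
      eventually_closedBall_prod_subset 0 0 (√(maxRadiusSq N)) hV, self_mem_nhdsWithin]
      with ε h1 h2 hε0 q hq
    have hε : 0 < ε := hε0
    have hmem := heatBall_subset_prod hN hε x t (chart_mem_heatBall hN hε x t hq)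
    simp only [chart] at hmem ⊢
    set ρ := ε * (q.2 * profile q.1) with hρ
    have hρ0 : 0 ≤ ρ := by
      have := hq.2.1
      have := profile_pos q.1
      positivity
    have hy : x + ρ • q.1 ∈ Metric.closedBall x (ε * √(maxRadiusSq N)) := hmem.1
    have hs : t - ρ ^ 2 ∈ Metric.closedBall t (ε ^ 2) := hmem.2
    have hnorm : ‖ρ • q.1‖ ≤ ε * √(maxRadiusSq N) := by
      simpa [dist_self_add_left] using hy
    have hρ2 : ρ ^ 2 ≤ ε ^ 2 := by
      simpa [Real.dist_eq] using hs
    have hu := hUb (x + ρ • q.1, t - ρ ^ 2) (h1 (mk_mem_prod hy hs)) (x + ρ • q.1, t)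
      (h1 (mk_mem_prod hy (Metric.mem_closedBall_self (sq_nonneg ε))))
    have hdiff : ((x + ρ • q.1, t - ρ ^ 2) : Space N × ℝ) - (x + ρ • q.1, t) =
        (-ρ ^ 2) • ((0 : Space N), (1 : ℝ)) := by
      ext <;> simp
    have hnd : ‖(-ρ ^ 2) • ((0 : Space N), (1 : ℝ))‖ = ρ ^ 2 := by
      rw [norm_smul, norm_neg, norm_pow, Real.norm_eq_abs, sq_abs]
      simp
    rw [hdiff, hnd, map_smul, ← hθ, smul_eq_mul, Real.norm_eq_abs] at hu
    have hv : |f (x + ρ • q.1) - f x - inner ℝ (gradient f x) (ρ • q.1) -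
        1 / 2 * inner ℝ (H (ρ • q.1)) (ρ • q.1)| ≤ η₁ * ‖ρ • q.1‖ ^ 2 :=
      h2 (mk_mem_prod (mem_closedBall_zero_iff.2 hnorm) (Metric.mem_closedBall_self (sq_nonneg ε)))
    have hv2 : η₁ * ‖ρ • q.1‖ ^ 2 ≤ η / 2 * ε ^ 2 := by
      calc η₁ * ‖ρ • q.1‖ ^ 2 ≤ η₁ * (ε * √(maxRadiusSq N)) ^ 2 := by gcongr
        _ = η / 2 * ε ^ 2 := by
            rw [mul_pow, Real.sq_sqrt hR.le, hη₁]
            field_simp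
    have hsum : φ (x + ρ • q.1, t - ρ ^ 2) - φ (x, t) - ε * linPart a q -
        ε ^ 2 * quadPart H (timeDeriv φ x t) q =
        (φ (x + ρ • q.1, t - ρ ^ 2) - φ (x + ρ • q.1, t) - -ρ ^ 2 * timeDeriv φ x t) +
        (f (x + ρ • q.1) - f x - inner ℝ (gradient f x) (ρ • q.1) -
          1 / 2 * inner ℝ (H (ρ • q.1)) (ρ • q.1)) := by
      have ha' : gradient (fun y => φ (y, t)) x = a := rfl
      simp only [linPart, quadPart, map_smul, real_inner_smul_left, real_inner_smul_right, hf, ha',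
        hρ]
      ring
    rw [hsum]
    refine (abs_add_le _ _).trans ?_
    have h5 : η / 2 * ρ ^ 2 ≤ η / 2 * ε ^ 2 := by gcongr
    linarith

end Expansion

section Operator

variable {N : ℕ}

lemma sum_inner_single_mul (v w : Space N) :
    ∑ i, inner ℝ v (EuclideanSpace.single i (1 : ℝ)) * w i = inner ℝ v w := by
  simp [PiLp.inner_apply, mul_comm]

/-- The product rule for the divergence, with `|∇f|^{p-2} = (|∇f|²)^{(p-2)/2}`. -/
lemma normalizedPLaplacian_eq {f : Space N → ℝ} {x : Space N} (hf : ContDiffAt ℝ 2 f x)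
    (hx : gradient f x ≠ 0) (p : ℝ) :
    normalizedPLaplacian p f x =
      LinearMap.trace ℝ _ (fderiv ℝ (gradient f) x : Space N →ₗ[ℝ] Space N) +
        (p - 2) * (inner ℝ (fderiv ℝ (gradient f) x (gradient f x)) (gradient f x) /
          ‖gradient f x‖ ^ 2) := by
  have hH := hasFDerivAt_gradient hf
  set H := fderiv ℝ (gradient f) x with hHdef
  set a := gradient f x with ha
  have ha0 : 0 < ‖a‖ := norm_pos_iff.2 hx
  have h1 : HasFDerivAt (fun y => (‖gradient f y‖ ^ 2) ^ ((p - 2) / 2))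
      (((p - 2) / 2 * (‖a‖ ^ 2) ^ ((p - 2) / 2 - 1)) • (2 • (innerSL ℝ a).comp H)) x :=
    hH.norm_sq.rpow_const (Or.inl (by positivity))
  have e1 : ∀ y, (‖gradient f y‖ ^ 2) ^ ((p - 2) / 2) = ‖gradient f y‖ ^ (p - 2) := by
    intro y
    rw [← Real.rpow_two, ← Real.rpow_mul (norm_nonneg _)]
    congr 1; ring
  have e2 : (‖a‖ ^ 2) ^ ((p - 2) / 2 - 1) = ‖a‖ ^ (p - 2) / ‖a‖ ^ 2 := by
    rw [← Real.rpow_two, ← Real.rpow_mul (norm_nonneg _), ← Real.rpow_sub ha0]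
    congr 1; ring
  simp_rw [e1] at h1
  have h2 : HasFDerivAt (fun y => ‖gradient f y‖ ^ (p - 2) • gradient f y) _ x := h1.smul hH
  have h3 : ∀ i, (fderiv ℝ (fun y => ‖gradient f y‖ ^ (p - 2) • gradient f y) x
      (EuclideanSpace.single i 1)) i = ‖a‖ ^ (p - 2) * (H (EuclideanSpace.single i 1)) i +
      (p - 2) * (‖a‖ ^ (p - 2) / ‖a‖ ^ 2) *
        (inner ℝ (H.adjoint a) (EuclideanSpace.single i (1 : ℝ)) * a i) := by
    intro i
    rw [h2.fderiv, ContinuousLinearMap.adjoint_inner_left, e2]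
    simp
    ring
  have htr : LinearMap.trace ℝ _ (H : Space N →ₗ[ℝ] Space N) =
      ∑ i, (H (EuclideanSpace.single i 1)) i := by
    rw [LinearMap.trace_eq_sum_inner _ (EuclideanSpace.basisFun (Fin N) ℝ)]
    refine Finset.sum_congr rfl fun i _ => ?_
    simp [EuclideanSpace.inner_single_left]
  rw [normalizedPLaplacian, divergence]
  simp_rw [h3]
  rw [Finset.sum_add_distrib, ← Finset.mul_sum, ← Finset.mul_sum, sum_inner_single_mul,
    ContinuousLinearMap.adjoint_inner_left, ← htr, real_inner_comm]
  have h4 : 0 < ‖a‖ ^ (p - 2) := by positivity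
  rw [← ha]
  field_simp

lemma scaledPLaplacian_eq_modelOp {f : Space N → ℝ} {x : Space N} (hf : ContDiffAt ℝ 2 f x)
    (hx : gradient f x ≠ 0) (p : ℝ≥0∞) :
    scaledPLaplacian p f x = modelOp p (fderiv ℝ (gradient f) x) (gradient f x) := by
  rw [scaledPLaplacian, modelOp]
  split_ifs
  · rfl
  · rw [normalizedPLaplacian_eq hf hx]

lemma modelOp_neg (p : ℝ≥0∞) (H : Space N →L[ℝ] Space N) (a : Space N) :
    modelOp p (-H) (-a) = -modelOp p H a := by
  have h : LinearMap.trace ℝ _ ((-H : Space N →L[ℝ] Space N) : Space N →ₗ[ℝ] Space N) =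
      -LinearMap.trace ℝ _ (H : Space N →ₗ[ℝ] Space N) := by
    rw [ContinuousLinearMap.toLinearMap_neg, map_neg]
  simp only [modelOp, h, norm_neg, map_neg, neg_apply, inner_neg_left, inner_neg_right]
  split_ifs <;> ring

end Operator

/-! ### The asymptotic mean value property -/

section MeanValue

variable {N : ℕ}

lemma IsBestConstant.neg {p : ℝ≥0∞} {ε : ℝ} {φ : Space N × ℝ → ℝ} {x : Space N} {t m : ℝ}
    (h : IsBestConstant p ε φ x t m) : IsBestConstant p ε (fun q => -φ q) x t (-m) :=
  IsBestConst.neg (μ := heatMeasure ε x t) h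

/-- One-sided asymptotic expansion of the best constants of a function with nonvanishing spatial
gradient. -/
lemma exists_isBestConstant_sub_le (hN : 1 ≤ N) {p : ℝ≥0∞} (hp : 1 ≤ p)
    (hNp : ¬ (N = 1 ∧ p = 1)) {φ : Space N × ℝ → ℝ} {x : Space N} {t : ℝ} {a : Space N}
    (ha : a ≠ 0) {H : Space N →L[ℝ] Space N} {θ : ℝ} (h : HasParabolicExpansion φ x t a H θ) :
    ∃ c : ℝ, 0 < c ∧ ∀ δ : ℝ, 0 < δ → ∀ᶠ ε in 𝓝[>] (0 : ℝ), ∀ m, IsBestConstant p ε φ x t m →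
      m - φ (x, t) ≤ ε ^ 2 * (c * (modelOp p H a - θ) + δ) := by
  obtain ⟨c, hc, hub⟩ := exists_upperBound hN hp hNp ha H θ
  refine ⟨c, hc, fun δ hδ => ?_⟩
  filter_upwards [hub (δ / 2) (by positivity), h.continuousOn, h.error_le (δ / 2) (by positivity),
    self_mem_nhdsWithin] with ε hε hcont herr hε0 m hm
  have hε' : 0 < ε := hε0
  have hmaps : MapsTo (chart ε x t) (chartDomain N) (closure (heatBall ε x t)) := fun q hq =>
    subset_closure (chart_mem_heatBall hN hε' x t hq)
  obtain ⟨B, hB⟩ := (isCompact_closure_heatBall hN hε' x t).exists_bound_of_continuousOn hcont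
  have hbest := ((isBestConstant_iff hN hε' x t (hcont.mono subset_closure) m).1 hm).affine
    (φ (x, t)) (inv_ne_zero hε'.ne')
  have h1 := hε (fun q => ε⁻¹ * (φ (chart ε x t q) - φ (x, t))) _
    (((hcont.comp (continuous_chart ε x t).continuousOn hmaps).sub
    continuousOn_const).const_smul ε⁻¹) ⟨ε⁻¹ * (B + |φ (x, t)|), fun q hq => ?_⟩
    (fun q hq => ?_) hbest
  · rw [inv_mul_le_iff₀ hε'] at h1
    refine h1.trans_eq ?_
    ring
  · rw [abs_mul, abs_of_pos (inv_pos.2 hε')]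
    gcongr
    exact (abs_sub _ _).trans (add_le_add_left (hB _ (hmaps hq)) _)
  · rw [inv_mul_le_iff₀ hε']
    have := (abs_le.1 (herr q hq)).2
    linarith

/-- The increment of the heat `p`-mean over the value at the centre lies, up to `o(ε²)`, between two
positive multiples of `ε²` times the defect in the equation. The lower bound is the upper bound for
`-φ`; that the two constants agree is not needed, since only the sign of the defect matters. -/
lemma exists_heatPMean_bounds (hN : 1 ≤ N) {p : ℝ≥0∞} (hp : 1 ≤ p) (hNp : ¬ (N = 1 ∧ p = 1))
    {φ : Space N × ℝ → ℝ} {x : Space N} {t : ℝ} (hφ : ContDiffAt ℝ 2 φ (x, t))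
    (hx : spatialGradient φ x t ≠ 0) :
    ∃ c d : ℝ, 0 < c ∧ 0 < d ∧ ∀ δ : ℝ, 0 < δ → ∀ᶠ ε in 𝓝[>] (0 : ℝ),
      heatPMean p ε φ x t - φ (x, t) ≤
        ε ^ 2 * (c * (scaledPLaplacian p (fun y => φ (y, t)) x - timeDeriv φ x t) + δ) ∧
      ε ^ 2 * (d * (scaledPLaplacian p (fun y => φ (y, t)) x - timeDeriv φ x t) - δ) ≤
        heatPMean p ε φ x t - φ (x, t) := by
  have hexp := hasParabolicExpansion_of_contDiffAt hN hφ
  have hfc : ContDiffAt ℝ 2 (fun y => φ (y, t)) x :=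
    ContDiffAt.comp x hφ (contDiffAt_id.prodMk contDiffAt_const)
  have hop := scaledPLaplacian_eq_modelOp hfc hx p
  obtain ⟨c, hc, hc'⟩ := exists_isBestConstant_sub_le hN hp hNp hx hexp
  obtain ⟨d, hd, hd'⟩ := exists_isBestConstant_sub_le hN hp hNp (neg_ne_zero.2 hx) hexp.neg
  refine ⟨c, d, hc, hd, fun δ hδ => ?_⟩
  filter_upwards [hc' δ hδ, hd' δ hδ, hexp.continuousOn, self_mem_nhdsWithin]
    with ε h1 h2 hcont hε0
  have hbest := isBestConstant_heatPMean hN hε0 x t hcont hp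
  have h3 := h1 _ hbest
  have h4 := h2 _ hbest.neg
  rw [modelOp_neg] at h4
  rw [hop]
  refine ⟨h3, ?_⟩
  have h5 : (modelOp p (fderiv ℝ (gradient fun y => φ (y, t)) x) (spatialGradient φ x t)) =
    modelOp p (fderiv ℝ (gradient fun y => φ (y, t)) x) (gradient (fun y => φ (y, t)) x) := rfl
  rw [h5] at h4
  linarith

/-- A bound from above by arbitrarily small multiples of `ε²` is a bound by some `o(ε²)`. -/
lemma exists_isLittleO_of_forall_le {g : ℝ → ℝ}
    (h : ∀ δ : ℝ, 0 < δ → ∀ᶠ ε in 𝓝[>] (0 : ℝ), g ε ≤ δ * ε ^ 2) :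
    ∃ r : ℝ → ℝ, Asymptotics.IsLittleO (𝓝[>] (0 : ℝ)) r (fun ε => ε ^ 2) ∧ ∀ ε, g ε ≤ r ε := by
  refine ⟨fun ε => max (g ε) 0, Asymptotics.isLittleO_iff.2 fun δ hδ => ?_,
    fun ε => le_max_left _ _⟩
  filter_upwards [h δ hδ] with ε hε
  rw [Real.norm_of_nonneg (le_max_right _ _), Real.norm_of_nonneg (sq_nonneg ε)]
  exact max_le hε (by positivity)

lemma nonpos_of_mul_sq_le_isLittleO {k : ℝ} {r : ℝ → ℝ}
    (hr : Asymptotics.IsLittleO (𝓝[>] (0 : ℝ)) r (fun ε => ε ^ 2))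
    (h : ∀ δ : ℝ, 0 < δ → ∀ᶠ ε in 𝓝[>] (0 : ℝ), ε ^ 2 * (k - δ) ≤ r ε) : k ≤ 0 := by
  by_contra! hk
  obtain ⟨ε, h1, h2, hε⟩ := ((h (k / 3) (by positivity)).and
    ((hr.bound (show 0 < k / 3 by positivity)).and self_mem_nhdsWithin)).exists
  have hε' : (0 : ℝ) < ε := hε
  have h3 : 0 < ε ^ 2 := by positivity
  have h4 := (le_abs_self (r ε)).trans h2
  rw [Real.norm_of_nonneg h3.le] at h4
  nlinarith [mul_pos h3 hk]

/-- The differential inequality for lower test functions is equivalent to the asymptotic mean value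
inequality. -/
lemma supersolution_iff_of_contDiffAt (hN : 1 ≤ N) {p : ℝ≥0∞} (hp : 1 ≤ p)
    (hNp : ¬ (N = 1 ∧ p = 1)) {φ : Space N × ℝ → ℝ} {x : Space N} {t : ℝ}
    (hφ : ContDiffAt ℝ 2 φ (x, t)) (hx : spatialGradient φ x t ≠ 0) :
    scaledPLaplacian p (fun y => φ (y, t)) x ≤ timeDeriv φ x t ↔
      ∃ r : ℝ → ℝ, Asymptotics.IsLittleO (𝓝[>] (0 : ℝ)) r (fun ε => ε ^ 2) ∧
        ∀ᶠ ε in 𝓝[>] (0 : ℝ), φ (x, t) ≥ heatPMean p ε φ x t + r ε := by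
  obtain ⟨c, d, hc, hd, hb⟩ := exists_heatPMean_bounds hN hp hNp hφ hx
  constructor
  · intro hA
    obtain ⟨r, hr, hle⟩ := exists_isLittleO_of_forall_le
      (g := fun ε => heatPMean p ε φ x t - φ (x, t)) fun δ hδ => by
        filter_upwards [hb δ hδ] with ε hε
        refine hε.1.trans ?_
        rw [mul_comm δ]
        gcongr
        have := mul_nonneg hc.le (sub_nonneg.2 hA)
        linarith
    refine ⟨fun ε => -r ε, hr.neg_left, Eventually.of_forall fun ε => ?_⟩
    have := hle ε
    linarith
  · rintro ⟨r, hr, hle⟩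
    have h := nonpos_of_mul_sq_le_isLittleO hr.neg_left
      (k := d * (scaledPLaplacian p (fun y => φ (y, t)) x - timeDeriv φ x t)) fun δ hδ => by
        filter_upwards [hb δ hδ, hle] with ε hε h1
        have := hε.2
        linarith
    exact sub_nonpos.1 (nonpos_of_mul_nonpos_right h hd)

/-- The differential inequality for upper test functions is equivalent to the asymptotic mean value
inequality. -/
lemma subsolution_iff_of_contDiffAt (hN : 1 ≤ N) {p : ℝ≥0∞} (hp : 1 ≤ p)
    (hNp : ¬ (N = 1 ∧ p = 1)) {φ : Space N × ℝ → ℝ} {x : Space N} {t : ℝ}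
    (hφ : ContDiffAt ℝ 2 φ (x, t)) (hx : spatialGradient φ x t ≠ 0) :
    timeDeriv φ x t ≤ scaledPLaplacian p (fun y => φ (y, t)) x ↔
      ∃ r : ℝ → ℝ, Asymptotics.IsLittleO (𝓝[>] (0 : ℝ)) r (fun ε => ε ^ 2) ∧
        ∀ᶠ ε in 𝓝[>] (0 : ℝ), φ (x, t) ≤ heatPMean p ε φ x t + r ε := by
  obtain ⟨c, d, hc, hd, hb⟩ := exists_heatPMean_bounds hN hp hNp hφ hx
  constructor
  · intro hA
    obtain ⟨r, hr, hle⟩ := exists_isLittleO_of_forall_le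
      (g := fun ε => φ (x, t) - heatPMean p ε φ x t) fun δ hδ => by
        filter_upwards [hb δ hδ] with ε hε
        have h1 := mul_nonneg (sq_nonneg ε) (mul_nonneg hd.le (sub_nonneg.2 hA))
        have h2 := hε.2
        rw [mul_sub] at h2
        linarith
    refine ⟨r, hr, Eventually.of_forall fun ε => ?_⟩
    have := hle ε
    linarith
  · rintro ⟨r, hr, hle⟩
    have h := nonpos_of_mul_sq_le_isLittleO hr
      (k := c * (timeDeriv φ x t - scaledPLaplacian p (fun y => φ (y, t)) x)) fun δ hδ => by
        filter_upwards [hb δ hδ, hle] with ε hε h1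
        have := hε.1
        linarith
    exact sub_nonpos.1 (nonpos_of_mul_nonpos_right h hc)

end MeanValue

end HeatMean

end

theorem theorem1p2 (N : ℕ) (hN : 1 ≤ N) (p : ℝ≥0∞) (hp : 1 ≤ p) (hNp : ¬ (N = 1 ∧ p = 1))
    (Ω : Set (HeatMean.Space N)) (hΩ : IsOpen Ω) (T : ℝ) (hT : 0 < T)
    (u : HeatMean.Space N × ℝ → ℝ) (hu : ContinuousOn u (Ω ×ˢ Set.Ioo 0 T)) :
    (∀ (x : HeatMean.Space N) (t ε : ℝ), 0 < ε → ∀ φ : HeatMean.Space N × ℝ → ℝ,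
      ContinuousOn φ (closure (HeatMean.heatBall ε x t)) →
        ∃! m : ℝ, HeatMean.IsBestConstant p ε φ x t m) ∧
    (HeatMean.IsViscositySolution p Ω T u ↔
      ∀ x ∈ Ω, ∀ t ∈ Set.Ioo 0 T, HeatMean.ViscosityAMVP p u x t) := by
  refine ⟨fun x t ε hε φ hφ => HeatMean.existsUnique_isBestConstant hN hε x t hφ hp, ?_⟩
  refine forall₄_congr fun x _ t _ => and_congr ?_ ?_
  · exact forall₂_congr fun φ hφ =>
      HeatMean.supersolution_iff_of_contDiffAt hN hp hNp hφ.1 hφ.2.2.2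
  · exact forall₂_congr fun φ hφ =>
      HeatMean.subsolution_iff_of_contDiffAt hN hp hNp hφ.1 hφ.2.2.2
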